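/- \textbf{Lemma (stabilised inf-sup condition).} \emph{Setting.} Let $d\in\{2,3\}$, $k\ge 2$, and let $\widetilde\Omega\subset\mathbb{R}^d$ be a bounded domain. Let $\sigma,q,c,\rho>0$ and $M\in\mathbb{R}$. A \emph{mesh of size $h$} is a finite conforming simplicial mesh $\widetilde{\mathcal T}_h$ of $\widetilde\Omega$ (closed $d$-simplices with union $\overline{\widetilde\Omega}$), which is shape-regular (each $T$ contains a ball of radius $\sigma\operatorname{diam}T$) and quasi-uniform ($qh\le\operatorname{diam}T\le h$ for each $T$). A \emph{level set function} $\phi$ is smooth on $\widetilde\Omega$ and defines $\Omega_h^n=\{x\in\widetilde\Omega:\phi(x)<0\}$ and $\Gamma_h^n=\{x\in\widetilde\Omega:\phi(x)=0\}$; it is such that for every $x\in\Gamma_h^n$ the ball $B_\rho(x)$ lies in $\widetilde\Omega$, $\|\nabla\phi(x)\|_2\ge c$, and $\|D^2\phi\|\le M$ on $B_\rho(x)$. Put $\bm n=-\nabla\phi/\|\nabla\phi\|_2$. For $\delta_h\ge 0$, let $\mathcal{T}^n_{h,\delta_h}$ be the set of those $T\in\widetilde{\mathcal T}_h$ that contain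 a point $x$ with $\operatorname{dist}(x,\Omega_h^n)\le\delta_h$, let $\mathcal{T}^n_{h,\Gamma_h^n}$ be the set of those $T$ with $\operatorname{meas}_{d-1}(T\cap\Gamma_h^n)>0$, and let $\mathcal O^n_{\delta_h,\mathcal T}$ and $\mathcal O^n_{\Gamma_h^n}$ be the unions of their elements. Let \[ V_h^n=\{v\in C^0(\mathcal O^n_{\delta_h,\mathcal T})^d : v|_T\in\mathbb P^k(T)^d\ \ \forall\, T\in\mathcal{T}^n_{h,\delta_h}\}, \] \[ N_h^n=\{\mu\in C^0(\mathcal O^n_{\Gamma_h^n})^d : \mu|_T\in\mathbb P^{k-1}(T)^d\ \ \forall\, T\in\mathcal{T}^n_{h,\Gamma_h^n}\}, \] \[ b_h^n(\lambda_h,v_h)=\int_{\Gamma_h^n}\lambda_h\cdot v_h\,ds,\qquad j_h^n(\lambda_h,\mu_h)=h^2\int_{\mathcal O^n_{\Gamma_h^n}}(\bm n\cdot\nabla\lambda_h)\cdot(\bm n\cdot\nabla\mu_h)\,dx, \] \[ |||v_h|||^2=\|\nabla v_h\|^2_{L^2(\mathcal O^n_{\delta_h,\mathcal T})}+\|h^{-1/2}v_h\|^2_{L^2(\Gamma_h^n)},\qquad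 |||\lambda_h|||^2=\|h^{1/2}\lambda_h\|^2_{L^2(\Gamma_h^n)}+\|h\,\bm n\cdot\nabla\lambda_h\|^2_{L^2(\mathcal O^n_{\Gamma_h^n})}. \] \emph{Claim.} There are $\beta>0$ and $h_0>0$, depending only on $d$, $k$, $\widetilde\Omega$, $\sigma$, $q$, $c$, $M$, $\rho$, such that for every $0<h\le h_0$, every mesh of size $h$, every level set function $\phi$ and every $\delta_h\ge0$ as above, and for all $\lambda_h\in N_h^n$, the following supremum is finite and \[ \beta\,|||\lambda_h|||\ \le\ \sup_{v_h\in V_h^n,\ |||v_h|||\neq0}\frac{b_h^n(\lambda_h,v_h)}{|||v_h|||}+j_h^n(\lambda_h,\lambda_h)^{1/2}. \] In particular $\beta$ is independent of $h$, of the strip width $\delta_h$ and of the position of the interface relative to the mesh. -/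

import Mathlib

open MeasureTheory
open scoped ContDiff

noncomputable section

namespace UnfittedFEM

/-- The ambient Euclidean space `ℝᵈ`. -/
abbrev E (d : ℕ) : Type := EuclideanSpace ℝ (Fin d)

variable {d : ℕ}

/-! ### Geometry: level set, interface, normal field -/

/-- The interface `Γ = {x ∈ Ω̃ | φ x = 0}`. -/
def interface (bg : Set (E d)) (φ : E d → ℝ) : Set (E d) := {x | x ∈ bg ∧ φ x = 0}

/-- The physical (bulk) domain `Ω = {x ∈ Ω̃ | φ x < 0}`. -/
def bulk (bg : Set (E d)) (φ : E d → ℝ) : Set (E d) := {x | x ∈ bg ∧ φ x < 0}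

/-- The extended normal field `n = - ∇φ / ‖∇φ‖`. -/
def normal (φ : E d → ℝ) (x : E d) : E d := -(‖gradient φ x‖⁻¹ • gradient φ x)

/-- `φ` is a smooth level set function on the background domain `bg`, whose interface keeps the
distance `ρ` to the outer boundary, on which `‖∇φ‖ ≥ c`, and with second derivative bounded by
`M` in the `ρ`-neighbourhood of the interface. For a single smooth level set function with compact
interface in `bg` and nonvanishing gradient on it, such `c`, `M`, `ρ` exist; keeping the
three numbers fixed makes the class uniform, e.g. over all translates of one body that stay away
from the outer boundary. -/
structure IsLevelSet (bg : Set (E d)) (c M ρ : ℝ) (φ : E d → ℝ) : Prop where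
  smooth : ContDiffOn ℝ ∞ φ bg
  clearance : ∀ x ∈ interface bg φ, Metric.ball x ρ ⊆ bg
  regular : ∀ x ∈ interface bg φ, c ≤ ‖gradient φ x‖
  curvature : ∀ x ∈ interface bg φ, ∀ y ∈ Metric.ball x ρ, ‖iteratedFDeriv ℝ 2 φ y‖ ≤ M

/-! ### Meshes -/

/-- The (closed) elements of a simplicial complex: the convex hulls of its `d`-simplices. -/
def elements (𝒦 : Geometry.SimplicialComplex ℝ (E d)) : Set (Set (E d)) :=
  {T | ∃ s ∈ 𝒦.faces, s.card = d + 1 ∧ T = convexHull ℝ (s : Set (E d))}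

/-- `𝒦` is a (conforming) simplicial mesh of the background domain `bg` of characteristic size `h`,
shape-regular with constant `σ` and quasi-uniform with constant `q`. -/
structure IsMesh (bg : Set (E d)) (σ q h : ℝ) (𝒦 : Geometry.SimplicialComplex ℝ (E d)) :
    Prop where
  finite : 𝒦.faces.Finite
  covers : ⋃₀ elements 𝒦 = closure bg
  shapeRegular : ∀ T ∈ elements 𝒦, ∃ x, Metric.closedBall x (σ * Metric.diam T) ⊆ T
  quasiUniform : ∀ T ∈ elements 𝒦, q * h ≤ Metric.diam T ∧ Metric.diam T ≤ h

/-- The active mesh: elements with a point at distance at most `δ` from the bulk domain. -/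
def activeMesh (bg : Set (E d)) (φ : E d → ℝ) (δ : ℝ) (𝒦 : Geometry.SimplicialComplex ℝ (E d)) :
    Set (Set (E d)) :=
  {T | T ∈ elements 𝒦 ∧ ∃ x ∈ T, Metric.infDist x (bulk bg φ) ≤ δ}

/-- The interface elements: `meas_{d-1}(T ∩ Γ) > 0`. -/
def interfaceMesh (bg : Set (E d)) (φ : E d → ℝ) (𝒦 : Geometry.SimplicialComplex ℝ (E d)) :
    Set (Set (E d)) :=
  {T | T ∈ elements 𝒦 ∧ 0 < (μHE[d - 1] : Measure (E d)) (T ∩ interface bg φ)}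

/-! ### Finite element spaces -/

/-- On `T`, every component of `v` is a polynomial of total degree at most `m`. -/
def IsPolyOn (m : ℕ) (T : Set (E d)) (v : E d → E d) : Prop :=
  ∃ p : Fin d → MvPolynomial (Fin d) ℝ, (∀ i, (p i).totalDegree ≤ m) ∧
    ∀ x ∈ T, ∀ i, v x i = MvPolynomial.eval (fun j => x j) (p i)

/-- Continuous vector-valued functions on the union of the elements in `𝒯` that are polynomials of
degree at most `m` on each of them. A function is represented by an extension to `ℝᵈ` whose values
off the union are arbitrary (and are never used below). -/
def feSpace (m : ℕ) (𝒯 : Set (Set (E d))) : Set (E d → E d) :=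
  {v | ContinuousOn v (⋃₀ 𝒯) ∧ ∀ T ∈ 𝒯, IsPolyOn m T v}

/-- The velocity space `V_h` (degree `k`, on the active mesh). -/
def velocitySpace (bg : Set (E d)) (φ : E d → ℝ) (δ : ℝ) (k : ℕ)
    (𝒦 : Geometry.SimplicialComplex ℝ (E d)) : Set (E d → E d) :=
  feSpace k (activeMesh bg φ δ 𝒦)

/-- The multiplier space `N_h` (degree `k - 1`, on the interface elements). -/
def multiplierSpace (bg : Set (E d)) (φ : E d → ℝ) (k : ℕ)
    (𝒦 : Geometry.SimplicialComplex ℝ (E d)) : Set (E d → E d) :=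
  feSpace (k - 1) (interfaceMesh bg φ 𝒦)

/-! ### Forms and norms

Derivatives are the classical ones in the interior of each element, hence almost everywhere. -/

/-- `b_h(μ, v) = ∫_Γ μ · v ds`. -/
def formB (bg : Set (E d)) (φ : E d → ℝ) (μ v : E d → E d) : ℝ :=
  ∫ x in interface bg φ, inner ℝ (μ x) (v x) ∂(μHE[d - 1] : Measure (E d))

/-- `n · ∇μ`, the derivative of `μ` in the direction of the extended normal. -/
def normalDeriv (φ : E d → ℝ) (μ : E d → E d) (x : E d) : E d := fderiv ℝ μ x (normal φ x)

/-- `j_h(μ, η) = h² ∫ (n · ∇μ) · (n · ∇η) dx` over the interface elements. -/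
def formJ (bg : Set (E d)) (φ : E d → ℝ) (h : ℝ) (𝒦 : Geometry.SimplicialComplex ℝ (E d))
    (μ η : E d → E d) : ℝ :=
  h ^ 2 * ∫ x in ⋃₀ interfaceMesh bg φ 𝒦, inner ℝ (normalDeriv φ μ x) (normalDeriv φ η x)

/-- The squared Frobenius norm `|∇v(x)|²` of the Jacobian. -/
def gradSq (v : E d → E d) (x : E d) : ℝ :=
  ∑ j : Fin d, ‖fderiv ℝ v x (EuclideanSpace.single j 1)‖ ^ 2

/-- `|||v|||`, with `|||v|||² = ‖∇v‖²` over the active domain `+ ‖h^(-1/2) v‖²` over `Γ`. -/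
def velocityNorm (bg : Set (E d)) (φ : E d → ℝ) (δ h : ℝ)
    (𝒦 : Geometry.SimplicialComplex ℝ (E d)) (v : E d → E d) : ℝ :=
  Real.sqrt ((∫ x in ⋃₀ activeMesh bg φ δ 𝒦, gradSq v x) +
    h⁻¹ * ∫ x in interface bg φ, ‖v x‖ ^ 2 ∂(μHE[d - 1] : Measure (E d)))

/-- `|||μ|||`, with `|||μ|||² = ‖h^(1/2) μ‖²` over `Γ` plus `‖h n · ∇μ‖²` over the interface
elements. -/
def multiplierNorm (bg : Set (E d)) (φ : E d → ℝ) (h : ℝ)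
    (𝒦 : Geometry.SimplicialComplex ℝ (E d)) (μ : E d → E d) : ℝ :=
  Real.sqrt ((h * ∫ x in interface bg φ, ‖μ x‖ ^ 2 ∂(μHE[d - 1] : Measure (E d))) +
    h ^ 2 * ∫ x in ⋃₀ interfaceMesh bg φ 𝒦, ‖normalDeriv φ μ x‖ ^ 2)

/-- The quotients `b_h(μ, v) / |||v|||` for `v ∈ V_h` with `|||v||| ≠ 0`. -/
def infSupQuotients (bg : Set (E d)) (φ : E d → ℝ) (δ h : ℝ) (k : ℕ)
    (𝒦 : Geometry.SimplicialComplex ℝ (E d)) (μ : E d → E d) : Set ℝ :=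
  {r | ∃ v ∈ velocitySpace bg φ δ k 𝒦, velocityNorm bg φ δ h 𝒦 v ≠ 0 ∧
    r = formB bg φ μ v / velocityNorm bg φ δ h 𝒦 v}

end UnfittedFEM

end

namespace UnfittedFEM

/-! ### Polynomial functions -/

/-! The test function is the multiplier itself. Since `k - 1 ≥ 1`, a multiplier μ extends from the
interface elements to a function `v` of degree `k - 1` on the whole mesh: written as homogeneous
polynomials in barycentric coordinates, the pieces of μ have coefficients attached to faces, and
coefficients that belong to no interface element are set to zero (`exists_scalar_extension`,
`exists_extension`). Then `b(μ, v) = G := ∫_Γ |μ|²`, and inverse estimates bound `h² ‖∇v‖²` by the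
squared L² norm of μ over the interface elements. Suppose this is bounded in turn by `Y² := h G + h²
D`, where `D := ∫ |n·∇μ|²` and `Y = |||μ|||`. Then `h |||v||| ≤ √A Y`, so the quotient of `v` is at
least `h G / (√A Y)`, while `j(μ, μ)^(1/2) = √(h² D) ≥ h² D / (√A Y)`. The two lower bounds add up
to `Y / √A`.

What remains is the volume bound (`exists_volume_estimate`), with a constant that ignores how Γ cuts
the elements. Freeze the direction `N` of `∇φ` at a point `x₀ ∈ T ∩ Γ`. Every interface element `T`
contains a ball of radius comparable to `h` from which all lines in direction `N` reach Γ within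
distance `h` without leaving the union of the interface elements (`LocalCut.hasColumns`). If the cut
is deep, such columns fit inside `T`. If it is shallow, Γ only grazes a nearly horizontal face of
`T`; the columns then start over the barycentre of that face, and the elements they traverse all
contain the face and are therefore cut themselves.

Integrating along the columns bounds μ on the ball by its trace on Γ and by `∂_N μ`
(`LocalCut.lintegral_ball_le`), and the ball controls `T` by equivalence of norms on polynomials.
Replacing `N` by the normal field costs a factor of order `h` in front of `∇μ`, which by an inverse
estimate leaves `h² ‖μ‖²` on the right (`exists_element_estimate`). Neighbourhoods overlap boundedly
often, so after summation this term is absorbed for small `h`. -/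

/-- `f` is a polynomial function of total degree at most `m`. -/
def IsPolyFun {d : ℕ} (m : ℕ) (f : E d → ℝ) : Prop :=
  ∃ p : MvPolynomial (Fin d) ℝ, p.totalDegree ≤ m ∧
    ∀ x, f x = MvPolynomial.eval (fun j => x j) p

namespace IsPolyFun

variable {d m m' : ℕ} {f g : E d → ℝ}

lemma mono (h : IsPolyFun m f) (hm : m ≤ m') : IsPolyFun m' f := by
  obtain ⟨p, hp, hf⟩ := h
  exact ⟨p, hp.trans hm, hf⟩

lemma const (c : ℝ) : IsPolyFun (d := d) 0 (fun _ => c) :=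
  ⟨MvPolynomial.C c, by simp, by simp⟩

lemma coord (i : Fin d) : IsPolyFun 1 (fun x : E d => x i) :=
  ⟨MvPolynomial.X i, by simp, by simp⟩

lemma add (hf : IsPolyFun m f) (hg : IsPolyFun m g) : IsPolyFun m (fun x => f x + g x) := by
  obtain ⟨p, hp, hf⟩ := hf
  obtain ⟨r, hr, hg⟩ := hg
  exact ⟨p + r, (MvPolynomial.totalDegree_add _ _).trans (max_le hp hr), by simp [hf, hg]⟩

lemma mul (hf : IsPolyFun m f) (hg : IsPolyFun m' g) :
    IsPolyFun (m + m') (fun x => f x * g x) := by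
  obtain ⟨p, hp, hf⟩ := hf
  obtain ⟨r, hr, hg⟩ := hg
  exact ⟨p * r, (MvPolynomial.totalDegree_mul _ _).trans (add_le_add hp hr), by simp [hf, hg]⟩

lemma const_mul (c : ℝ) (hf : IsPolyFun m f) : IsPolyFun m (fun x => c * f x) := by
  simpa using (const c).mul hf

lemma sum {ι : Type*} (s : Finset ι) {f : ι → E d → ℝ} (h : ∀ i ∈ s, IsPolyFun m (f i)) :
    IsPolyFun m (fun x => ∑ i ∈ s, f i x) := by
  classical
  induction s using Finset.induction_on with
  | empty => simpa using (const (d := d) 0).mono (Nat.zero_le m)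
  | insert a s ha ih =>
    simp only [Finset.sum_insert ha]
    exact (h a (by simp)).add (ih fun i hi => h i (by simp [hi]))

lemma pow (hf : IsPolyFun m f) (k : ℕ) : IsPolyFun (k * m) (fun x => f x ^ k) := by
  obtain ⟨p, hp, hf⟩ := hf
  exact ⟨p ^ k, (MvPolynomial.totalDegree_pow _ _).trans (Nat.mul_le_mul_left k hp), by simp [hf]⟩

lemma prod {ι : Type*} (s : Finset ι) {f : ι → E d → ℝ} {k : ι → ℕ}
    (h : ∀ i ∈ s, IsPolyFun (k i) (f i)) :
    IsPolyFun (∑ i ∈ s, k i) (fun x => ∏ i ∈ s, f i x) := by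
  classical
  induction s using Finset.induction_on with
  | empty => simpa using const (d := d) 1
  | insert a s ha ih =>
    simp only [Finset.prod_insert ha, Finset.sum_insert ha]
    exact (h a (by simp)).mul (ih fun i hi => h i (by simp [hi]))

/-- Substituting functions of degree one into a polynomial does not raise the degree. -/
lemma eval {ι : Type*} (Q : MvPolynomial ι ℝ) {g : ι → E d → ℝ}
    (h : ∀ α ∈ Q.support, ∀ i ∈ α.support, IsPolyFun 1 (g i)) :
    IsPolyFun Q.totalDegree (fun x => MvPolynomial.eval (fun i => g i x) Q) := by
  simp only [MvPolynomial.eval_eq]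
  refine sum _ fun α hα => const_mul _ ?_
  refine (prod (k := fun i => α i) α.support fun i hi => ?_).mono (MvPolynomial.le_totalDegree hα)
  simpa using (h α hα i hi).pow (α i)

lemma congr (h : IsPolyFun m f) (hfg : ∀ x, g x = f x) : IsPolyFun m g := by
  obtain ⟨p, hp, hf⟩ := h
  exact ⟨p, hp, fun x => (hfg x).trans (hf x)⟩

lemma comp_affine (hf : IsPolyFun m f) (y : E d) (h : ℝ) :
    IsPolyFun m (fun z => f (y + h • z)) := by
  obtain ⟨p, hp, hf⟩ := hf
  have := eval (d := d) p (g := fun i z => y i + h * z i)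
    (fun α _ i _ => ((const (y i)).mono (Nat.zero_le 1)).add ((coord i).const_mul h))
  exact (this.mono hp).congr fun z => by simp [hf]

lemma contDiff (hf : IsPolyFun m f) : ContDiff ℝ ∞ f := by
  obtain ⟨p, -, hf⟩ := hf
  have : f = fun x => MvPolynomial.eval (fun j => x j) p := funext hf
  rw [this]
  simp only [MvPolynomial.eval_eq]
  fun_prop

end IsPolyFun

/-! ### Norm equivalence on polynomials -/

/-- A continuous positive function, homogeneous of degree two, dominates the squared norm. -/
lemma exists_sq_norm_le_of_homogeneous {W : Type*} [NormedAddCommGroup W] [NormedSpace ℝ W]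
    [FiniteDimensional ℝ W] (q : W → ℝ) (hc : Continuous q)
    (hq : ∀ (t : ℝ) w, q (t • w) = t ^ 2 * q w) (hpos : ∀ w, w ≠ 0 → 0 < q w) :
    ∃ C : ℝ, 0 < C ∧ ∀ w, ‖w‖ ^ 2 ≤ C * q w := by
  have : ProperSpace W := FiniteDimensional.proper ℝ W
  rcases (Metric.sphere (0 : W) 1).eq_empty_or_nonempty with he | hne
  · refine ⟨1, one_pos, fun w => ?_⟩
    have hw : w = 0 := by
      by_contra hw
      have : ‖w‖⁻¹ • w ∈ Metric.sphere (0 : W) 1 := by simp [norm_smul, hw]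
      simp [he] at this
    subst hw
    have := hq 0 0
    simp at this
    simp [this]
  · obtain ⟨u, hu, hmin⟩ := (isCompact_sphere (0 : W) 1).exists_isMinOn hne hc.continuousOn
    have hu0 : u ≠ 0 := by rintro rfl; simp at hu
    refine ⟨(q u)⁻¹, inv_pos.2 (hpos u hu0), fun w => ?_⟩
    by_cases hw : w = 0
    · subst hw
      have := hq 0 0
      simp at this
      simp [this]
    · have h1 : q u ≤ q (‖w‖⁻¹ • w) := hmin (by simp [norm_smul, hw])
      rw [hq] at h1
      have hw' : 0 < ‖w‖ := norm_pos_iff.2 hw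
      rw [inv_mul_eq_div, le_div_iff₀ (hpos u hu0)]
      rw [inv_pow, inv_mul_eq_div, le_div_iff₀ (by positivity)] at h1
      linarith

/-- The ball contains a cube, and a polynomial vanishing on a product of infinite sets is zero.
Dividing by `d + 1` rather than `d` also covers `d = 0`. -/
lemma eq_zero_of_eval_eq_zero_on_ball {d : ℕ} (p : MvPolynomial (Fin d) ℝ) {κ : ℝ} (hκ : 0 < κ)
    (h : ∀ x : E d, x ∈ Metric.closedBall 0 κ → MvPolynomial.eval (fun j => x j) p = 0) :
    p = 0 := by
  have hδ : 0 < κ / (d + 1) := by positivity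
  refine MvPolynomial.funext_set (fun _ => Set.Icc (0 : ℝ) (κ / (d + 1)))
    (fun _ => Set.Icc_infinite hδ) fun x hx => ?_
  rw [map_zero]
  refine h (WithLp.toLp 2 x) ?_
  rw [mem_closedBall_zero_iff]
  have h1 : ‖(WithLp.toLp 2 x : E d)‖ ≤ ∑ i, ‖x i‖ := by
    have : (WithLp.toLp 2 x : E d) = ∑ i, x i • EuclideanSpace.single i (1 : ℝ) := by
      ext j; simp [Pi.single_apply]
    rw [this]
    refine (norm_sum_le _ _).trans (Finset.sum_le_sum fun i _ => by simp [norm_smul])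
  refine h1.trans ((Finset.sum_le_card_nsmul _ _ (κ / (d + 1)) fun i _ => ?_).trans ?_)
  · have := hx i (Set.mem_univ i)
    rw [Real.norm_eq_abs, abs_of_nonneg this.1]
    exact this.2
  · simp only [Finset.card_univ, Fintype.card_fin, nsmul_eq_mul]
    rw [mul_div_assoc', div_le_iff₀ (by positivity)]
    nlinarith

/-- Pointwise bounds for polynomials and their derivatives on the unit ball by the `L²` norm on a
concentric ball. -/
lemma exists_poly_bound_unit (d m : ℕ) {κ : ℝ} (hκ : 0 < κ) :
    ∃ C : ℝ, 0 < C ∧ ∀ f : E d → ℝ, IsPolyFun m f → ∀ z ∈ Metric.closedBall (0 : E d) 1,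
      f z ^ 2 ≤ C * ∫ x in Metric.closedBall (0 : E d) κ, f x ^ 2 ∧
      ‖fderiv ℝ f z‖ ^ 2 ≤ C * ∫ x in Metric.closedBall (0 : E d) κ, f x ^ 2 := by
  let V := MvPolynomial.restrictTotalDegree (Fin d) ℝ m
  let b := Module.finBasis ℝ V
  let N := Module.finrank ℝ V
  let g : Fin N → E d → ℝ := fun i x => MvPolynomial.eval (fun j => x j) (b i : MvPolynomial _ ℝ)
  have hg : ∀ i, ContDiff ℝ ∞ (g i) := fun i =>
    IsPolyFun.contDiff ⟨(b i : MvPolynomial _ ℝ), (MvPolynomial.mem_restrictTotalDegree _ _ _).1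
      (b i).2, fun _ => rfl⟩
  let Φ : (Fin N → ℝ) → E d → ℝ := fun c x => ∑ i, c i * g i x
  have hΦ : ∀ c x, Φ c x = MvPolynomial.eval (fun j => x j)
      ((∑ i, c i • b i : V) : MvPolynomial (Fin d) ℝ) := by
    intro c x
    simp [Φ, g, MvPolynomial.smul_eval]
  have hgc : ∀ i, Continuous (g i) := fun i => (hg i).continuous
  have hcont : Continuous (Function.uncurry Φ) := by
    simp only [Φ, Function.uncurry_def]
    fun_prop
  have hΦc : ∀ c, Continuous (Φ c) := fun c => by
    simp only [Φ]; fun_prop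
  -- In coordinates with respect to a basis of the polynomials, the squared L² norm on the small
  -- ball is a positive definite form, hence comparable with the norm of the coordinate vector; the
  -- latter bounds values and derivatives on the unit ball.
  let q : (Fin N → ℝ) → ℝ := fun c => ∫ x in Metric.closedBall (0 : E d) κ, Φ c x ^ 2
  have hint : ∀ c, IntegrableOn (fun x => Φ c x ^ 2) (Metric.closedBall (0 : E d) κ) := fun c =>
    ((hΦc c).pow 2).continuousOn.integrableOn_compact (isCompact_closedBall _ _)
  obtain ⟨C₀, hC₀, hq⟩ := exists_sq_norm_le_of_homogeneous q
    (by
      refine continuous_parametric_integral_of_continuous (f := fun c x => Φ c x ^ 2) ?_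
        (isCompact_closedBall _ _)
      exact hcont.pow 2)
    (by
      intro t c
      simp only [q, ← integral_const_mul]
      congr 1 with x
      simp only [Φ, Pi.smul_apply, smul_eq_mul, mul_assoc, ← Finset.mul_sum, mul_pow])
    (by
      intro c hc
      by_contra hle
      have h0 : q c = 0 := le_antisymm (not_lt.1 hle) (integral_nonneg fun _ => sq_nonneg _)
      have h1 : ∀ x ∈ Metric.ball (0 : E d) κ, Φ c x = 0 := by
        have h2 := (setIntegral_eq_zero_iff_of_nonneg_ae
          (Filter.Eventually.of_forall fun x => sq_nonneg _) (hint c)).1 h0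
        have h3 : (fun x => Φ c x ^ 2) =ᵐ[volume.restrict (Metric.ball (0 : E d) κ)] 0 :=
          ae_restrict_of_ae_restrict_of_subset Metric.ball_subset_closedBall h2
        have h4 := Measure.eqOn_open_of_ae_eq h3 Metric.isOpen_ball
          ((hΦc c).pow 2).continuousOn continuousOn_const
        intro x hx
        exact pow_eq_zero_iff (two_ne_zero) |>.1 (h4 hx)
      have h5 := eq_zero_of_eval_eq_zero_on_ball
        ((∑ i, c i • b i : V) : MvPolynomial (Fin d) ℝ) (half_pos hκ) (fun x hx => by
          rw [← hΦ]
          exact h1 x (Metric.closedBall_subset_ball (half_lt_self hκ) hx))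
      have h6 : (∑ i, c i • b i : V) = 0 := Subtype.ext h5
      exact hc (funext fun i => Fintype.linearIndependent_iff.1 b.linearIndependent c h6 i))
  have hK : ∀ i, ∃ K : ℝ, ∀ z ∈ Metric.closedBall (0 : E d) 1, |g i z| ≤ K ∧
      ‖fderiv ℝ (g i) z‖ ≤ K := by
    intro i
    obtain ⟨K₁, h₁⟩ := (isCompact_closedBall (0 : E d) 1).exists_bound_of_continuousOn
      (hgc i).continuousOn
    obtain ⟨K₂, h₂⟩ := (isCompact_closedBall (0 : E d) 1).exists_bound_of_continuousOn
      ((hg i).continuous_fderiv (by simp)).continuousOn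
    exact ⟨max K₁ K₂, fun z hz => ⟨(h₁ z hz).trans (le_max_left _ _),
      (h₂ z hz).trans (le_max_right _ _)⟩⟩
  choose K hK using hK
  have hz0 : (0 : E d) ∈ Metric.closedBall (0 : E d) 1 := by simp
  have hK0 : ∀ i, 0 ≤ K i := fun i => (abs_nonneg _).trans (hK i 0 hz0).1
  let S := ∑ i, K i + 1
  have hS : 0 < S := add_pos_of_nonneg_of_pos (Finset.sum_nonneg fun i _ => hK0 i) one_pos
  refine ⟨S ^ 2 * C₀, by positivity, fun f hf z hz => ?_⟩
  obtain ⟨p, hp, hfp⟩ := hf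
  let pv : V := ⟨p, (MvPolynomial.mem_restrictTotalDegree _ _ _).2 hp⟩
  let c : Fin N → ℝ := fun i => b.repr pv i
  have hfc : f = Φ c := by
    funext x
    rw [hΦ, hfp]
    have : (∑ i, c i • b i : V) = pv := b.sum_repr pv
    rw [this]
  have hfin : ∀ a : ℝ, 0 ≤ a → a ≤ S * ‖c‖ → a ^ 2 ≤ S ^ 2 * C₀ *
      ∫ x in Metric.closedBall (0 : E d) κ, f x ^ 2 := by
    intro a ha hle
    calc a ^ 2 ≤ (S * ‖c‖) ^ 2 := pow_le_pow_left₀ ha hle 2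
      _ = S ^ 2 * ‖c‖ ^ 2 := by ring
      _ ≤ S ^ 2 * (C₀ * q c) := by gcongr; exact hq c
      _ = _ := by rw [hfc]; simp only [q]; ring
  have hsum : ∀ u : Fin N → ℝ, (∀ i, u i ≤ K i) → ∑ i, |c i| * u i ≤ S * ‖c‖ := by
    intro u hu
    calc ∑ i, |c i| * u i ≤ ∑ i, ‖c‖ * K i := by
          refine Finset.sum_le_sum fun i _ => ?_
          have h1 : |c i| ≤ ‖c‖ := norm_le_pi_norm c i
          calc |c i| * u i ≤ |c i| * K i := mul_le_mul_of_nonneg_left (hu i) (abs_nonneg _)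
            _ ≤ _ := mul_le_mul_of_nonneg_right h1 (hK0 i)
      _ = (∑ i, K i) * ‖c‖ := by rw [← Finset.mul_sum, mul_comm]
      _ ≤ _ := by gcongr; simp [S]
  constructor
  · rw [← sq_abs]
    refine hfin _ (abs_nonneg _) ?_
    rw [hfc]
    refine le_trans ?_ (hsum (fun i => |g i z|) fun i => (hK i z hz).1)
    refine (Finset.abs_sum_le_sum_abs _ _).trans_eq ?_
    simp [abs_mul]
  · refine hfin _ (norm_nonneg _) ?_
    rw [hfc]
    have hd : HasFDerivAt (Φ c) (∑ i, c i • fderiv ℝ (g i) z) z := by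
      refine HasFDerivAt.fun_sum fun i _ => ?_
      exact (((hg i).differentiable (by simp)) z).hasFDerivAt.const_mul (c i)
    rw [hd.fderiv]
    refine le_trans ?_ (hsum (fun i => ‖fderiv ℝ (g i) z‖) fun i => (hK i z hz).2)
    refine (norm_sum_le _ _).trans_eq ?_
    simp [norm_smul]

lemma setIntegral_closedBall_scale {d : ℕ} (f : E d → ℝ) (y : E d) {h : ℝ} (hh : 0 < h) {κ : ℝ}
    (hκ : 0 ≤ κ) :
    ∫ z in Metric.closedBall (0 : E d) κ, f (y + h • z) =
      (h ^ d)⁻¹ * ∫ x in Metric.closedBall y (κ * h), f x := by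
  have h1 := Measure.setIntegral_comp_smul (volume : Measure (E d)) (fun x => f (y + x))
    (Metric.closedBall (0 : E d) κ) hh.ne'
  rw [h1, smul_closedBall _ _ hκ, smul_zero, finrank_euclideanSpace_fin, smul_eq_mul,
    abs_of_pos (by positivity)]
  congr 1
  have h2 := (measurePreserving_add_left (volume : Measure (E d)) y).setIntegral_preimage_emb
    (measurableEmbedding_addLeft y) f (Metric.closedBall y (κ * h))
  rw [← h2]
  congr 2
  ext x
  simp [abs_of_pos hh, mul_comm]

/-- Scaled pointwise (inverse) estimates for polynomials. -/
lemma exists_poly_bound (d m : ℕ) {κ : ℝ} (hκ : 0 < κ) :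
    ∃ C : ℝ, 0 < C ∧ ∀ h : ℝ, 0 < h → ∀ y : E d, ∀ f : E d → ℝ, IsPolyFun m f →
      ∀ x ∈ Metric.closedBall y h,
      f x ^ 2 ≤ C * ((h ^ d)⁻¹ * ∫ x in Metric.closedBall y (κ * h), f x ^ 2) ∧
      h ^ 2 * ‖fderiv ℝ f x‖ ^ 2 ≤
        C * ((h ^ d)⁻¹ * ∫ x in Metric.closedBall y (κ * h), f x ^ 2) := by
  obtain ⟨C, hC, H⟩ := exists_poly_bound_unit d m hκ
  refine ⟨C, hC, fun h hh y f hf x hx => ?_⟩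
  have hz : h⁻¹ • (x - y) ∈ Metric.closedBall (0 : E d) 1 := by
    rw [mem_closedBall_zero_iff, norm_smul, norm_inv, Real.norm_of_nonneg hh.le,
      inv_mul_le_iff₀ hh, mul_one]
    exact mem_closedBall_iff_norm.1 hx
  have hxz : y + h • (h⁻¹ • (x - y)) = x := by rw [smul_inv_smul₀ hh.ne']; abel
  have h1 := H _ (hf.comp_affine y h) _ hz
  rw [setIntegral_closedBall_scale (fun x => f x ^ 2) y hh hκ.le] at h1
  have hd : HasFDerivAt (fun z => f (y + h • z)) (h • fderiv ℝ f x) (h⁻¹ • (x - y)) := by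
    have h2 : HasFDerivAt (fun z : E d => y + h • z) (h • ContinuousLinearMap.id ℝ (E d))
        (h⁻¹ • (x - y)) := ((hasFDerivAt_id _).const_smul h).const_add y
    have h3 : HasFDerivAt f (fderiv ℝ f x) (y + h • (h⁻¹ • (x - y))) := by
      rw [hxz]; exact ((hf.contDiff.differentiable (by simp)) x).hasFDerivAt
    have h4 := HasFDerivAt.comp (f := fun z : E d => y + h • z) (h⁻¹ • (x - y)) h3 h2
    refine h4.congr_fderiv ?_
    ext; simp
  rw [hd.fderiv, hxz, norm_smul, mul_pow, Real.norm_of_nonneg hh.le] at h1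
  exact h1

/-- A map all of whose components are polynomial functions of degree at most `m`. -/
def IsPolyMap {d : ℕ} (m : ℕ) (F : E d → E d) : Prop := ∀ i, IsPolyFun m (fun x => F x i)

lemma IsPolyMap.contDiff {d m : ℕ} {F : E d → E d} (hF : IsPolyMap m F) : ContDiff ℝ ∞ F :=
  contDiff_euclidean.2 fun i => (hF i).contDiff

lemma IsPolyMap.mono {d m m' : ℕ} {F : E d → E d} (hF : IsPolyMap m F) (h : m ≤ m') :
    IsPolyMap m' F := fun i => (hF i).mono h

lemma norm_fderiv_sq_le_sum {d : ℕ} {F : E d → E d} {x : E d} (hF : DifferentiableAt ℝ F x) :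
    ‖fderiv ℝ F x‖ ^ 2 ≤ ∑ i, ‖fderiv ℝ (fun y => F y i) x‖ ^ 2 := by
  have hS : 0 ≤ ∑ i, ‖fderiv ℝ (fun y => F y i) x‖ ^ 2 :=
    Finset.sum_nonneg fun i _ => sq_nonneg _
  have h1 : ‖fderiv ℝ F x‖ ≤ Real.sqrt (∑ i, ‖fderiv ℝ (fun y => F y i) x‖ ^ 2) := by
    refine ContinuousLinearMap.opNorm_le_bound _ (Real.sqrt_nonneg _) fun v => ?_
    rw [EuclideanSpace.norm_eq]
    refine Real.sqrt_le_iff.2 ⟨by positivity, ?_⟩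
    rw [mul_pow, Real.sq_sqrt hS, Finset.sum_mul]
    refine Finset.sum_le_sum fun i _ => ?_
    have h2 : fderiv ℝ (fun y => F y i) x v = (fderiv ℝ F x v) i := by
      let L : E d →L[ℝ] ℝ := EuclideanSpace.proj i
      have h3 : HasFDerivAt (fun y => F y i) (L ∘L fderiv ℝ F x) x :=
        L.hasFDerivAt.comp x hF.hasFDerivAt
      exact congrArg (fun L => L v) h3.fderiv
    rw [← h2, ← mul_pow]
    exact pow_le_pow_left₀ (norm_nonneg _) (ContinuousLinearMap.le_opNorm _ _) 2
  calc _ ≤ _ := pow_le_pow_left₀ (norm_nonneg _) h1 2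
    _ = _ := Real.sq_sqrt hS

/-- The scalar bounds are summed over the components; all the squared quantities involved are
additive or subadditive, so the constant is unchanged. -/
lemma exists_polyMap_bound (d m : ℕ) {κ : ℝ} (hκ : 0 < κ) :
    ∃ C : ℝ, 0 < C ∧ ∀ h : ℝ, 0 < h → ∀ y : E d, ∀ F : E d → E d, IsPolyMap m F →
      ∀ x ∈ Metric.closedBall y h,
      ‖F x‖ ^ 2 ≤ C * ((h ^ d)⁻¹ * ∫ x in Metric.closedBall y (κ * h), ‖F x‖ ^ 2) ∧
      h ^ 2 * ‖fderiv ℝ F x‖ ^ 2 ≤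
        C * ((h ^ d)⁻¹ * ∫ x in Metric.closedBall y (κ * h), ‖F x‖ ^ 2) := by
  obtain ⟨C, hC, H⟩ := exists_poly_bound d m hκ
  refine ⟨C, hC, fun h hh y F hF x hx => ?_⟩
  have hint : ∫ x in Metric.closedBall y (κ * h), ‖F x‖ ^ 2 =
      ∑ i, ∫ x in Metric.closedBall y (κ * h), (F x i) ^ 2 := by
    rw [← integral_finsetSum]
    · congr 1 with x
      simp [EuclideanSpace.norm_sq_eq]
    · intro i _
      exact ((hF i).contDiff.continuous.pow 2).continuousOn.integrableOn_compact
        (isCompact_closedBall _ _)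
  rw [hint, Finset.mul_sum, Finset.mul_sum]
  constructor
  · rw [EuclideanSpace.norm_sq_eq]
    refine Finset.sum_le_sum fun i _ => ?_
    simpa using (H h hh y _ (hF i) x hx).1
  · calc _ ≤ h ^ 2 * ∑ i, ‖fderiv ℝ (fun y => F y i) x‖ ^ 2 := by
          gcongr
          exact norm_fderiv_sq_le_sum ((hF.contDiff.differentiable (by simp)) x)
      _ ≤ _ := by
          rw [Finset.mul_sum]
          exact Finset.sum_le_sum fun i _ => (H h hh y _ (hF i) x hx).2

/-- Inverse estimates on compact sets of size `h` containing a ball of radius `κ h`. -/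
lemma exists_inverse_estimates (d m : ℕ) {κ : ℝ} (hκ : 0 < κ) :
    ∃ C : ℝ, 0 < C ∧ ∀ h : ℝ, 0 < h → ∀ (T : Set (E d)) (y : E d), IsCompact T →
      Metric.closedBall y (κ * h) ⊆ T → T ⊆ Metric.closedBall y h →
      ∀ F : E d → E d, IsPolyMap m F →
      (∀ x ∈ T, h ^ d * ‖F x‖ ^ 2 ≤ C * ∫ x in T, ‖F x‖ ^ 2) ∧
      (∫ x in T, ‖F x‖ ^ 2 ≤ C * ∫ x in Metric.closedBall y (κ * h), ‖F x‖ ^ 2) ∧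
      (h ^ 2 * ∫ x in T, ‖fderiv ℝ F x‖ ^ 2 ≤ C * ∫ x in T, ‖F x‖ ^ 2) := by
  obtain ⟨C, hC, H⟩ := exists_polyMap_bound d m hκ
  let v₁ := volume.real (Metric.closedBall (0 : E d) 1)
  refine ⟨C * (1 + v₁), by positivity, fun h hh T y hT hyT hTy F hF => ?_⟩
  have hcF : Continuous fun x => ‖F x‖ ^ 2 := (hF.contDiff.continuous.norm).pow 2
  have hcF' : Continuous fun x => ‖fderiv ℝ F x‖ ^ 2 :=
    ((hF.contDiff.continuous_fderiv (by simp)).norm).pow 2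
  have hTint : IntegrableOn (fun x => ‖F x‖ ^ 2) T := hcF.continuousOn.integrableOn_compact hT
  have hmono : ∫ x in Metric.closedBall y (κ * h), ‖F x‖ ^ 2 ≤ ∫ x in T, ‖F x‖ ^ 2 :=
    setIntegral_mono_set hTint (Filter.Eventually.of_forall fun x => sq_nonneg _)
      hyT.eventuallyLE
  have hpos : 0 ≤ ∫ x in Metric.closedBall y (κ * h), ‖F x‖ ^ 2 :=
    integral_nonneg fun _ => sq_nonneg _
  have hv₁ : 0 ≤ v₁ := measureReal_nonneg
  have hvol : volume.real T ≤ h ^ d * v₁ := by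
    calc volume.real T ≤ volume.real (Metric.closedBall y h) :=
          measureReal_mono hTy (isCompact_closedBall _ _).measure_lt_top.ne
      _ = _ := by
          rw [Measure.addHaar_real_closedBall volume y hh.le, finrank_euclideanSpace_fin]
          simp only [v₁]
          rw [Measure.addHaar_real_closedBall volume (0 : E d) zero_le_one]
          simp
  -- A pointwise bound by `h ^ (-d)` times an integral over the small ball becomes an integral bound
  -- over `T`, because the volume of `T` is at most `v₁ h ^ d`.
  have hbd : ∀ (g : E d → ℝ), Continuous g → (∀ x, 0 ≤ g x) →
      (∀ x ∈ T, g x ≤ C * ((h ^ d)⁻¹ * ∫ x in Metric.closedBall y (κ * h), ‖F x‖ ^ 2)) →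
      ∫ x in T, g x ≤ C * (1 + v₁) * ∫ x in Metric.closedBall y (κ * h), ‖F x‖ ^ 2 := by
    intro g hg hg0 hgT
    have h1 : ∫ x in T, g x ≤
        ∫ x in T, C * ((h ^ d)⁻¹ * ∫ x in Metric.closedBall y (κ * h), ‖F x‖ ^ 2) :=
      setIntegral_mono_on (hg.continuousOn.integrableOn_compact hT)
        (integrableOn_const hT.measure_lt_top.ne) hT.measurableSet hgT
    refine h1.trans ?_
    rw [setIntegral_const, smul_eq_mul]
    calc _ ≤ h ^ d * v₁ * (C * ((h ^ d)⁻¹ * ∫ x in Metric.closedBall y (κ * h), ‖F x‖ ^ 2)) := by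
          gcongr
      _ = C * v₁ * ∫ x in Metric.closedBall y (κ * h), ‖F x‖ ^ 2 := by
          field_simp
      _ ≤ _ := by gcongr; linarith
  refine ⟨fun x hx => ?_, hbd _ hcF (fun _ => sq_nonneg _) fun x hx => (H h hh y F hF x (hTy hx)).1,
    ?_⟩
  · have h1 := (H h hh y F hF x (hTy hx)).1
    calc h ^ d * ‖F x‖ ^ 2
        ≤ h ^ d * (C * ((h ^ d)⁻¹ * ∫ x in Metric.closedBall y (κ * h), ‖F x‖ ^ 2)) := by gcongr
      _ = C * ∫ x in Metric.closedBall y (κ * h), ‖F x‖ ^ 2 := by field_simp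
      _ ≤ C * (1 + v₁) * ∫ x in T, ‖F x‖ ^ 2 := by
          gcongr
          nlinarith
  · rw [← integral_const_mul]
    refine (hbd (fun x => h ^ 2 * ‖fderiv ℝ F x‖ ^ 2) (continuous_const.mul hcF')
      (fun _ => by positivity) fun x hx => (H h hh y F hF x (hTy hx)).2).trans ?_
    gcongr

/-! ### Piecewise smooth functions of one variable -/

lemma countable_frontier_of_compact_convex {I : Set ℝ} (hI : IsCompact I) (hc : Convex ℝ I) :
    (frontier I).Countable := by
  rcases I.eq_empty_or_nonempty with rfl | hne
  · simp
  · have : I = Set.Icc (sInf I) (sSup I) := eq_Icc_of_connected_compact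
      ⟨hne, hc.isPreconnected⟩ hI
    rw [this, frontier_Icc ((csInf_le hI.bddBelow hne.some_mem).trans
      (le_csSup hI.bddAbove hne.some_mem))]
    exact (Set.toFinite _).countable

/-- The closed convex sets `I j` meet `[a, b]` in intervals, so their frontiers form a countable
set. Off this set `f` coincides locally with some `P j` and is differentiable, and the fundamental
theorem of calculus tolerates countably many exceptions for continuous `f`. -/
lemma norm_sub_le_integral_of_piecewise {V : Type*} [NormedAddCommGroup V] [NormedSpace ℝ V]
    [CompleteSpace V] {J : Type*} [Finite J] {f : ℝ → V} {a b : ℝ} (hab : a ≤ b)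
    {I : J → Set ℝ} {P : J → ℝ → V} (hIc : ∀ j, IsClosed (I j)) (hIv : ∀ j, Convex ℝ (I j))
    (hP : ∀ j, Differentiable ℝ (P j)) (hcov : ∀ s ∈ Set.Icc a b, ∃ j, s ∈ I j)
    (hf : ContinuousOn f (Set.Icc a b))
    (heq : ∀ j, ∀ s ∈ Set.Icc a b, s ∈ I j → f s = P j s) {G : ℝ → ℝ}
    (hG : IntervalIntegrable G volume a b)
    (hle : ∀ j, ∀ s ∈ Set.Icc a b, s ∈ I j → ‖deriv (P j) s‖ ≤ G s) :
    ‖f b - f a‖ ≤ ∫ s in a..b, G s := by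
  let S : Set ℝ := ⋃ j, frontier (I j ∩ Set.Icc a b)
  have hS : S.Countable := Set.countable_iUnion fun j =>
    countable_frontier_of_compact_convex (isCompact_Icc.inter_left (hIc j))
      ((hIv j).inter (convex_Icc a b))
  have hd : ∀ s ∈ Set.Ioo a b \ S, HasDerivAt f (deriv f s) s ∧ ‖deriv f s‖ ≤ G s := by
    rintro s ⟨hs, hsS⟩
    obtain ⟨j, hj⟩ := hcov s (Set.Ioo_subset_Icc_self hs)
    have hjs : s ∈ I j ∩ Set.Icc a b := ⟨hj, Set.Ioo_subset_Icc_self hs⟩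
    have hint : s ∈ interior (I j ∩ Set.Icc a b) := by
      by_contra hn
      exact hsS (Set.mem_iUnion.2 ⟨j, subset_closure hjs, hn⟩)
    have hev : f =ᶠ[nhds s] P j := by
      filter_upwards [mem_interior_iff_mem_nhds.1 hint] with t ht
      exact heq j t ht.2 ht.1
    have h1 : HasDerivAt f (deriv (P j) s) s :=
      ((hP j) s).hasDerivAt.congr_of_eventuallyEq hev
    rw [h1.deriv]
    exact ⟨h1, hle j s hjs.2 hjs.1⟩
  have hae : ∀ᵐ s ∂volume.restrict (Set.Ioc a b), ‖deriv f s‖ ≤ G s := by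
    rw [ae_restrict_iff' measurableSet_Ioc]
    have h1 : ∀ᵐ s : ℝ, s ∉ S ∪ {b} := by
      exact compl_mem_ae_iff.2 ((hS.union (Set.countable_singleton b)).measure_zero volume)
    filter_upwards [h1] with s hs hs'
    refine (hd s ⟨⟨hs'.1, lt_of_le_of_ne hs'.2 fun h => hs (Or.inr h)⟩, fun h => hs (Or.inl h)⟩).2
  have hint : IntervalIntegrable (deriv f) volume a b := by
    rw [intervalIntegrable_iff_integrableOn_Ioc_of_le hab] at hG ⊢
    have hmeas : AEStronglyMeasurable (deriv f) (volume.restrict (Set.Ioc a b)) := by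
      exact aestronglyMeasurable_deriv f _
    exact Integrable.mono' hG hmeas hae
  rw [← integral_eq_of_hasDerivAt_off_countable_of_le f (deriv f) hab hS hf
    (fun s hs => (hd s hs).1) hint]
  exact intervalIntegral.norm_integral_le_of_norm_le hab
    ((ae_restrict_iff' measurableSet_Ioc).1 hae) hG

/-! ### Barycentric coordinates on a simplicial complex -/

/-- `w` are barycentric coordinates of `x` with respect to the vertices `s`. -/
def IsBaryOn {d : ℕ} (s : Finset (E d)) (x : E d) (w : E d → ℝ) : Prop :=
  (∀ z, z ∉ s → w z = 0) ∧ (∀ z, 0 ≤ w z) ∧ ∑ z ∈ s, w z = 1 ∧ ∑ z ∈ s, w z • z = x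

section

variable {d : ℕ}

lemma IsBaryOn.mono {s t : Finset (E d)} {x : E d} {w : E d → ℝ} (h : IsBaryOn s x w)
    (hst : s ⊆ t) : IsBaryOn t x w := by
  obtain ⟨h0, h1, h2, h3⟩ := h
  refine ⟨fun z hz => h0 z fun hz' => hz (hst hz'), h1, ?_, ?_⟩
  · rw [← h2]
    exact (Finset.sum_subset hst fun z _ hz => h0 z hz).symm
  · rw [← h3]
    exact (Finset.sum_subset hst fun z _ hz => by rw [h0 z hz, zero_smul]).symm

lemma exists_isBaryOn {s : Finset (E d)} {x : E d} (hx : x ∈ convexHull ℝ (s : Set (E d))) :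
    ∃ w, IsBaryOn s x w := by
  classical
  obtain ⟨w, h0, h1, h2⟩ := Finset.mem_convexHull'.1 hx
  refine ⟨fun z => if z ∈ s then w z else 0, fun z hz => by simp [hz], fun z => ?_, ?_, ?_⟩
  · dsimp only
    split_ifs with hz
    exacts [h0 z hz, le_rfl]
  · rw [← h1]
    exact Finset.sum_congr rfl fun z hz => by simp [hz]
  · rw [← h2]
    exact Finset.sum_congr rfl fun z hz => by simp [hz]

lemma IsBaryOn.mem_convexHull {s : Finset (E d)} {x : E d} {w : E d → ℝ} (h : IsBaryOn s x w) :
    x ∈ convexHull ℝ (s : Set (E d)) :=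
  Finset.mem_convexHull'.2 ⟨w, fun z _ => h.2.1 z, h.2.2.1, h.2.2.2⟩

lemma eq_weights_of_affineIndependent {s : Finset (E d)}
    (hs : AffineIndependent ℝ ((↑) : s → E d)) {w w' : E d → ℝ}
    (h1 : ∑ z ∈ s, w z = ∑ z ∈ s, w' z) (h2 : ∑ z ∈ s, w z • z = ∑ z ∈ s, w' z • z) :
    ∀ z ∈ s, w z = w' z := by
  intro z hz
  have := (affineIndependent_iff.1 hs) Finset.univ (fun i => w i - w' i)
    (by
      rw [Finset.sum_sub_distrib, sub_eq_zero, Finset.sum_coe_sort s w, Finset.sum_coe_sort s w', h1])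
    (by
      simp only [sub_smul]
      rw [Finset.sum_sub_distrib, sub_eq_zero, Finset.sum_coe_sort s fun z => w z • z,
        Finset.sum_coe_sort s fun z => w' z • z, h2])
    ⟨z, hz⟩ (Finset.mem_univ _)
  exact sub_eq_zero.1 this

lemma IsBaryOn.unique {s : Finset (E d)} (hs : AffineIndependent ℝ ((↑) : s → E d)) {x : E d}
    {w w' : E d → ℝ} (h : IsBaryOn s x w) (h' : IsBaryOn s x w') : w = w' := by
  funext z
  by_cases hz : z ∈ s
  · exact eq_weights_of_affineIndependent hs (h.2.2.1.trans h'.2.2.1.symm)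
      (h.2.2.2.trans h'.2.2.2.symm) z hz
  · rw [h.1 z hz, h'.1 z hz]

variable {𝒦 : Geometry.SimplicialComplex ℝ (E d)}

/-- This is where conformity enters: two simplices meet in the hull of their common vertices, so
both families of coordinates are those with respect to the common face. It makes `hat` independent
of the simplex chosen. -/
lemma IsBaryOn.unique_of_faces {s t : Finset (E d)} (hs : s ∈ 𝒦.faces) (ht : t ∈ 𝒦.faces)
    {x : E d} {w w' : E d → ℝ} (h : IsBaryOn s x w) (h' : IsBaryOn t x w') : w = w' := by
  classical
  have hx := 𝒦.inter_subset_convexHull hs ht ⟨h.mem_convexHull, h'.mem_convexHull⟩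
  rw [← Finset.coe_inter] at hx
  obtain ⟨u, hu⟩ := exists_isBaryOn hx
  rw [h.unique (𝒦.indep hs) (hu.mono Finset.inter_subset_left),
    h'.unique (𝒦.indep ht) (hu.mono Finset.inter_subset_right)]

open Classical in
/-- The barycentric coordinates of `x` in the complex `𝒦`: `hat 𝒦 x z` is the value at `x` of the
piecewise affine nodal basis function of the vertex `z`. -/
noncomputable def hat (𝒦 : Geometry.SimplicialComplex ℝ (E d)) (x : E d) : E d → ℝ :=
  if h : ∃ w, ∃ s ∈ 𝒦.faces, IsBaryOn s x w then h.choose else 0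

lemma isBaryOn_hat {s : Finset (E d)} (hs : s ∈ 𝒦.faces) {x : E d}
    (hx : x ∈ convexHull ℝ (s : Set (E d))) : IsBaryOn s x (hat 𝒦 x) := by
  obtain ⟨w, hw⟩ := exists_isBaryOn hx
  have h : ∃ w, ∃ s ∈ 𝒦.faces, IsBaryOn s x w := ⟨w, s, hs, hw⟩
  obtain ⟨t, ht, hwt⟩ := h.choose_spec
  rw [hat, dif_pos h, ← hw.unique_of_faces hs ht hwt]
  exact hw

lemma hat_eq_of_isBaryOn {s : Finset (E d)} (hs : s ∈ 𝒦.faces) {x : E d} {w : E d → ℝ}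
    (h : IsBaryOn s x w) : hat 𝒦 x = w :=
  (isBaryOn_hat hs h.mem_convexHull).unique (𝒦.indep hs) h

lemma mem_of_hat_ne_zero {s : Finset (E d)} (hs : s ∈ 𝒦.faces) {x : E d}
    (hx : x ∈ convexHull ℝ (s : Set (E d))) {z : E d} (hz : hat 𝒦 x z ≠ 0) : z ∈ s := by
  by_contra h
  exact hz ((isBaryOn_hat hs hx).1 z h)

lemma hat_nonneg (x z : E d) : 0 ≤ hat 𝒦 x z := by
  rw [hat]
  split_ifs with h
  · obtain ⟨t, ht, hwt⟩ := h.choose_spec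
    exact hwt.2.1 z
  · exact le_rfl

lemma IsBaryOn.le_one {s : Finset (E d)} {x : E d} {w : E d → ℝ} (h : IsBaryOn s x w) (z : E d) :
    w z ≤ 1 := by
  by_cases hz : z ∈ s
  · rw [← h.2.2.1]
    exact Finset.single_le_sum (fun y _ => h.2.1 y) hz
  · rw [h.1 z hz]
    exact zero_le_one

lemma AffineMap.isPolyFun (a : E d →ᵃ[ℝ] ℝ) : IsPolyFun 1 (fun x => a x) := by
  have h : ∀ x, a x = a 0 + ∑ j, a.linear (EuclideanSpace.single j 1) * x j := by
    intro x
    have h1 : a x = a.linear x + a 0 := by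
      have := a.decomp
      exact congrFun this x
    have h2 : x = ∑ j, x j • EuclideanSpace.single j (1 : ℝ) := by
      ext j; simp [Pi.single_apply]
    rw [h1, add_comm]
    congr 1
    conv_lhs => rw [h2]
    rw [map_sum]
    exact Finset.sum_congr rfl fun j _ => by rw [map_smul, smul_eq_mul, mul_comm]
  refine IsPolyFun.congr ?_ h
  exact ((IsPolyFun.const _).mono (Nat.zero_le 1)).add
    (IsPolyFun.sum _ fun j _ => (IsPolyFun.coord j).const_mul _)

/-- The vertex sets of the elements. -/
def simplices (𝒦 : Geometry.SimplicialComplex ℝ (E d)) : Set (Finset (E d)) :=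
  {s | s ∈ 𝒦.faces ∧ s.card = d + 1}

lemma mem_elements_iff {T : Set (E d)} :
    T ∈ elements 𝒦 ↔ ∃ s ∈ simplices 𝒦, T = convexHull ℝ (s : Set (E d)) := by
  constructor
  · rintro ⟨s, hs, hc, rfl⟩
    exact ⟨s, ⟨hs, hc⟩, rfl⟩
  · rintro ⟨s, ⟨hs, hc⟩, rfl⟩
    exact ⟨s, hs, hc, rfl⟩

lemma convexHull_mem_elements {s : Finset (E d)} (hs : s ∈ simplices 𝒦) :
    convexHull ℝ (s : Set (E d)) ∈ elements 𝒦 := mem_elements_iff.2 ⟨s, hs, rfl⟩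

/-- On each element, every nodal basis function is affine. -/
lemma exists_affineMap_eq_hat {s : Finset (E d)} (hs : s ∈ simplices 𝒦) (z : E d) :
    ∃ a : E d →ᵃ[ℝ] ℝ, (∀ x ∈ convexHull ℝ (s : Set (E d)), hat 𝒦 x z = a x) ∧
      (z ∉ s → a = 0) := by
  classical
  by_cases hz : z ∈ s
  · have hind := 𝒦.indep hs.1
    have htop : affineSpan ℝ (Set.range ((↑) : s → E d)) = ⊤ := by
      rw [hind.affineSpan_eq_top_iff_card_eq_finrank_add_one]
      simp [hs.2]
    let b : AffineBasis s ℝ (E d) := ⟨(↑), hind, htop⟩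
    refine ⟨b.coord ⟨z, hz⟩, fun x hx => ?_, fun h => (h hz).elim⟩
    have hb := isBaryOn_hat hs.1 hx
    let w' : E d → ℝ := fun y => if h : y ∈ s then b.coord ⟨y, h⟩ x else 0
    have hw' : ∀ i : s, w' i = b.coord i x := fun i => by simp [w']
    have h1 : ∑ y ∈ s, w' y = 1 := by
      rw [← Finset.sum_coe_sort s w', ← b.sum_coord_apply_eq_one x]
      exact Finset.sum_congr rfl fun i _ => hw' i
    have h2 : ∑ y ∈ s, w' y • y = x := by
      rw [← Finset.sum_coe_sort s fun y => w' y • y]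
      conv_rhs => rw [← b.linear_combination_coord_eq_self x]
      exact Finset.sum_congr rfl fun i _ => by rw [hw' i]; rfl
    rw [eq_weights_of_affineIndependent hind (hb.2.2.1.trans h1.symm) (hb.2.2.2.trans h2.symm) z hz]
    exact hw' ⟨z, hz⟩
  · exact ⟨0, fun x hx => by rw [(isBaryOn_hat hs.1 hx).1 z hz]; rfl, fun _ => rfl⟩

lemma finite_simplices (hf : 𝒦.faces.Finite) : (simplices 𝒦).Finite :=
  hf.subset fun _ hs => hs.1

lemma finite_elements (hf : 𝒦.faces.Finite) : (elements 𝒦).Finite := by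
  refine ((finite_simplices hf).image fun s : Finset (E d) => convexHull ℝ (s : Set (E d))).subset ?_
  rintro T hT
  obtain ⟨s, hs, rfl⟩ := mem_elements_iff.1 hT
  exact ⟨s, hs, rfl⟩

lemma isCompact_convexHull_finset (s : Finset (E d)) : IsCompact (convexHull ℝ (s : Set (E d))) :=
  s.finite_toSet.isCompact_convexHull ℝ

lemma continuousOn_sUnion_of_finite {X Y : Type*} [TopologicalSpace X] [TopologicalSpace Y]
    {𝒯 : Set (Set X)} (hfin : 𝒯.Finite) (hcl : ∀ T ∈ 𝒯, IsClosed T) {f : X → Y}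
    (hf : ∀ T ∈ 𝒯, ContinuousOn f T) : ContinuousOn f (⋃₀ 𝒯) := by
  rw [Set.sUnion_eq_iUnion]
  have : Finite 𝒯 := hfin
  exact (locallyFinite_of_finite _).continuousOn_iUnion (fun i => hcl i i.2) fun i => hf i i.2

lemma continuousOn_hat (hf : 𝒦.faces.Finite) (z : E d) :
    ContinuousOn (fun x => hat 𝒦 x z) (⋃₀ elements 𝒦) := by
  refine continuousOn_sUnion_of_finite (finite_elements hf) ?_ ?_
  · intro T hT
    obtain ⟨s, hs, rfl⟩ := mem_elements_iff.1 hT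
    exact (isCompact_convexHull_finset s).isClosed
  · intro T hT
    obtain ⟨s, hs, rfl⟩ := mem_elements_iff.1 hT
    obtain ⟨a, ha, -⟩ := exists_affineMap_eq_hat hs z
    exact (a.continuous_of_finiteDimensional.continuousOn).congr ha

/-- Between the centre and the boundary point in direction `u` the values differ by at most `1`,
over a distance `r`. -/
lemma AffineMap.abs_linear_le {a : E d →ᵃ[ℝ] ℝ} {m : E d} {r : ℝ} (hr : 0 < r)
    (h0 : ∀ x ∈ Metric.closedBall m r, 0 ≤ a x) (h1 : ∀ x ∈ Metric.closedBall m r, a x ≤ 1)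
    (u : E d) : |a.linear u| ≤ ‖u‖ / r := by
  by_cases hu : u = 0
  · simp [hu]
  have hu' : 0 < ‖u‖ := norm_pos_iff.2 hu
  have hm : m ∈ Metric.closedBall m r := Metric.mem_closedBall_self hr.le
  have hv : (r / ‖u‖) • u + m ∈ Metric.closedBall m r := by
    rw [mem_closedBall_iff_norm, add_sub_cancel_right, norm_smul, Real.norm_of_nonneg (by positivity),
      div_mul_cancel₀ _ hu'.ne']
  have hlin : a.linear ((r / ‖u‖) • u) = a ((r / ‖u‖) • u + m) - a m := by
    have := a.map_vadd m ((r / ‖u‖) • u)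
    simp only [vadd_eq_add] at this
    rw [this]; ring
  have habs : |a.linear ((r / ‖u‖) • u)| ≤ 1 := by
    rw [hlin, abs_le]
    constructor <;> linarith [h0 _ hm, h1 _ hm, h0 _ hv, h1 _ hv]
  rw [map_smul, smul_eq_mul, abs_mul, abs_of_pos (by positivity)] at habs
  rw [le_div_iff₀ hr]
  rw [div_mul_eq_mul_div, div_le_one hu'] at habs
  linarith

/-- The nodal basis functions of a mesh whose elements contain balls of radius `r` have Lipschitz
constant `1 / r` along segments covered by the mesh. -/
lemma abs_hat_sub_hat_le (hf : 𝒦.faces.Finite) {r : ℝ} (hr : 0 < r)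
    (hball : ∀ T ∈ elements 𝒦, ∃ m, Metric.closedBall m r ⊆ T) {g x : E d}
    (hseg : segment ℝ g x ⊆ ⋃₀ elements 𝒦) (z : E d) :
    |hat 𝒦 x z - hat 𝒦 g z| ≤ dist x g / r := by
  have : Finite (simplices 𝒦) := finite_simplices hf
  choose a ha ha0 using fun s : simplices 𝒦 => exists_affineMap_eq_hat s.2 z
  let ℓ : ℝ → E d := fun τ => g + τ • (x - g)
  have hℓc : Continuous ℓ := by fun_prop
  have hℓ : ∀ τ ∈ Set.Icc (0 : ℝ) 1, ℓ τ ∈ segment ℝ g x := fun τ hτ => by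
    rw [segment_eq_image']
    exact ⟨τ, hτ, rfl⟩
  have hderiv : ∀ (s : simplices 𝒦) τ, HasDerivAt (fun τ => a s (ℓ τ)) ((a s).linear (x - g)) τ := by
    intro s τ
    have h1 : (fun τ => a s (ℓ τ)) = fun τ => τ * (a s).linear (x - g) + a s g := by
      funext τ
      have := (a s).map_vadd g (τ • (x - g))
      simp only [vadd_eq_add, map_smul, smul_eq_mul] at this
      rw [← this]
      simp only [ℓ, add_comm]
    rw [h1]
    simpa using ((hasDerivAt_id τ).mul_const _).add_const (a s g)
  -- Along the segment the nodal function is piecewise affine. On each element it has values in `[0,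
  -- 1]` on a ball of radius `r`, so its slope is at most `1 / r`, and a constant majorant suffices.
  have key := norm_sub_le_integral_of_piecewise (f := fun τ => hat 𝒦 (ℓ τ) z) (zero_le_one)
    (I := fun s : simplices 𝒦 => ℓ ⁻¹' convexHull ℝ ((s : Finset (E d)) : Set (E d)))
    (P := fun s τ => a s (ℓ τ)) (G := fun _ => dist x g / r)
    (fun s => (isCompact_convexHull_finset _).isClosed.preimage hℓc)
    (fun s => by
      have : ℓ = AffineMap.lineMap g x := by
        funext τ
        simp [ℓ, AffineMap.lineMap_apply, add_comm]
      rw [this]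
      exact (convex_convexHull ℝ _).affine_preimage _)
    (fun s τ => (hderiv s τ).differentiableAt)
    (fun τ hτ => by
      obtain ⟨T, hT, hx⟩ := hseg (hℓ τ hτ)
      obtain ⟨s, hs, rfl⟩ := mem_elements_iff.1 hT
      exact ⟨⟨s, hs⟩, hx⟩)
    ((continuousOn_hat hf z).comp hℓc.continuousOn fun τ hτ => hseg (hℓ τ hτ))
    (fun s τ _ hs => ha s _ hs)
    (by simp)
    (fun s τ _ hs => by
      rw [(hderiv s τ).deriv, dist_eq_norm, Real.norm_eq_abs]
      obtain ⟨m, hm⟩ := hball _ (convexHull_mem_elements s.2)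
      refine AffineMap.abs_linear_le hr (m := m) (fun y hy => ?_) (fun y hy => ?_) _
      · rw [← ha s y (hm hy)]; exact hat_nonneg _ _
      · rw [← ha s y (hm hy)]; exact (isBaryOn_hat s.2.1 (hm hy)).le_one z)
  simpa [ℓ] using key

end

/-! ### Projection along a direction and the Hausdorff measure of hypersurfaces -/

/-- `P` is a coordinate projection along the unit vector `N`. -/
structure IsFrame {n : ℕ} (N : E (n + 1)) (P : E (n + 1) →L[ℝ] E n) : Prop where
  norm_sq : ∀ x, ‖x‖ ^ 2 = inner ℝ N x ^ 2 + ‖P x‖ ^ 2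
  measurePreserving : MeasurePreserving (fun x => ((inner ℝ N x : ℝ), P x)) volume
    ((volume : Measure ℝ).prod (volume : Measure (E n)))
  exists_eq : ∀ w, ∃ x, P x = w ∧ inner ℝ N x = (0 : ℝ)

/-- Complete `N` to an orthonormal basis with `N` at index `0` and let `P` collect the remaining
coordinates. -/
lemma exists_isFrame {n : ℕ} {N : E (n + 1)} (hN : ‖N‖ = 1) :
    ∃ P : E (n + 1) →L[ℝ] E n, IsFrame N P := by
  have hv : Orthonormal ℝ (({0} : Set (Fin (n + 1))).domRestrict fun _ => N) := by
    refine ⟨fun _ => hN, fun i j hij => (hij ?_).elim⟩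
    exact Subtype.ext (i.2.trans j.2.symm)
  obtain ⟨b, hb⟩ := hv.exists_orthonormalBasis_extension_of_card_eq (by simp)
  have hb0 : b 0 = N := hb 0 rfl
  let P₀ : E (n + 1) →ₗ[ℝ] E n :=
    { toFun := fun x => WithLp.toLp 2 fun i => b.repr x i.succ
      map_add' := fun x y => by ext; simp
      map_smul' := fun c x => by ext; simp }
  let P : E (n + 1) →L[ℝ] E n := LinearMap.toContinuousLinearMap P₀
  have hP : ∀ x i, P x i = b.repr x i.succ := fun x i => rfl
  have h0 : ∀ x, inner ℝ N x = b.repr x 0 := fun x => by rw [b.repr_apply_apply, hb0]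
  refine ⟨P, ⟨fun x => ?_, ?_, fun w => ?_⟩⟩
  · rw [← b.repr.norm_map x, EuclideanSpace.norm_sq_eq, EuclideanSpace.norm_sq_eq,
      Fin.sum_univ_succ, h0]
    simp [hP]
  · have h1 := b.measurePreserving_repr
    have h2 := PiLp.volume_preserving_ofLp (Fin (n + 1))
    have h3 := volume_preserving_piFinSuccAbove (fun _ : Fin (n + 1) => ℝ) 0
    have h4 : MeasurePreserving (Prod.map id (WithLp.toLp 2) : ℝ × (Fin n → ℝ) → ℝ × E n)
        ((volume : Measure ℝ).prod volume) ((volume : Measure ℝ).prod volume) :=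
      (MeasurePreserving.id _).prod (PiLp.volume_preserving_toLp (Fin n))
    have h5 := h4.comp (h3.comp (h2.comp h1))
    convert h5 using 1
    funext x
    refine Prod.ext ?_ ?_
    · simp [h0, MeasurableEquiv.piFinSuccAbove, Fin.insertNthEquiv]
    · ext i
      simp [hP, MeasurableEquiv.piFinSuccAbove, Fin.insertNthEquiv, Fin.tail]
  · refine ⟨b.repr.symm (WithLp.toLp 2 (Fin.cons 0 w)), ?_, ?_⟩
    · ext i
      simp [hP]
    · simp [h0]

namespace IsFrame

variable {n : ℕ} {N : E (n + 1)} {P : E (n + 1) →L[ℝ] E n}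

lemma norm_apply_le (hP : IsFrame N P) (x : E (n + 1)) : ‖P x‖ ≤ ‖x‖ := by
  refine (sq_le_sq₀ (norm_nonneg _) (norm_nonneg _)).1 ?_
  rw [hP.norm_sq x]
  nlinarith [sq_nonneg (inner ℝ N x : ℝ)]

lemma lipschitz (hP : IsFrame N P) : LipschitzWith 1 P := by
  refine LipschitzWith.of_dist_le_mul fun x y => ?_
  rw [dist_eq_norm, dist_eq_norm, ← map_sub, NNReal.coe_one, one_mul]
  exact hP.norm_apply_le _

lemma apply_self (hP : IsFrame N P) (hN : ‖N‖ = 1) : P N = 0 := by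
  have := hP.norm_sq N
  rw [real_inner_self_eq_norm_sq, hN] at this
  simpa using this

lemma apply_add_smul (hP : IsFrame N P) (hN : ‖N‖ = 1) (x : E (n + 1)) (s : ℝ) :
    P (x + s • N) = P x := by
  rw [map_add, map_smul, hP.apply_self hN, smul_zero, add_zero]

/-- A contraction does not increase Hausdorff measure, and on `E n` the normalised Hausdorff measure
is Lebesgue measure. This inequality replaces the area formula for graphs. -/
lemma volume_image_le (hP : IsFrame N P) (S : Set (E (n + 1))) :
    volume (P '' S) ≤ (μHE[n] : Measure (E (n + 1))) S := by
  have h := hP.lipschitz.hausdorffMeasure_image_le (d := (n : ℝ)) (Nat.cast_nonneg n) S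
  rw [← EuclideanSpace.euclideanHausdorffMeasure_eq_volume n,
    Measure.euclideanHausdorffMeasure_def, Measure.euclideanHausdorffMeasure_def,
    Measure.smul_apply, Measure.smul_apply]
  gcongr
  simpa using h

/-- The hypothesis makes the inverse of `P` on `S` Lipschitz, so `S` is a Lipschitz image of a
bounded subset of `E n`. -/
lemma measure_lt_top (hP : IsFrame N P) {S : Set (E (n + 1))} (hS : Bornology.IsBounded S)
    {C : NNReal} (hC : ∀ x ∈ S, ∀ y ∈ S, dist x y ≤ C * dist (P x) (P y)) :
    (μHE[n] : Measure (E (n + 1))) S < ⊤ := by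
  let γ := Function.invFunOn P S
  have hγ : ∀ w ∈ P '' S, γ w ∈ S ∧ P (γ w) = w := fun w hw =>
    ⟨Function.invFunOn_mem hw, Function.invFunOn_eq hw⟩
  have hL : LipschitzOnWith C γ (P '' S) := by
    refine LipschitzOnWith.of_dist_le_mul fun w hw w' hw' => ?_
    have := hC _ (hγ w hw).1 _ (hγ w' hw').1
    rwa [(hγ w hw).2, (hγ w' hw').2] at this
  have hsub : S ⊆ γ '' (P '' S) := by
    intro x hx
    have hx' : P x ∈ P '' S := ⟨x, hx, rfl⟩
    refine ⟨P x, hx', ?_⟩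
    have h1 := hC _ (hγ _ hx').1 _ hx
    rw [(hγ _ hx').2, dist_self, mul_zero] at h1
    exact dist_le_zero.1 h1
  have h := hL.hausdorffMeasure_image_le (d := (n : ℝ)) (Nat.cast_nonneg n)
  have hfin : (μHE[n] : Measure (E n)) (P '' S) < ⊤ := by
    rw [EuclideanSpace.euclideanHausdorffMeasure_eq_volume n]
    exact (hP.lipschitz.isBounded_image hS).measure_lt_top
  rw [Measure.euclideanHausdorffMeasure_def, Measure.smul_apply] at hfin ⊢
  refine lt_of_le_of_lt ?_ (ENNReal.mul_lt_top (a := (C : ENNReal) ^ (n : ℝ)) (by simp) hfin)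
  rw [ENNReal.smul_def, ENNReal.smul_def, smul_eq_mul, smul_eq_mul, mul_left_comm]
  gcongr
  exact (measure_mono hsub).trans h

/-- Integrals over a slab around a graph are controlled by integrals over the graph. -/
lemma lintegral_slab_le (hP : IsFrame N P) (hN : ‖N‖ = 1) {S : Set (E (n + 1))} (hS : IsCompact S)
    (hinj : Set.InjOn P S) {F : E (n + 1) → ENNReal} (hF : ContinuousOn F S)
    {B : Set (E (n + 1))} (hB : MeasurableSet B) {π : E (n + 1) → E (n + 1)} {L : ℝ}
    (hπ : ∀ y ∈ B, π y ∈ S ∧ ∃ s : ℝ, |s| ≤ L ∧ π y = y + s • N) :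
    ∫⁻ y in B, F (π y) ≤ ENNReal.ofReal (2 * L) * ∫⁻ x in S, F x ∂(μHE[n] : Measure (E (n + 1))) := by
  have : CompactSpace S := isCompact_iff_compactSpace.1 hS
  let e : S → E n := fun x => P x
  have hec : Continuous e := P.continuous.comp continuous_subtype_val
  have hei : Function.Injective e := fun x y h => Subtype.ext (hinj x.2 y.2 h)
  have heE : MeasurableEmbedding e := (hec.isClosedEmbedding hei).measurableEmbedding
  -- `S` is a graph over `P '' S`: `G` is `F` read off on the base and `H` is the height of the
  -- graph. Compactness makes `e` a closed embedding, whence measurability of both; `π` itself need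
  -- not be measurable, since `F ∘ π` factors through `G ∘ P` on `B`.
  let G : E n → ENNReal := Function.extend e (fun x => F x) 0
  let H : E n → ℝ := Function.extend e (fun x => inner ℝ N (x : E (n + 1))) 0
  have hG : Measurable G :=
    heE.measurable_extend (continuousOn_iff_continuous_domRestrict.1 hF).measurable measurable_zero
  have hH : Measurable H := by
    refine heE.measurable_extend ?_ measurable_zero
    exact (continuous_const.inner continuous_subtype_val).measurable
  have hGe : ∀ x ∈ S, G (P x) = F x := fun x hx => hei.extend_apply (fun x => F x) 0 ⟨x, hx⟩
  have hHe : ∀ x ∈ S, H (P x) = inner ℝ N x := fun x hx =>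
    hei.extend_apply (fun x => inner ℝ N (x : E (n + 1))) 0 ⟨x, hx⟩
  let D : Set (ℝ × E n) := {p | |p.1 - H p.2| ≤ L}
  have hD : MeasurableSet D := by
    refine measurableSet_le ?_ measurable_const
    exact continuous_abs.measurable.comp (measurable_fst.sub (hH.comp measurable_snd))
  let K : ℝ × E n → ENNReal := D.indicator fun p => G p.2
  have hK : Measurable K := (hG.comp measurable_snd).indicator hD
  calc ∫⁻ y in B, F (π y) ≤ ∫⁻ y in B, K (inner ℝ N y, P y) := by
        refine setLIntegral_mono' hB fun y hy => ?_
        obtain ⟨hyS, s, hs, hys⟩ := hπ y hy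
        have hPy : P (π y) = P y := by rw [hys, hP.apply_add_smul hN]
        have h1 : ((inner ℝ N y : ℝ), P y) ∈ D := by
          simp only [D, Set.mem_ofPred_eq]
          rw [← hPy, hHe _ hyS, hys, inner_add_right, inner_smul_right,
            real_inner_self_eq_norm_sq, hN]
          simpa using hs
        simp only [K, Set.indicator_of_mem h1]
        rw [← hPy, hGe _ hyS]
    _ ≤ ∫⁻ y, K (inner ℝ N y, P y) := setLIntegral_le_lintegral _ _
    _ = ∫⁻ p, K p ∂((volume : Measure ℝ).prod (volume : Measure (E n))) :=
        hP.measurePreserving.lintegral_comp hK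
    _ = ∫⁻ w, ∫⁻ s, K (s, w) := lintegral_prod_symm _ hK.aemeasurable
    _ = ∫⁻ w, ENNReal.ofReal (2 * L) * G w := by
        refine lintegral_congr fun w => ?_
        have h1 : ∀ s, K (s, w) = (Metric.closedBall (H w) L).indicator (fun _ => G w) s := by
          intro s
          by_cases hs : |s - H w| ≤ L
          · rw [Set.indicator_of_mem (by simpa [Real.dist_eq] using hs)]
            exact Set.indicator_of_mem (s := D) hs _
          · rw [Set.indicator_of_notMem (by simpa [Real.dist_eq] using hs)]
            exact Set.indicator_of_notMem (s := D) hs _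
        simp only [h1]
        rw [lintegral_indicator_const Metric.isClosed_closedBall.measurableSet, Real.volume_closedBall,
          mul_comm]
    _ = ENNReal.ofReal (2 * L) * ∫⁻ w in Set.range e, G w := by
        rw [lintegral_const_mul _ hG, ← lintegral_indicator heE.measurableSet_range]
        congr 2 with w
        by_cases hw : w ∈ Set.range e
        · rw [Set.indicator_of_mem hw]
        · rw [Set.indicator_of_notMem hw]
          exact Function.extend_apply' _ _ _ hw
    _ ≤ ENNReal.ofReal (2 * L) * ∫⁻ w, G w ∂(((μHE[n] : Measure (E (n + 1))).restrict S).map P) := by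
        gcongr
        -- On the base, Lebesgue measure is dominated by the projected surface measure because `P`
        -- is a contraction.
        refine Measure.le_iff.2 fun A hA => ?_
        rw [Measure.restrict_apply hA, Measure.map_apply P.continuous.measurable hA,
          Measure.restrict_apply (P.continuous.measurable hA)]
        refine le_trans (measure_mono ?_) (hP.volume_image_le _)
        rintro w ⟨hwA, ⟨x, rfl⟩⟩
        exact ⟨x, ⟨hwA, x.2⟩, rfl⟩
    _ = ENNReal.ofReal (2 * L) * ∫⁻ x in S, G (P x) ∂(μHE[n] : Measure (E (n + 1))) := by
        rw [lintegral_map hG P.continuous.measurable]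
    _ = _ := by
        congr 1
        exact setLIntegral_congr_fun hS.measurableSet fun x hx => hGe x hx

end IsFrame

/-- A sign change inside a convex set produces a zero set of positive `n`-dimensional measure. -/
lemma measure_pos_of_sign_change_interior {n : ℕ} {K : Set (E (n + 1))} (hK : Convex ℝ K)
    {f : E (n + 1) → ℝ} (hf : ContinuousOn f K) {p y : E (n + 1)} (hp : p ∈ interior K)
    (hy : y ∈ interior K) (hfp : f p < 0) (hfy : 0 < f y) :
    0 < (μHE[n] : Measure (E (n + 1))) (K ∩ {x | f x = 0}) := by
  have hne : y - p ≠ 0 := by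
    intro h
    rw [sub_eq_zero.1 h] at hfy
    linarith
  have hnorm : 0 < ‖y - p‖ := norm_pos_iff.2 hne
  obtain ⟨P, hP⟩ := exists_isFrame (N := ‖y - p‖⁻¹ • (y - p)) (by
    rw [norm_smul, norm_inv, norm_norm, inv_mul_cancel₀ hnorm.ne'])
  have hPyp : P (y - p) = 0 := by
    have := hP.apply_self (by rw [norm_smul, norm_inv, norm_norm, inv_mul_cancel₀ hnorm.ne'])
    rw [map_smul, smul_eq_zero] at this
    exact this.resolve_left (inv_ne_zero hnorm.ne')
  have hKn : ∀ x ∈ interior K, K ∈ nhds x := fun x hx => mem_interior_iff_mem_nhds.1 hx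
  obtain ⟨ε₁, hε₁, h₁⟩ := Metric.mem_nhds_iff.1 (Filter.inter_mem (hKn p hp)
    ((hf.continuousAt (hKn p hp)).preimage_mem_nhds (Iio_mem_nhds hfp)))
  obtain ⟨ε₂, hε₂, h₂⟩ := Metric.mem_nhds_iff.1 (Filter.inter_mem (hKn y hy)
    ((hf.continuousAt (hKn y hy)).preimage_mem_nhds (Ioi_mem_nhds hfy)))
  have hε : 0 < min ε₁ ε₂ := lt_min hε₁ hε₂
  -- On every line parallel to `y - p` that passes close to `p` the function still changes sign. The
  -- projection of the zero set along this direction therefore contains a ball, which bounds its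
  -- measure from below.
  refine lt_of_lt_of_le (Metric.measure_ball_pos volume (P p) hε)
    ((measure_mono ?_).trans (hP.volume_image_le _))
  intro w hw
  obtain ⟨u, hu, hu0⟩ := hP.exists_eq (w - P p)
  have hun : ‖u‖ < min ε₁ ε₂ := by
    have h3 := hP.norm_sq u
    rw [hu0, hu, ← dist_eq_norm] at h3
    have h4 : ‖u‖ ^ 2 = dist w (P p) ^ 2 := by linarith
    rw [(sq_eq_sq₀ (norm_nonneg _) dist_nonneg).1 h4]
    exact hw
  have hpu : p + u ∈ K ∩ f ⁻¹' Set.Iio 0 :=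
    h₁ (by simpa using hun.trans_le (min_le_left _ _))
  have hyu : y + u ∈ K ∩ f ⁻¹' Set.Ioi 0 :=
    h₂ (by simpa using hun.trans_le (min_le_right _ _))
  have hseg : segment ℝ (p + u) (y + u) ⊆ K := hK.segment_subset hpu.1 hyu.1
  obtain ⟨x, hx, hx0⟩ := (convex_segment (𝕜 := ℝ) (p + u) (y + u)).isPreconnected.intermediate_value
    (left_mem_segment ℝ _ _) (right_mem_segment ℝ _ _) (hf.mono hseg) ⟨hpu.2.le, hyu.2.le⟩
  refine ⟨x, ⟨hseg hx, hx0⟩, ?_⟩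
  rw [segment_eq_image'] at hx
  obtain ⟨t, -, rfl⟩ := hx
  have h5 : y + u - (p + u) = y - p := by abel
  simp only [h5, map_add, map_smul, hPyp, hu, smul_zero, add_zero]
  abel

/-- By continuity both points may be moved into the interior without losing the signs. -/
lemma measure_pos_of_sign_change {n : ℕ} {K : Set (E (n + 1))} (hK : Convex ℝ K)
    (hne : (interior K).Nonempty) {f : E (n + 1) → ℝ} (hf : ContinuousOn f K) {p y : E (n + 1)}
    (hp : p ∈ K) (hy : y ∈ K) (hfp : f p < 0) (hfy : 0 < f y) :
    0 < (μHE[n] : Measure (E (n + 1))) (K ∩ {x | f x = 0}) := by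
  have key : ∀ x ∈ K, ∀ U : Set ℝ, U ∈ nhds (f x) → ∃ x' ∈ interior K, f x' ∈ U := by
    intro x hx U hU
    have h1 : x ∈ closure (interior K) := by
      rw [hK.closure_interior_eq_closure_of_nonempty_interior hne]
      exact subset_closure hx
    have h2 : ∀ᶠ x' in nhdsWithin x (interior K), f x' ∈ U :=
      (hf x hx).mono_left (nhdsWithin_mono x interior_subset) hU
    have : (nhdsWithin x (interior K)).NeBot := mem_closure_iff_nhdsWithin_neBot.1 h1
    obtain ⟨x', h3, h4⟩ := (h2.and self_mem_nhdsWithin).exists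
    exact ⟨x', h4, h3⟩
  obtain ⟨p', hp', hfp'⟩ := key p hp _ (Iio_mem_nhds hfp)
  obtain ⟨y', hy', hfy'⟩ := key y hy _ (Ioi_mem_nhds hfy)
  exact measure_pos_of_sign_change_interior hK hf hp' hy' hfp' hfy'

/-! ### Columns of interface elements -/

/-- On `A`, the function `f` is affine with gradient `N` up to a perturbation of Lipschitz
constant `η`. -/
def NearLinear {d : ℕ} (f : E d → ℝ) (N : E d) (η : ℝ) (A : Set (E d)) : Prop :=
  ∀ x ∈ A, ∀ y ∈ A, |f x - f y - inner ℝ N (x - y)| ≤ η * dist x y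

namespace NearLinear

variable {d : ℕ} {f : E d → ℝ} {N : E d} {η : ℝ} {A : Set (E d)}

lemma neg (h : NearLinear f N η A) : NearLinear (fun x => -f x) (-N) η A := by
  intro x hx y hy
  rw [← abs_neg]
  convert h x hx y hy using 2
  rw [inner_neg_left]
  ring

lemma mono (h : NearLinear f N η A) {B : Set (E d)} (hB : B ⊆ A) : NearLinear f N η B :=
  fun x hx y hy => h x (hB hx) y (hB hy)

lemma abs_sub_le (h : NearLinear f N η A) (hN : ‖N‖ = 1) {x y : E d} (hx : x ∈ A) (hy : y ∈ A) :
    |f x - f y| ≤ (1 + η) * dist x y := by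
  have h1 := h x hx y hy
  have h2 : |(inner ℝ N (x - y) : ℝ)| ≤ dist x y := by
    rw [dist_eq_norm]
    simpa [hN] using abs_real_inner_le_norm N (x - y)
  have h3 := abs_le.1 h1
  have h4 := abs_le.1 h2
  rw [abs_le]
  constructor <;> nlinarith

lemma continuousOn (h : NearLinear f N η A) (hN : ‖N‖ = 1) (hη : 0 ≤ η) : ContinuousOn f A := by
  have : LipschitzOnWith (Real.toNNReal (1 + η)) f A := by
    refine LipschitzOnWith.of_dist_le_mul fun x hx y hy => ?_
    rw [Real.coe_toNNReal _ (by linarith), Real.dist_eq]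
    exact h.abs_sub_le hN hx hy
  exact this.continuousOn

lemma abs_smul_sub_le (h : NearLinear f N η A) (hN : ‖N‖ = 1) {x : E d} {s : ℝ} (hx : x ∈ A)
    (hy : x + s • N ∈ A) : |f (x + s • N) - f x - s| ≤ η * |s| := by
  have := h _ hy x hx
  rw [add_sub_cancel_left, inner_smul_right, real_inner_self_eq_norm_sq, hN, dist_eq_norm,
    add_sub_cancel_left, norm_smul, hN] at this
  simpa using this

end NearLinear

/-- An element cut by the zero set contains a minimiser of `f` in the relative interior of a face
which is itself cut by the zero set, or at which `f` is negative. -/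
lemma exists_carrier {n : ℕ} {s : Finset (E (n + 1))} {f : E (n + 1) → ℝ} {Γ : Set (E (n + 1))}
    (hf : ContinuousOn f (convexHull ℝ (s : Set (E (n + 1)))))
    (hΓ : ∀ x ∈ convexHull ℝ (s : Set (E (n + 1))), x ∈ Γ → f x = 0)
    (hpos : 0 < (μHE[n] : Measure (E (n + 1))) (convexHull ℝ (s : Set (E (n + 1))) ∩ Γ)) :
    ∃ p, ∃ G ⊆ s, ∃ w, IsBaryOn G p w ∧ (∀ z ∈ G, 0 < w z) ∧
      (∀ x ∈ convexHull ℝ (s : Set (E (n + 1))), f p ≤ f x) ∧ f p ≤ 0 ∧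
      (f p < 0 ∨ 0 < (μHE[n] : Measure (E (n + 1))) (convexHull ℝ (G : Set (E (n + 1))) ∩ Γ)) := by
  classical
  obtain ⟨x₁, hx₁⟩ := nonempty_of_measure_ne_zero hpos.ne'
  obtain ⟨p₀, hp₀, hmin⟩ := (isCompact_convexHull_finset s).exists_isMinOn ⟨x₁, hx₁.1⟩ hf
  have hmin' : ∀ x ∈ convexHull ℝ (s : Set (E (n + 1))), f p₀ ≤ f x := fun x hx => hmin hx
  have hle : f p₀ ≤ 0 := by
    rw [← hΓ x₁ hx₁.1 hx₁.2]
    exact hmin' _ hx₁.1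
  -- With a negative minimum, the face spanned by the vertices of positive weight serves.
  rcases hle.lt_or_eq with hlt | heq
  · obtain ⟨w, hw⟩ := exists_isBaryOn hp₀
    refine ⟨p₀, s.filter (fun z => w z ≠ 0), Finset.filter_subset _ _, w, ⟨fun z hz => ?_, hw.2.1,
      ?_, ?_⟩, fun z hz => ?_, hmin', hle, Or.inl hlt⟩
    · by_cases hzs : z ∈ s
      · by_contra h0
        exact hz (Finset.mem_filter.2 ⟨hzs, h0⟩)
      · exact hw.1 z hzs
    · rw [Finset.sum_filter_ne_zero, hw.2.2.1]
    · rw [← hw.2.2.2, Finset.sum_filter]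
      refine Finset.sum_congr rfl fun z _ => ?_
      split_ifs with h0
      · rfl
      · rw [not_not.1 h0, zero_smul]
    · exact lt_of_le_of_ne (hw.2.1 z) (Finset.mem_filter.1 hz).2.symm
  -- With minimum zero, all points of Γ in the element are minimisers. Take a face with the fewest
  -- vertices among those meeting Γ in positive measure: its proper faces contribute only a null
  -- set, so some point of Γ lies in its relative interior.
  · let 𝒢 := s.powerset.filter fun G : Finset (E (n + 1)) =>
      0 < (μHE[n] : Measure (E (n + 1))) (convexHull ℝ (G : Set (E (n + 1))) ∩ Γ)
    have hs𝒢 : s ∈ 𝒢 := by simp [𝒢, hpos]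
    obtain ⟨G, hG, hGmin⟩ := Finset.exists_min_image 𝒢 Finset.card ⟨s, hs𝒢⟩
    have hG' := Finset.mem_filter.1 hG
    have hGs : G ⊆ s := Finset.mem_powerset.1 hG'.1
    have hnull : (μHE[n] : Measure (E (n + 1)))
        (⋃ z ∈ G, convexHull ℝ ((G.erase z : Finset (E (n + 1))) : Set (E (n + 1))) ∩ Γ) = 0 := by
      refine (measure_biUnion_null_iff G.countable_toSet).2 fun z hz => ?_
      by_contra hne
      have h1 : G.erase z ∈ 𝒢 := Finset.mem_filter.2
        ⟨Finset.mem_powerset.2 ((Finset.erase_subset _ _).trans hGs), pos_iff_ne_zero.2 hne⟩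
      exact absurd (hGmin _ h1) (not_le.2 (Finset.card_erase_lt_of_mem hz))
    obtain ⟨p, hp, hpn⟩ : ∃ p ∈ convexHull ℝ (G : Set (E (n + 1))) ∩ Γ,
        p ∉ ⋃ z ∈ G, convexHull ℝ ((G.erase z : Finset (E (n + 1))) : Set (E (n + 1))) ∩ Γ := by
      by_contra! hcon
      exact hG'.2.ne' (measure_mono_null hcon hnull)
    have hps := convexHull_mono (𝕜 := ℝ) (Finset.coe_subset.2 hGs) hp.1
    have hfp : f p = 0 := hΓ p hps hp.2
    obtain ⟨w, hw⟩ := exists_isBaryOn hp.1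
    refine ⟨p, G, hGs, w, hw, fun z hz => lt_of_le_of_ne (hw.2.1 z) fun h0 => hpn ?_,
      fun x hx => by rw [hfp, ← heq]; exact hmin' x hx, hfp.le, Or.inr hG'.2⟩
    refine Set.mem_iUnion₂.2 ⟨z, hz, ?_, hp.2⟩
    refine Finset.mem_convexHull'.2 ⟨w, fun y _ => hw.2.1 y, ?_, ?_⟩
    · rw [Finset.sum_erase _ h0.symm]
      exact hw.2.2.1
    · rw [Finset.sum_erase _ (by rw [← h0, zero_smul])]
      exact hw.2.2.2

/-- At a minimiser in the relative interior of a face, the face is almost horizontal. -/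
lemma inner_vertex_sub_le {d : ℕ} {G : Finset (E d)} {p : E d} {w : E d → ℝ} (hw : IsBaryOn G p w)
    (hwpos : ∀ z ∈ G, 0 < w z) {f : E d → ℝ} {N : E d} {η : ℝ}
    (hf : NearLinear f N η (convexHull ℝ (G : Set (E d))))
    (hmin : ∀ x ∈ convexHull ℝ (G : Set (E d)), f p ≤ f x) {z : E d} (hz : z ∈ G) :
    inner ℝ N (z - p) ≤ η * ‖z - p‖ := by
  classical
  -- Moving from `p` away from `z` by the fraction `θ` stays in the face, since the weight of `z`
  -- becomes `(1 + θ) θ - θ = θ²`. Minimality at `p` then excludes an upward slope towards `z`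
  -- larger than `η`.
  set θ := w z with hθ
  have hθpos : 0 < θ := hwpos z hz
  have hp' : p - θ • (z - p) ∈ convexHull ℝ (G : Set (E d)) := by
    refine Finset.mem_convexHull'.2 ⟨fun y => (1 + θ) * w y - if y = z then θ else 0, ?_, ?_, ?_⟩
    · intro y hy
      dsimp only
      split_ifs with h
      · subst h
        nlinarith
      · have := hwpos y hy
        simp only [sub_zero]
        positivity
    · rw [Finset.sum_sub_distrib, ← Finset.mul_sum, hw.2.2.1, Finset.sum_ite_eq' G z]
      simp [hz]
    · simp only [sub_smul, mul_smul, ite_smul, zero_smul]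
      rw [Finset.sum_sub_distrib, ← Finset.smul_sum, hw.2.2.2, Finset.sum_ite_eq' G z]
      simp only [hz, if_true]
      module
  have h1 := hf _ hp' p hw.mem_convexHull
  have h2 := hmin _ hp'
  have h3 : p - θ • (z - p) - p = -(θ • (z - p)) := by abel
  rw [dist_eq_norm, h3, inner_neg_right, inner_smul_right, norm_neg, norm_smul,
    Real.norm_of_nonneg hθpos.le] at h1
  have h4 := (abs_le.1 h1).2
  have h5 : θ * inner ℝ N (z - p) ≤ θ * (η * ‖z - p‖) := by linarith
  exact le_of_mul_le_mul_left h5 hθpos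

/-- The barycentre of a face. -/
lemma isBaryOn_centroid {d : ℕ} [DecidableEq (E d)] {G : Finset (E d)} (hG : G.Nonempty) :
    IsBaryOn G (∑ z ∈ G, (G.card : ℝ)⁻¹ • z) (fun z => if z ∈ G then (G.card : ℝ)⁻¹ else 0) := by
  have hc : (G.card : ℝ) ≠ 0 := by exact_mod_cast hG.card_pos.ne'
  refine ⟨fun z hz => if_neg hz, fun z => ?_, ?_, ?_⟩
  · dsimp only
    split_ifs <;> positivity
  · rw [Finset.sum_congr rfl fun z hz => if_pos hz]
    simp [hc]
  · exact Finset.sum_congr rfl fun z hz => by simp only [if_pos hz]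

/-- The local situation near an interface element: `f` is nearly linear on a ball of radius `3 h`
around the point `x₀`, which is covered by elements of diameter at most `h` that contain balls of
radius `r`. -/
structure LocalCut {n : ℕ} (𝒦 : Geometry.SimplicialComplex ℝ (E (n + 1))) (Γ : Set (E (n + 1)))
    (h r η : ℝ) (x₀ N : E (n + 1)) (f : E (n + 1) → ℝ) : Prop where
  finite : 𝒦.faces.Finite
  r_pos : 0 < r
  inball : ∀ T ∈ elements 𝒦, ∃ m, Metric.closedBall m r ⊆ T
  diam_le : ∀ T ∈ elements 𝒦, Metric.diam T ≤ h
  norm_eq : ‖N‖ = 1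
  near : NearLinear f N η (Metric.closedBall x₀ (3 * h))
  covered : Metric.closedBall x₀ (3 * h) ⊆ ⋃₀ elements 𝒦
  mem_iff : ∀ x ∈ Metric.closedBall x₀ (3 * h), x ∈ Γ ↔ f x = 0

/-- The elements cut by `Γ`. -/
def cutElements {n : ℕ} (𝒦 : Geometry.SimplicialComplex ℝ (E (n + 1))) (Γ : Set (E (n + 1))) :
    Set (Set (E (n + 1))) :=
  {T | T ∈ elements 𝒦 ∧ 0 < (μHE[n] : Measure (E (n + 1))) (T ∩ Γ)}

lemma isBounded_of_mem_elements {d : ℕ} {𝒦 : Geometry.SimplicialComplex ℝ (E d)} {T : Set (E d)}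
    (hT : T ∈ elements 𝒦) : Bornology.IsBounded T := by
  obtain ⟨s, -, rfl⟩ := mem_elements_iff.1 hT
  exact (isCompact_convexHull_finset s).isBounded

lemma isCompact_of_mem_elements {d : ℕ} {𝒦 : Geometry.SimplicialComplex ℝ (E d)} {T : Set (E d)}
    (hT : T ∈ elements 𝒦) : IsCompact T := by
  obtain ⟨s, -, rfl⟩ := mem_elements_iff.1 hT
  exact isCompact_convexHull_finset s

lemma convex_of_mem_elements {d : ℕ} {𝒦 : Geometry.SimplicialComplex ℝ (E d)} {T : Set (E d)}
    (hT : T ∈ elements 𝒦) : Convex ℝ T := by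
  obtain ⟨s, -, rfl⟩ := mem_elements_iff.1 hT
  exact convex_convexHull ℝ _

lemma isClosed_sUnion_of_subset_elements {d : ℕ} {𝒦 : Geometry.SimplicialComplex ℝ (E d)}
    (hf : 𝒦.faces.Finite) {𝒯 : Set (Set (E d))} (h𝒯 : 𝒯 ⊆ elements 𝒦) : IsClosed (⋃₀ 𝒯) := by
  rw [Set.sUnion_eq_biUnion]
  exact ((finite_elements hf).subset h𝒯).isClosed_biUnion fun _ hT =>
    (isCompact_of_mem_elements (h𝒯 hT)).isClosed

/-- A ball inside a convex set, shrunk towards a point of the set. -/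
lemma closedBall_shrink_subset {d : ℕ} {T : Set (E d)} (hT : Convex ℝ T) {g m : E d} {r t : ℝ}
    (hg : g ∈ T) (hm : Metric.closedBall m r ⊆ T) (ht : 0 < t) (ht1 : t ≤ 1) :
    Metric.closedBall (g + t • (m - g)) (t * r) ⊆ T := by
  intro x hx
  have h1 : m + t⁻¹ • (x - (g + t • (m - g))) ∈ T := by
    refine hm ?_
    rw [mem_closedBall_iff_norm, add_sub_cancel_left, norm_smul, norm_inv, Real.norm_of_nonneg ht.le,
      inv_mul_le_iff₀ ht]
    exact mem_closedBall_iff_norm.1 hx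
  have h2 := hT hg h1 (sub_nonneg.2 ht1) ht.le (by ring)
  have h3 : (1 - t) • g + t • (m + t⁻¹ • (x - (g + t • (m - g)))) = x := by
    rw [smul_add, smul_inv_smul₀ ht.ne']
    module
  rwa [h3] at h2

/-- A ball inside `T` from which the columns in direction `N` reach the zero set of `f` inside the
union of the cut elements. -/
def HasColumns {n : ℕ} (𝒦 : Geometry.SimplicialComplex ℝ (E (n + 1))) (Γ : Set (E (n + 1)))
    (h ν : ℝ) (N : E (n + 1)) (f : E (n + 1) → ℝ) (T : Set (E (n + 1))) : Prop :=
  ∃ y₀, Metric.closedBall y₀ ν ⊆ T ∧ ∀ y ∈ Metric.closedBall y₀ ν, ∃ s : ℝ, |s| ≤ h ∧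
    f (y + s • N) = 0 ∧ segment ℝ y (y + s • N) ⊆ ⋃₀ cutElements 𝒦 Γ

/-- Reversing the signs of `f` and `N` preserves the columns, so the function may be assumed
nonnegative at the centre of the inscribed ball. -/
lemma HasColumns.of_neg {n : ℕ} {𝒦 : Geometry.SimplicialComplex ℝ (E (n + 1))}
    {Γ : Set (E (n + 1))} {h ν : ℝ} {N : E (n + 1)} {f : E (n + 1) → ℝ} {T : Set (E (n + 1))}
    (H : HasColumns 𝒦 Γ h ν (-N) (fun x => -f x) T) : HasColumns 𝒦 Γ h ν N f T := by
  obtain ⟨y₀, hy₀, H⟩ := H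
  refine ⟨y₀, hy₀, fun y hy => ?_⟩
  obtain ⟨s, hs, hs0, hseg⟩ := H y hy
  rw [smul_neg, ← neg_smul] at hs0 hseg
  exact ⟨-s, by rwa [abs_neg], neg_eq_zero.1 hs0, hseg⟩

namespace LocalCut

variable {n : ℕ} {𝒦 : Geometry.SimplicialComplex ℝ (E (n + 1))} {Γ : Set (E (n + 1))}
  {h r η : ℝ} {x₀ N : E (n + 1)} {f : E (n + 1) → ℝ}

lemma neg (H : LocalCut 𝒦 Γ h r η x₀ N f) : LocalCut 𝒦 Γ h r η x₀ (-N) (fun x => -f x) where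
  finite := H.finite
  r_pos := H.r_pos
  inball := H.inball
  diam_le := H.diam_le
  norm_eq := by rw [norm_neg, H.norm_eq]
  near := H.near.neg
  covered := H.covered
  mem_iff := fun x hx => by rw [H.mem_iff x hx, neg_eq_zero]

lemma two_mul_r_le (H : LocalCut 𝒦 Γ h r η x₀ N f) {T : Set (E (n + 1))} (hT : T ∈ elements 𝒦) :
    2 * r ≤ h := by
  obtain ⟨m, hm⟩ := H.inball T hT
  have h1 : m + r • N ∈ T := hm (by simp [norm_smul, H.norm_eq, abs_of_pos H.r_pos])
  have h2 : m - r • N ∈ T := hm (by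
    rw [mem_closedBall_iff_norm]
    simp [norm_smul, H.norm_eq, abs_of_pos H.r_pos])
  have h3 := Metric.dist_le_diam_of_mem (isBounded_of_mem_elements hT) h1 h2
  have h4 : m + r • N - (m - r • N) = (2 * r) • N := by module
  rw [dist_eq_norm, h4, norm_smul, H.norm_eq, Real.norm_of_nonneg (by linarith [H.r_pos]),
    mul_one] at h3
  exact h3.trans (H.diam_le T hT)

lemma subset_closedBall (H : LocalCut 𝒦 Γ h r η x₀ N f) {T : Set (E (n + 1))}
    (hT : T ∈ elements 𝒦) {x : E (n + 1)} (hx : x ∈ T) : T ⊆ Metric.closedBall x h := fun _ hy =>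
  (Metric.dist_le_diam_of_mem (isBounded_of_mem_elements hT) hy hx).trans (H.diam_le T hT)

/-- Along a line in direction `N`, a sign change of `f` happens at the expected distance. -/
lemma exists_zero (H : LocalCut 𝒦 Γ h r η x₀ N f) (hη : 0 ≤ η) {y : E (n + 1)} {a b : ℝ}
    (hab : a ≤ b) (hmem : ∀ s ∈ Set.Icc a b, y + s • N ∈ Metric.closedBall x₀ (3 * h))
    (ha : f (y + a • N) ≤ 0) (hb : 0 ≤ f (y + b • N)) : ∃ s ∈ Set.Icc a b, f (y + s • N) = 0 := by
  have hc : ContinuousOn (fun s : ℝ => f (y + s • N)) (Set.Icc a b) :=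
    (H.near.continuousOn H.norm_eq hη).comp (by fun_prop) hmem
  exact intermediate_value_Icc hab hc ⟨ha, hb⟩

/-- Case of a deep cut. On the segment from `p` to the incentre `m` there is a zero of `f`, and the
depth of `f p` keeps it away from `p`. Shrinking the inscribed ball towards `p` then gives a ball
around this zero inside `T`, and short columns in it already cross the zero set. -/
lemma hasColumns_fat (H : LocalCut 𝒦 Γ h r η x₀ N f) (hη : 0 ≤ η) (hη' : η ≤ 1 / 2)
    {T : Set (E (n + 1))} (hT : T ∈ cutElements 𝒦 Γ) (hx₀ : x₀ ∈ T) {p m : E (n + 1)} (hp : p ∈ T)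
    {ε : ℝ} (hε : 0 < ε) (hfp : f p < -(ε * h)) (hm : Metric.closedBall m r ⊆ T)
    (hfm : 0 ≤ f m) : HasColumns 𝒦 Γ h (ε * r / 16) N f T := by
  have hr := H.r_pos
  have h2r := H.two_mul_r_le hT.1
  have hh : 0 < h := by linarith
  have hmT : m ∈ T := hm (Metric.mem_closedBall_self hr.le)
  have hTA : T ⊆ Metric.closedBall x₀ (3 * h) :=
    (H.subset_closedBall hT.1 hx₀).trans (Metric.closedBall_subset_closedBall (by linarith))
  have hconv := convex_of_mem_elements hT.1
  have hseg := hconv.segment_subset hp hmT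
  obtain ⟨x₁, hx₁, hfx₁⟩ := (convex_segment (𝕜 := ℝ) p m).isPreconnected.intermediate_value
    (left_mem_segment ℝ _ _) (right_mem_segment ℝ _ _)
    ((H.near.continuousOn H.norm_eq hη).mono (hseg.trans hTA))
    ⟨by nlinarith, hfm⟩
  rw [segment_eq_image'] at hx₁
  obtain ⟨t, ht, rfl⟩ := hx₁
  have hpm : dist m p ≤ h := H.subset_closedBall hT.1 hp hmT
  -- `f` rises by at least `ε h` between `p` and the zero with slope at most `1 + η ≤ 2`, over a
  -- distance at most `t h`.
  have ht2 : ε ≤ 2 * t := by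
    have h1 := H.near.abs_sub_le H.norm_eq (hTA (hseg (by rw [segment_eq_image']; exact ⟨t, ht, rfl⟩)))
      (hTA hp)
    dsimp only at hfx₁ h1
    rw [hfx₁, dist_eq_norm, add_sub_cancel_left, norm_smul, Real.norm_of_nonneg ht.1,
      ← dist_eq_norm] at h1
    have h2 := (abs_le.1 h1).2
    have h3 : (1 + η) * (t * dist m p) ≤ 2 * (t * h) := by
      have h4 : t * dist m p ≤ t * h := mul_le_mul_of_nonneg_left hpm ht.1
      have h5 : 0 ≤ t * dist m p := mul_nonneg ht.1 dist_nonneg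
      nlinarith
    have h6 : ε * h ≤ 2 * t * h := by linarith
    exact le_of_mul_le_mul_right h6 hh
  have htpos : 0 < t := by linarith
  have hball := closedBall_shrink_subset hconv hp hm htpos ht.2
  set x₁ := p + t • (m - p) with hx₁
  set ν := ε * r / 16 with hν
  have hνpos : 0 < ν := by positivity
  have hνt : 8 * ν ≤ t * r := by
    rw [hν]; nlinarith
  refine ⟨x₁, (Metric.closedBall_subset_closedBall (by linarith)).trans hball, fun y hy => ?_⟩
  have hmem : ∀ s ∈ Set.Icc (-(4 * ν)) (4 * ν), y + s • N ∈ T := by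
    intro s hs
    refine hball (Metric.closedBall_subset_closedBall (ε₁ := 5 * ν) (by linarith) ?_)
    have h1 : dist (y + s • N) y ≤ 4 * ν := by
      rw [dist_eq_norm, add_sub_cancel_left, norm_smul, H.norm_eq, mul_one]
      exact abs_le.2 hs
    have := dist_triangle (y + s • N) y x₁
    rw [Metric.mem_closedBall] at hy ⊢
    linarith
  have hyT : y ∈ T := by simpa using hmem 0 ⟨by linarith, by linarith⟩
  have hx₁T : x₁ ∈ T := hball (Metric.mem_closedBall_self (by positivity))
  have hfy : |f y| ≤ 2 * ν := by
    have h1 := H.near.abs_sub_le H.norm_eq (hTA hyT) (hTA hx₁T)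
    rw [show f x₁ = 0 from hfx₁, sub_zero] at h1
    have h2 : dist y x₁ ≤ ν := hy
    have h3 : 0 ≤ dist y x₁ := dist_nonneg
    nlinarith
  have hstep : ∀ s ∈ Set.Icc (-(4 * ν)) (4 * ν), |f (y + s • N) - f y - s| ≤ η * |s| := fun s hs =>
    H.near.abs_smul_sub_le H.norm_eq (hTA hyT) (hTA (hmem s hs))
  -- Here `|f y| ≤ 2 ν`, while a step of `± 4 ν` along `N` changes `f` by at least `(1 - η) 4 ν ≥ 2
  -- ν`, so the sign changes in between.
  have hfy' := abs_le.1 hfy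
  obtain ⟨s, hs, hs0⟩ := H.exists_zero hη (y := y) (a := -(4 * ν)) (b := 4 * ν) (by linarith)
    (fun s hs => hTA (hmem s hs))
    (by
      have h1 := (abs_le.1 (hstep (-(4 * ν)) ⟨le_rfl, by linarith⟩)).2
      rw [abs_neg, abs_of_pos (by linarith : 0 < 4 * ν)] at h1
      nlinarith)
    (by
      have h1 := (abs_le.1 (hstep (4 * ν) ⟨by linarith, le_rfl⟩)).1
      rw [abs_of_pos (by linarith : 0 < 4 * ν)] at h1
      nlinarith)
  refine ⟨s, (abs_le.2 hs).trans ?_, hs0,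
    (hconv.segment_subset hyT (hmem s hs)).trans (Set.subset_sUnion_of_mem hT)⟩
  have : t * r ≤ r := by nlinarith [ht.2]
  linarith

/-- Case of a shallow cut: Γ may leave `T` near the face `G` that carries the minimiser, so the
columns must cross other elements. With `τ = t h`, all elements meeting the open ball of radius `14
τ` around the barycentre `g` of `G` contain the whole of `G`. Such an element is cut as soon as it
contains a point where `f > 0`, and columns descending to the zero set see only positive values
before they arrive. -/
lemma hasColumns_thin (H : LocalCut 𝒦 Γ h r η x₀ N f) (hη : 0 ≤ η) {t : ℝ}
    (ht : t * (14 * (n + 2) * h) = r) (hηt : η ≤ t)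
    {s : Finset (E (n + 1))} (hs : s ∈ simplices 𝒦)
    (hT : convexHull ℝ (s : Set (E (n + 1))) ∈ cutElements 𝒦 Γ)
    (hx₀ : x₀ ∈ convexHull ℝ (s : Set (E (n + 1)))) {m : E (n + 1)}
    (hm : Metric.closedBall m r ⊆ convexHull ℝ (s : Set (E (n + 1))))
    {p : E (n + 1)} {G : Finset (E (n + 1))} (hG : G ⊆ s) {w : E (n + 1) → ℝ}
    (hw : IsBaryOn G p w) (hwpos : ∀ z ∈ G, 0 < w z)
    (hmin : ∀ x ∈ convexHull ℝ (s : Set (E (n + 1))), f p ≤ f x) (hfp : f p ≤ 0)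
    (hfp' : -(t * r / 16) ≤ f p)
    (hcut : f p < 0 ∨ 0 < (μHE[n] : Measure (E (n + 1))) (convexHull ℝ (G : Set (E (n + 1))) ∩ Γ)) :
    HasColumns 𝒦 Γ h (t * r / 8) N f (convexHull ℝ (s : Set (E (n + 1)))) := by
  classical
  set T := convexHull ℝ (s : Set (E (n + 1))) with hTdef
  have hr := H.r_pos
  have h2r := H.two_mul_r_le hT.1
  have hh : 0 < h := by linarith
  have htpos : 0 < t := by
    by_contra hle
    have : t * (14 * (n + 2) * h) ≤ 0 := mul_nonpos_of_nonpos_of_nonneg (not_lt.1 hle) (by positivity)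
    linarith
  set τ := t * h with hτ
  have hτpos : 0 < τ := by positivity
  have hτr : 14 * τ * (n + 2) = r := by rw [hτ, ← ht]; ring
  have hn2 : (2 : ℝ) ≤ n + 2 := by linarith [(Nat.cast_nonneg n : (0 : ℝ) ≤ n)]
  have h28 : 28 * τ ≤ r := by nlinarith
  have ht1 : t ≤ 1 / 28 := by
    have h1 : 28 * (t * h) ≤ 1 * h := by linarith
    nlinarith
  have htr : 2 * (t * r) ≤ τ := by rw [hτ]; nlinarith
  have hmT : m ∈ T := hm (Metric.mem_closedBall_self hr.le)
  have hTh : ∀ {x y}, x ∈ T → y ∈ T → dist y x ≤ h := fun hx hy => H.subset_closedBall hT.1 hx hy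
  have hTA : T ⊆ Metric.closedBall x₀ (3 * h) :=
    (H.subset_closedBall hT.1 hx₀).trans (Metric.closedBall_subset_closedBall (by linarith))
  have hGT : convexHull ℝ (G : Set (E (n + 1))) ⊆ T :=
    convexHull_mono (Finset.coe_subset.2 hG)
  have hpT : p ∈ T := hGT hw.mem_convexHull
  have hGne : G.Nonempty := by
    rw [Finset.nonempty_iff_ne_empty]
    rintro rfl
    simpa using hw.2.2.1
  set g := ∑ z ∈ G, (G.card : ℝ)⁻¹ • z with hg
  have hgb := isBaryOn_centroid hGne
  rw [← hg] at hgb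
  have hgT : g ∈ T := hGT hgb.mem_convexHull
  have hcard : (0 : ℝ) < G.card := by exact_mod_cast hGne.card_pos
  -- The face is almost horizontal: averaging the slope bounds over its vertices costs `η h`, the
  -- deviation from linearity another `η h`, and `η h ≤ τ`.
  have hfg : f g ≤ 2 * τ := by
    have h1 : inner ℝ N (g - p) ≤ η * h := by
      have h2 : g - p = ∑ z ∈ G, (G.card : ℝ)⁻¹ • (z - p) := by
        simp only [smul_sub, Finset.sum_sub_distrib, ← hg, Finset.sum_const]
        rw [← Nat.cast_smul_eq_nsmul ℝ, smul_inv_smul₀ hcard.ne']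
      rw [h2, inner_sum]
      calc _ ≤ ∑ z ∈ G, (G.card : ℝ)⁻¹ * (η * h) := by
            refine Finset.sum_le_sum fun z hz => ?_
            rw [inner_smul_right]
            have h3 := inner_vertex_sub_le hw hwpos (H.near.mono (hGT.trans hTA))
              (fun x hx => hmin x (hGT hx)) hz
            have h4 : ‖z - p‖ ≤ h := by
              rw [← dist_eq_norm]
              exact hTh hpT (hGT (subset_convexHull ℝ _ hz))
            gcongr
            exact h3.trans (by gcongr)
        _ = _ := by
            rw [Finset.sum_const, nsmul_eq_mul, mul_inv_cancel_left₀ hcard.ne']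
    have h2 := (abs_le.1 (H.near g (hTA hgT) p (hTA hpT))).2
    have h3 : η * dist g p ≤ η * h := mul_le_mul_of_nonneg_left (hTh hpT hgT) hη
    have h4 : η * h ≤ τ := mul_le_mul_of_nonneg_right hηt hh.le
    linarith
  -- At the barycentre each vertex of `G` has weight `1 / card G`, and `G` has at most `n + 2`
  -- vertices because the ambient dimension is `n + 1`.
  have hhat : ∀ z ∈ G, (n + 2 : ℝ)⁻¹ ≤ hat 𝒦 g z := by
    intro z hz
    rw [hat_eq_of_isBaryOn (𝒦.down_closed hs.1 hG hGne) hgb]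
    simp only [if_pos hz]
    gcongr
    have h1 := Finset.card_le_card hG
    rw [hs.2] at h1
    exact_mod_cast h1
  -- elements near the barycentre which meet `f > 0` are cut
  have hnear : ∀ x, dist x g < 14 * τ → x ∈ Metric.closedBall x₀ (2 * h) := by
    intro x hx
    have h1 := dist_triangle x g x₀
    have h2 := hTh hx₀ hgT
    rw [Metric.mem_closedBall]
    nlinarith
  have hcutx : ∀ x, dist x g < 14 * τ → 0 < f x → x ∈ ⋃₀ cutElements 𝒦 Γ := by
    intro x hx hfx
    have hx2 := hnear x hx
    have hx3 : x ∈ Metric.closedBall x₀ (3 * h) :=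
      Metric.closedBall_subset_closedBall (by linarith) hx2
    obtain ⟨K, hK, hxK⟩ := H.covered hx3
    refine ⟨K, ⟨hK, ?_⟩, hxK⟩
    obtain ⟨s', hs', rfl⟩ := mem_elements_iff.1 hK
    have hKA : convexHull ℝ (s' : Set (E (n + 1))) ⊆ Metric.closedBall x₀ (3 * h) := by
      intro y hy
      have h1 := H.subset_closedBall hK hxK hy
      have h2 := dist_triangle y x x₀
      rw [Metric.mem_closedBall] at h1 hx2 ⊢
      linarith
    -- Nodal functions are Lipschitz with constant `1 / r`, and `14 τ / r = 1 / (n + 2)`. Hence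
    -- those of the vertices of `G` are still positive at `x`, so these vertices belong to every
    -- element containing `x`.
    have hGs' : G ⊆ s' := by
      intro z hz
      refine mem_of_hat_ne_zero (𝒦 := 𝒦) hs'.1 hxK ?_
      have hseg : segment ℝ g x ⊆ ⋃₀ elements 𝒦 :=
        ((convex_closedBall x₀ (3 * h)).segment_subset (hTA hgT) hx3).trans H.covered
      have h1 := (abs_le.1 (abs_hat_sub_hat_le H.finite hr H.inball hseg z)).1
      have h2 : dist x g / r < (n + 2 : ℝ)⁻¹ := by
        rw [div_lt_iff₀ hr, ← hτr, inv_mul_eq_div, lt_div_iff₀ (by linarith)]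
        nlinarith
      have h3 := hhat z hz
      exact (by linarith : 0 < hat 𝒦 x z).ne'
    have hGK := convexHull_mono (𝕜 := ℝ) (Finset.coe_subset.2 hGs')
    -- Either `p` and `x` give a sign change in the element, or `G` alone already meets Γ in
    -- positive measure.
    rcases hcut with hneg | hpos
    · obtain ⟨m', hm'⟩ := H.inball _ hK
      have hint : (interior (convexHull ℝ (s' : Set (E (n + 1))))).Nonempty :=
        ⟨m', interior_mono hm' (Metric.ball_subset_interior_closedBall (Metric.mem_ball_self hr))⟩
      refine lt_of_lt_of_le (measure_pos_of_sign_change (convex_convexHull ℝ _) hint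
        ((H.near.continuousOn H.norm_eq hη).mono hKA) (hGK hw.mem_convexHull) hxK hneg hfx)
        (measure_mono ?_)
      exact fun y hy => ⟨hy.1, (H.mem_iff y (hKA hy.1)).2 hy.2⟩
    · exact hpos.trans_le (measure_mono (Set.inter_subset_inter_left _ hGK))
  have hball := closedBall_shrink_subset (convex_convexHull ℝ _) hgT hm htpos (by linarith)
  -- The inscribed ball shrunk towards `g` has radius `t r`. Starting in its upper part leaves room
  -- in `T` to descend by `t r / 4`, which forces `f y > 0` because `f ≥ f p ≥ -(t r / 16)` on `T`.
  set y₀ := g + t • (m - g) + (t * r / 2) • N with hy₀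
  have htrpos : 0 < t * r := by positivity
  have hy₀b : ∀ y ∈ Metric.closedBall y₀ (t * r / 8), ∀ a ∈ Set.Icc (-(t * r / 4)) 0,
      y + a • N ∈ T := by
    intro y hy a ha
    refine hball ?_
    have h1 : y + a • N - (g + t • (m - g)) = (y - y₀) + (a + t * r / 2) • N := by
      rw [hy₀]; module
    rw [mem_closedBall_iff_norm, h1]
    refine (norm_add_le _ _).trans ?_
    rw [norm_smul, H.norm_eq, mul_one, Real.norm_of_nonneg (by linarith [ha.1])]
    have := mem_closedBall_iff_norm.1 hy
    linarith [ha.2]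
  have hyT : ∀ y ∈ Metric.closedBall y₀ (t * r / 8), y ∈ T := fun y hy => by
    simpa using hy₀b y hy 0 ⟨by linarith, le_rfl⟩
  refine ⟨y₀, hyT, fun y hy => ?_⟩
  have hyg : dist y g ≤ 1.4 * τ := by
    have h1 : y - g = (y - y₀) + t • (m - g) + (t * r / 2) • N := by rw [hy₀]; module
    rw [dist_eq_norm, h1]
    refine (norm_add_le _ _).trans ((add_le_add_left (norm_add_le _ _) _).trans ?_)
    rw [norm_smul, norm_smul, H.norm_eq, mul_one, Real.norm_of_nonneg htpos.le,
      Real.norm_of_nonneg (by linarith), ← dist_eq_norm m g]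
    have h2 := mem_closedBall_iff_norm.1 hy
    have h3 : t * dist m g ≤ τ := mul_le_mul_of_nonneg_left (hTh hgT hmT) htpos.le
    linarith
  have hfypos : 0 < f y := by
    have h1 := hy₀b y hy (-(t * r / 4)) ⟨le_rfl, by linarith⟩
    have h2 := H.near.abs_smul_sub_le H.norm_eq (hTA (hyT y hy)) (hTA h1)
    rw [abs_neg, abs_of_pos (by linarith : 0 < t * r / 4)] at h2
    have h3 := hmin _ h1
    have h4 := (abs_le.1 h2).2
    nlinarith
  have hfyle : f y ≤ 6 * τ := by
    have h1 := (abs_le.1 (H.near.abs_sub_le H.norm_eq (hTA (hyT y hy)) (hTA hgT))).2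
    have h2 : (1 + η) * dist y g ≤ 1.5 * (1.4 * τ) := by
      have : 0 ≤ dist y g := dist_nonneg
      nlinarith
    linarith
  have hdist : ∀ a ∈ Set.Icc (-(12 * τ)) 0, dist (y + a • N) g < 14 * τ := by
    intro a ha
    have h1 : dist (y + a • N) y ≤ 12 * τ := by
      rw [dist_eq_norm, add_sub_cancel_left, norm_smul, H.norm_eq, mul_one, Real.norm_eq_abs, abs_le]
      exact ⟨ha.1, ha.2.trans (by linarith)⟩
    have := dist_triangle (y + a • N) y g
    linarith
  have hmem : ∀ a ∈ Set.Icc (-(12 * τ)) 0, y + a • N ∈ Metric.closedBall x₀ (3 * h) := fun a ha =>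
    Metric.closedBall_subset_closedBall (by linarith) (hnear _ (hdist a ha))
  have hyA := hTA (hyT y hy)
  -- Since `f y ≤ 6 τ` and the slope along `N` is at least `1 - η ≥ 1 / 2`, descending by `12 τ`
  -- suffices; together with `dist y g ≤ 1.4 τ` this stays below `14 τ`.
  obtain ⟨a, ha, ha0⟩ := H.exists_zero hη (y := y) (a := -(12 * τ)) (b := 0) (by linarith) hmem
    (by
      have h1 := (abs_le.1 (H.near.abs_smul_sub_le H.norm_eq hyA
        (hmem (-(12 * τ)) ⟨le_rfl, by linarith⟩))).2
      rw [abs_neg, abs_of_pos (by linarith : 0 < 12 * τ)] at h1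
      nlinarith)
    (by simpa using hfypos.le)
  have haneg : a < 0 := by
    refine lt_of_le_of_ne ha.2 fun h0 => ?_
    rw [h0, zero_smul, add_zero] at ha0
    exact hfypos.ne' ha0
  refine ⟨a, ?_, ha0, ?_⟩
  · rw [abs_of_neg haneg]
    linarith [ha.1]
  · have hcl : IsClosed (⋃₀ cutElements 𝒦 Γ) :=
      isClosed_sUnion_of_subset_elements H.finite fun K hK => hK.1
    -- Above the zero `f` is positive, so these points lie in cut elements; the zero itself is
    -- reached by closedness of their union.
    have hIoc : ∀ b ∈ Set.Ioc a 0, y + b • N ∈ ⋃₀ cutElements 𝒦 Γ := by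
      intro b hb
      refine hcutx _ (hdist b ⟨ha.1.trans hb.1.le, hb.2⟩) ?_
      have h1 : y + a • N + (b - a) • N = y + b • N := by module
      have h2 := H.near.abs_smul_sub_le H.norm_eq (x := y + a • N) (s := b - a) (hmem a ha)
        (by rw [h1]; exact hmem b ⟨ha.1.trans hb.1.le, hb.2⟩)
      rw [h1, ha0, abs_of_pos (sub_pos.2 hb.1)] at h2
      have h3 := (abs_le.1 h2).1
      nlinarith [hb.1]
    have hIcc : ∀ b ∈ Set.Icc a 0, y + b • N ∈ ⋃₀ cutElements 𝒦 Γ := by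
      have h1 : Set.Icc a 0 = closure (Set.Ioc a 0) := (closure_Ioc haneg.ne).symm
      intro b hb
      rw [h1] at hb
      have hc : Continuous fun b : ℝ => y + b • N := by fun_prop
      exact (hcl.preimage hc).closure_subset_iff.2 hIoc hb
    intro x hx
    rw [segment_eq_image'] at hx
    obtain ⟨θ, hθ, rfl⟩ := hx
    have h1 : y + θ • (y + a • N - y) = y + (θ * a) • N := by module
    dsimp only
    rw [h1]
    exact hIcc _ ⟨by nlinarith [hθ.2], by nlinarith [hθ.1]⟩

/-- Every cut element has columns. -/
lemma hasColumns (H : LocalCut 𝒦 Γ h r η x₀ N f) (hη : 0 ≤ η) {t : ℝ}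
    (ht : t * (14 * (n + 2) * h) = r) (hηt : η ≤ t) {T : Set (E (n + 1))}
    (hT : T ∈ cutElements 𝒦 Γ) (hx₀ : x₀ ∈ T) : ∃ ν, t * r ^ 2 / (256 * h) ≤ ν ∧
      HasColumns 𝒦 Γ h ν N f T := by
  obtain ⟨s, hs, rfl⟩ := mem_elements_iff.1 hT.1
  obtain ⟨m, hm⟩ := H.inball _ hT.1
  have hr := H.r_pos
  have h2r := H.two_mul_r_le hT.1
  have hh : 0 < h := by linarith
  have htpos : 0 < t := by
    by_contra hle
    have : t * (14 * (n + 2) * h) ≤ 0 := mul_nonpos_of_nonpos_of_nonneg (not_lt.1 hle) (by positivity)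
    linarith
  have ht1 : t ≤ 1 / 2 := by
    have hn2 : (0 : ℝ) ≤ n := Nat.cast_nonneg n
    have h1 : t * h ≤ 1 / 2 * h := by nlinarith [mul_pos htpos hh, mul_nonneg hn2 (mul_pos htpos hh).le]
    exact le_of_mul_le_mul_right h1 hh
  have main : ∀ {N : E (n + 1)} {f : E (n + 1) → ℝ}, LocalCut 𝒦 Γ h r η x₀ N f → 0 ≤ f m →
      ∃ ν, t * r ^ 2 / (256 * h) ≤ ν ∧
        HasColumns 𝒦 Γ h ν N f (convexHull ℝ (s : Set (E (n + 1)))) := by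
    intro N f H hfm
    have hTA : convexHull ℝ (s : Set (E (n + 1))) ⊆ Metric.closedBall x₀ (3 * h) :=
      (H.subset_closedBall hT.1 hx₀).trans (Metric.closedBall_subset_closedBall (by linarith))
    obtain ⟨p, G, hG, w, hw, hwpos, hmin, hfp, hcut⟩ := exists_carrier
      ((H.near.continuousOn H.norm_eq hη).mono hTA) (fun x hx hxΓ => (H.mem_iff x (hTA hx)).1 hxΓ)
      hT.2
    -- The threshold corresponds to `ε = t r / (16 h)` in the deep case, whose radius `ε r / 16` is
    -- the asserted lower bound; the radius `t r / 8` of the shallow case is larger.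
    by_cases hc : -(t * r / 16) ≤ f p
    · refine ⟨t * r / 8, ?_, H.hasColumns_thin hη ht hηt hs hT hx₀ hm hG hw hwpos hmin hfp hc hcut⟩
      rw [div_le_iff₀ (by positivity)]
      have h1 : 0 < t * r := by positivity
      nlinarith
    · refine ⟨t * r / (16 * h) * r / 16, le_of_eq ?_, H.hasColumns_fat hη (hηt.trans ht1) hT hx₀
        (convexHull_mono (Finset.coe_subset.2 hG) hw.mem_convexHull) (by positivity) ?_ hm hfm⟩
      · field_simp
        norm_num
      · have h1 : t * r / (16 * h) * h = t * r / 16 := by field_simp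
        rw [h1]
        exact not_le.1 hc
  rcases le_total 0 (f m) with h0 | h0
  · exact main H h0
  · obtain ⟨ν, hν, hcol⟩ := main H.neg (neg_nonneg.2 h0)
    exact ⟨ν, hν, hcol.of_neg⟩

end LocalCut
/-! ### Measure-theoretic facts on meshes -/

/-- A finite simplicial complex whose elements contain balls of radius `r` and have diameter at
most `h`. -/
structure GoodMesh {d : ℕ} (𝒦 : Geometry.SimplicialComplex ℝ (E d)) (h r : ℝ) : Prop where
  finite : 𝒦.faces.Finite
  r_pos : 0 < r
  inball : ∀ T ∈ elements 𝒦, ∃ m, Metric.closedBall m r ⊆ T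
  diam_le : ∀ T ∈ elements 𝒦, Metric.diam T ≤ h

lemma IsMesh.goodMesh {d : ℕ} {bg : Set (E d)} {σ q h : ℝ}
    {𝒦 : Geometry.SimplicialComplex ℝ (E d)} (H : IsMesh bg σ q h 𝒦) (hσ : 0 < σ) (hq : 0 < q)
    (hh : 0 < h) : GoodMesh 𝒦 h (σ * q * h) where
  finite := H.finite
  r_pos := by positivity
  inball := fun T hT => by
    obtain ⟨x, hx⟩ := H.shapeRegular T hT
    refine ⟨x, (Metric.closedBall_subset_closedBall ?_).trans hx⟩
    rw [mul_assoc]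
    exact mul_le_mul_of_nonneg_left (H.quasiUniform T hT).1 hσ.le
  diam_le := fun T hT => (H.quasiUniform T hT).2

/-- Distinct elements share at most `d` vertices, so their intersection lies in a proper affine
subspace. -/
lemma volume_inter_elements_eq_zero {d : ℕ} {𝒦 : Geometry.SimplicialComplex ℝ (E d)}
    {T T' : Set (E d)} (hT : T ∈ elements 𝒦) (hT' : T' ∈ elements 𝒦) (hne : T ≠ T') :
    volume (T ∩ T') = 0 := by
  classical
  obtain ⟨s, hs, rfl⟩ := mem_elements_iff.1 hT
  obtain ⟨t, ht, rfl⟩ := mem_elements_iff.1 hT'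
  have hst : s ≠ t := fun h => hne (by rw [h])
  have hlt : (s ∩ t).card < d + 1 := by
    rw [← hs.2]
    refine Finset.card_lt_card ((Finset.inter_subset_left).ssubset_of_ne fun h => hst ?_)
    exact Finset.eq_of_subset_of_card_le (Finset.inter_eq_left.1 h) (by rw [hs.2, ht.2])
  have hsub : convexHull ℝ (s : Set (E d)) ∩ convexHull ℝ (t : Set (E d)) ⊆
      affineSpan ℝ ((s ∩ t : Finset (E d)) : Set (E d)) := by
    refine (𝒦.inter_subset_convexHull hs.1 ht.1).trans ?_
    rw [Finset.coe_inter]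
    exact convexHull_subset_affineSpan _
  refine measure_mono_null hsub (Measure.addHaar_affineSubspace volume _ fun htop => ?_)
  rcases (s ∩ t).eq_empty_or_nonempty with he | hne'
  · rw [he] at htop
    simp at htop
  · have h2 : Module.finrank ℝ (vectorSpan ℝ ((s ∩ t : Finset (E d)) : Set (E d))) ≤
        (s ∩ t).card - 1 := by
      have := finrank_vectorSpan_image_finset_le ℝ (id : E d → E d) (s ∩ t)
        (n := (s ∩ t).card - 1) (by have := hne'.card_pos; omega)
      rwa [Finset.image_id] at this
    have h3 : vectorSpan ℝ ((s ∩ t : Finset (E d)) : Set (E d)) = ⊤ := by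
      rw [← direction_affineSpan, htop, AffineSubspace.direction_top]
    rw [h3, finrank_top, finrank_euclideanSpace_fin] at h2
    have := hne'.card_pos
    omega

/-- The frontier of a convex set is null. Classical derivatives of piecewise polynomials are thereby
those of the pieces almost everywhere. -/
lemma ae_mem_interior_of_mem_elements {d : ℕ} {𝒦 : Geometry.SimplicialComplex ℝ (E d)}
    {T : Set (E d)} (hT : T ∈ elements 𝒦) : ∀ᵐ x ∂volume.restrict T, x ∈ interior T := by
  have hc := isCompact_of_mem_elements hT
  rw [ae_restrict_iff' hc.measurableSet]
  have h1 := (convex_of_mem_elements hT).addHaar_frontier volume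
  filter_upwards [compl_mem_ae_iff.2 h1] with x hx hxT
  by_contra hn
  exact hx ⟨subset_closure hxT, hn⟩

lemma setIntegral_sUnion_elements {d : ℕ} {𝒦 : Geometry.SimplicialComplex ℝ (E d)}
    {𝒯 : Finset (Set (E d))} (h𝒯 : ∀ T ∈ 𝒯, T ∈ elements 𝒦) {g : E d → ℝ}
    (hg : ∀ T ∈ 𝒯, IntegrableOn g T) :
    ∫ x in ⋃₀ (𝒯 : Set (Set (E d))), g x = ∑ T ∈ 𝒯, ∫ x in T, g x := by
  have h1 : ⋃₀ (𝒯 : Set (Set (E d))) = ⋃ T : {T // T ∈ 𝒯}, T.1 := by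
    rw [Set.sUnion_eq_iUnion]
    rfl
  have hint : IntegrableOn g (⋃ T : {T // T ∈ 𝒯}, T.1) :=
    integrableOn_finite_iUnion.2 fun T => hg T.1 T.2
  rw [h1, integral_iUnion_ae (fun T : {T // T ∈ 𝒯} => ((isCompact_of_mem_elements
    (h𝒯 T.1 T.2)).measurableSet).nullMeasurableSet) ?_ hint, tsum_fintype,
    Finset.sum_coe_sort 𝒯 fun T => ∫ x in T, g x]
  intro T T' hTT'
  exact volume_inter_elements_eq_zero (h𝒯 T.1 T.2) (h𝒯 T'.1 T'.2) fun h => hTT' (Subtype.ext h)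

namespace GoodMesh

variable {d : ℕ} {𝒦 : Geometry.SimplicialComplex ℝ (E d)} {h r : ℝ}

lemma subset_closedBall (H : GoodMesh 𝒦 h r) {T : Set (E d)}
    (hT : T ∈ elements 𝒦) {x : E d} (hx : x ∈ T) : T ⊆ Metric.closedBall x h := fun _ hy =>
  (Metric.dist_le_diam_of_mem (isBounded_of_mem_elements hT) hy hx).trans (H.diam_le T hT)

/-- The number of elements inside a ball. -/
lemma card_le (H : GoodMesh 𝒦 h r) {𝒯 : Finset (Set (E d))} (h𝒯 : ∀ T ∈ 𝒯, T ∈ elements 𝒦)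
    {x : E d} {R : ℝ} (hR : 0 ≤ R) (hsub : ∀ T ∈ 𝒯, T ⊆ Metric.closedBall x R) :
    (𝒯.card : ℝ) ≤ (R / r) ^ d := by
  have hr := H.r_pos
  have h1 : ∑ T ∈ 𝒯, volume T = volume (⋃ T ∈ 𝒯, T) := by
    refine (measure_biUnion_finset₀ (fun T hT T' hT' hne => ?_) fun T hT =>
      (isCompact_of_mem_elements (h𝒯 T hT)).measurableSet.nullMeasurableSet).symm
    exact volume_inter_elements_eq_zero (h𝒯 T hT) (h𝒯 T' hT') hne
  have h2 : volume (⋃ T ∈ 𝒯, T) ≤ volume (Metric.closedBall x R) :=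
    measure_mono (Set.iUnion₂_subset hsub)
  have h3 : ∀ T ∈ 𝒯, volume (Metric.closedBall (0 : E d) r) ≤ volume T := by
    intro T hT
    obtain ⟨m, hm⟩ := H.inball T (h𝒯 T hT)
    rw [← Measure.addHaar_closedBall_center volume m]
    exact measure_mono hm
  have h4 : (𝒯.card : ENNReal) * volume (Metric.closedBall (0 : E d) r) ≤
      volume (Metric.closedBall x R) := by
    rw [← nsmul_eq_mul]
    exact (Finset.card_nsmul_le_sum _ _ _ h3).trans (h1.le.trans h2)
  rw [Measure.addHaar_closedBall volume _ hr.le, Measure.addHaar_closedBall volume _ hR,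
    ← mul_assoc, ENNReal.mul_le_mul_iff_left (Metric.measure_ball_pos _ _ one_pos).ne'
      measure_ball_lt_top.ne, finrank_euclideanSpace_fin, ← ENNReal.ofReal_natCast,
    ← ENNReal.ofReal_mul (by positivity), ENNReal.ofReal_le_ofReal_iff (by positivity)] at h4
  rw [div_pow, le_div_iff₀ (by positivity)]
  exact h4

end GoodMesh

/-- The Cauchy–Schwarz inequality with the constant function. -/
lemma sq_setIntegral_Icc_le {a b : ℝ} (hab : a < b) {g : ℝ → ℝ}
    (hg : IntegrableOn g (Set.Icc a b)) (hg2 : IntegrableOn (fun s => g s ^ 2) (Set.Icc a b)) :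
    (∫ s in Set.Icc a b, g s) ^ 2 ≤ (b - a) * ∫ s in Set.Icc a b, g s ^ 2 := by
  set A := ∫ s in Set.Icc a b, g s with hA
  -- `c` is the mean of `g`; the claim is nonnegativity of the variance.
  set c := A / (b - a) with hc
  have hba : 0 < b - a := sub_pos.2 hab
  have h1 : 0 ≤ ∫ s in Set.Icc a b, (g s - c) ^ 2 := integral_nonneg fun _ => sq_nonneg _
  have h2 : ∫ s in Set.Icc a b, (g s - c) ^ 2 =
      (∫ s in Set.Icc a b, g s ^ 2) - 2 * c * A + c ^ 2 * (b - a) := by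
    have h3 : ∀ s, (g s - c) ^ 2 = (g s ^ 2 - 2 * c * g s) + c ^ 2 := fun s => by ring
    have hconst : IntegrableOn (fun _ : ℝ => c ^ 2) (Set.Icc a b) :=
      integrableOn_const (by simp)
    simp only [h3]
    have h5 : IntegrableOn (fun s => 2 * c * g s) (Set.Icc a b) := hg.const_mul _
    have h6 : IntegrableOn (fun s => g s ^ 2 - 2 * c * g s) (Set.Icc a b) := hg2.sub h5
    rw [integral_add h6 hconst, integral_sub hg2 h5,
      integral_const_mul, setIntegral_const, smul_eq_mul, ← hA]
    simp [hab.le, mul_comm]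
  have h4 : c * (b - a) = A := by rw [hc]; field_simp
  rw [h2] at h1
  nlinarith

/-! ### Integration along columns -/

section

variable {n : ℕ} {𝒦 : Geometry.SimplicialComplex ℝ (E (n + 1))} {Γ : Set (E (n + 1))}
  {h r η : ℝ} {x₀ N : E (n + 1)} {f : E (n + 1) → ℝ}

/-- The increment of a piecewise polynomial along a line inside the union of the cut elements. -/
lemma LocalCut.sq_norm_sub_le (H : LocalCut 𝒦 Γ h r η x₀ N f) (hh : 0 < h) {m : ℕ}
    {μ : E (n + 1) → E (n + 1)} {P : Set (E (n + 1)) → E (n + 1) → E (n + 1)}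
    (hP : ∀ K ∈ cutElements 𝒦 Γ, IsPolyMap m (P K) ∧ Set.EqOn μ (P K) K)
    (hμ : ContinuousOn μ (⋃₀ cutElements 𝒦 Γ)) {J : Finset (Set (E (n + 1)))}
    (hJ : ∀ K, K ∈ J ↔ K ∈ cutElements 𝒦 Γ ∧ K ⊆ Metric.closedBall x₀ (3 * h))
    {y : E (n + 1)} (hy : y ∈ Metric.closedBall x₀ h) {a b : ℝ} (hab : a ≤ b) (ha : -h ≤ a)
    (hb : b ≤ h) (hseg : ∀ τ ∈ Set.Icc a b, y + τ • N ∈ ⋃₀ cutElements 𝒦 Γ) :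
    ENNReal.ofReal (‖μ (y + b • N) - μ (y + a • N)‖ ^ 2) ≤ ENNReal.ofReal (2 * h * J.card) *
      ∑ K ∈ J, ∫⁻ τ in Set.Icc (-h) h,
        K.indicator (fun x => ENNReal.ofReal (‖fderiv ℝ (P K) x N‖ ^ 2)) (y + τ • N) := by
  classical
  let ℓ : ℝ → E (n + 1) := fun τ => y + τ • N
  have hℓc : Continuous ℓ := by fun_prop
  have hJe : ∀ K ∈ J, K ∈ elements 𝒦 := fun K hK => ((hJ K).1 hK).1.1
  have hPJ : ∀ K ∈ J, IsPolyMap m (P K) ∧ Set.EqOn μ (P K) K := fun K hK => hP K ((hJ K).1 hK).1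
  have hℓ' : ∀ τ, HasDerivAt ℓ N τ := fun τ => by
    have := ((hasDerivAt_id τ).smul_const N).const_add y
    rw [one_smul] at this
    exact this
  have hder : ∀ K ∈ J, ∀ τ, HasDerivAt (fun τ => P K (ℓ τ)) (fderiv ℝ (P K) (ℓ τ) N) τ :=
    fun K hK τ => (((hPJ K hK).1.contDiff.differentiable (by simp))
      (ℓ τ)).hasFDerivAt.comp_hasDerivAt τ (hℓ' τ)
  -- At each parameter the speed of `μ` is bounded by the directional derivative of one polynomial
  -- piece, hence by the sum over all `K ∈ J` of these derivatives cut off to `K`.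
  let g : Set (E (n + 1)) → ℝ → ℝ := fun K τ =>
    (ℓ ⁻¹' K).indicator (fun τ => ‖fderiv ℝ (P K) (ℓ τ) N‖) τ
  have hg0 : ∀ K τ, 0 ≤ g K τ := fun K τ => Set.indicator_nonneg (fun _ _ => norm_nonneg _) τ
  have hcont : ∀ K ∈ J, Continuous fun τ => ‖fderiv ℝ (P K) (ℓ τ) N‖ := by
    intro K hK
    have := (hPJ K hK).1.contDiff.continuous_fderiv (by simp)
    exact (((this.comp hℓc).clm_apply continuous_const)).norm
  have hmeasK : ∀ K ∈ J, MeasurableSet (ℓ ⁻¹' K) := fun K hK =>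
    ((isCompact_of_mem_elements (hJe K hK)).isClosed.preimage hℓc).measurableSet
  have hgi : ∀ K ∈ J, IntegrableOn (g K) (Set.Icc (-h) h) := fun K hK =>
    ((hcont K hK).integrableOn_Icc).indicator (hmeasK K hK)
  have hg2 : ∀ K τ, g K τ ^ 2 = (ℓ ⁻¹' K).indicator (fun τ => ‖fderiv ℝ (P K) (ℓ τ) N‖ ^ 2) τ := by
    intro K τ
    simp only [g]
    by_cases hτ : τ ∈ ℓ ⁻¹' K <;> simp [hτ]
  have hg2i : ∀ K ∈ J, IntegrableOn (fun τ => g K τ ^ 2) (Set.Icc (-h) h) := fun K hK => by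
    simp only [hg2]
    exact (((hcont K hK).pow 2).integrableOn_Icc).indicator (hmeasK K hK)
  let G : ℝ → ℝ := fun τ => ∑ K ∈ J, g K τ
  have hGi : IntegrableOn G (Set.Icc (-h) h) := integrable_finsetSum _ hgi
  have hG2 : ∀ τ, G τ ^ 2 ≤ J.card * ∑ K ∈ J, g K τ ^ 2 := fun τ => sq_sum_le_card_mul_sum_sq
  have hsumi : IntegrableOn (fun τ => J.card * ∑ K ∈ J, g K τ ^ 2) (Set.Icc (-h) h) :=
    (integrable_finsetSum _ hg2i).const_mul _
  have hG2i : IntegrableOn (fun τ => G τ ^ 2) (Set.Icc (-h) h) := by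
    refine Integrable.mono' hsumi (hGi.aestronglyMeasurable.pow 2) (Filter.Eventually.of_forall ?_)
    intro τ
    rw [Real.norm_of_nonneg (sq_nonneg _)]
    exact hG2 τ
  have hsub : Set.Icc a b ⊆ Set.Icc (-h) h := Set.Icc_subset_Icc ha hb
  have h1 : ‖μ (ℓ b) - μ (ℓ a)‖ ≤ ∫ τ in a..b, G τ := by
    refine norm_sub_le_integral_of_piecewise (J := {K // K ∈ J}) (f := fun τ => μ (ℓ τ)) hab
      (I := fun K => ℓ ⁻¹' K.1) (P := fun K τ => P K.1 (ℓ τ))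
      (fun K => (isCompact_of_mem_elements (hJe K.1 K.2)).isClosed.preimage hℓc)
      (fun K => ?_) (fun K τ => (hder K.1 K.2 τ).differentiableAt) (fun τ hτ => ?_)
      (hμ.comp hℓc.continuousOn hseg) (fun K τ _ hK => (hPJ K.1 K.2).2 hK) ?_ (fun K τ _ hK => ?_)
    · have : ℓ = AffineMap.lineMap y (y + N) := by
        funext τ
        simp [ℓ, AffineMap.lineMap_apply, add_comm]
      rw [this]
      exact (convex_of_mem_elements (hJe K.1 K.2)).affine_preimage _
    · obtain ⟨K, hK, hx⟩ := hseg τ hτ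
      -- The radius `3 h` adds the distance from `x₀` to `y`, the length of the column and the
      -- diameter of the element.
      refine ⟨⟨K, (hJ K).2 ⟨hK, fun z hz => ?_⟩⟩, hx⟩
      have h2 : dist z (y + τ • N) ≤ h := (Metric.dist_le_diam_of_mem
        (isBounded_of_mem_elements hK.1) hz hx).trans (H.diam_le K hK.1)
      have h3 : dist (y + τ • N) y ≤ h := by
        rw [dist_eq_norm, add_sub_cancel_left, norm_smul, H.norm_eq, mul_one]
        exact abs_le.2 (hsub hτ)
      have h4 := dist_triangle4 z (y + τ • N) y x₀
      rw [Metric.mem_closedBall] at hy ⊢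
      linarith
    · rw [intervalIntegrable_iff_integrableOn_Icc_of_le hab]
      exact hGi.mono_set hsub
    · rw [(hder K.1 K.2 τ).deriv]
      have h2 : ‖fderiv ℝ (P K.1) (ℓ τ) N‖ = g K.1 τ := by
        simp only [g]
        rw [Set.indicator_of_mem hK]
      rw [h2]
      exact Finset.single_le_sum (f := fun K => g K τ) (fun K _ => hg0 K τ) K.2
  have h2 : ∫ τ in a..b, G τ ≤ ∫ τ in Set.Icc (-h) h, G τ := by
    rw [intervalIntegral.integral_of_le hab, ← integral_Icc_eq_integral_Ioc]
    exact setIntegral_mono_set hGi (Filter.Eventually.of_forall fun τ =>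
      Finset.sum_nonneg fun K _ => hg0 K τ) hsub.eventuallyLE
  -- Cauchy–Schwarz is used twice: in the parameter, with length `2 h`, and for the sum over `J`.
  have h3 : ‖μ (ℓ b) - μ (ℓ a)‖ ^ 2 ≤
      2 * h * J.card * ∑ K ∈ J, ∫ τ in Set.Icc (-h) h, g K τ ^ 2 := by
    calc _ ≤ (∫ τ in Set.Icc (-h) h, G τ) ^ 2 :=
          pow_le_pow_left₀ (norm_nonneg _) (h1.trans h2) 2
      _ ≤ (h - -h) * ∫ τ in Set.Icc (-h) h, G τ ^ 2 :=
          sq_setIntegral_Icc_le (by linarith) hGi hG2i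
      _ ≤ (h - -h) * ∫ τ in Set.Icc (-h) h, J.card * ∑ K ∈ J, g K τ ^ 2 := by
          refine mul_le_mul_of_nonneg_left ?_ (by linarith)
          exact integral_mono hG2i hsumi hG2
      _ = _ := by
          rw [integral_const_mul, integral_finsetSum _ hg2i]
          ring
  refine (ENNReal.ofReal_le_ofReal h3).trans_eq ?_
  rw [ENNReal.ofReal_mul (by positivity), ENNReal.ofReal_sum_of_nonneg fun K _ =>
    integral_nonneg fun _ => sq_nonneg _]
  congr 1
  refine Finset.sum_congr rfl fun K hK => ?_
  rw [ofReal_integral_eq_lintegral_ofReal (hg2i K hK)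
    (Filter.Eventually.of_forall fun _ => sq_nonneg _)]
  refine lintegral_congr fun τ => ?_
  rw [hg2]
  by_cases hτ : ℓ τ ∈ K
  · rw [Set.indicator_of_mem (show τ ∈ ℓ ⁻¹' K from hτ), Set.indicator_of_mem hτ]
  · rw [Set.indicator_of_notMem (show τ ∉ ℓ ⁻¹' K from hτ), Set.indicator_of_notMem hτ,
      ENNReal.ofReal_zero]

/-- Tonelli and translation invariance: each shift by `τ • N` contributes at most the full integral
of `A`. -/
lemma lintegral_translate_le {A : E (n + 1) → ENNReal} (hA : Measurable A) (B : Set (E (n + 1)))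
    (h : ℝ) (N : E (n + 1)) :
    ∫⁻ y in B, ∫⁻ τ in Set.Icc (-h) h, A (y + τ • N) ≤ ENNReal.ofReal (2 * h) * ∫⁻ x, A x := by
  have hm : Measurable (Function.uncurry fun (y : E (n + 1)) (τ : ℝ) => A (y + τ • N)) := by
    refine hA.comp ?_
    fun_prop
  rw [lintegral_lintegral_swap hm.aemeasurable]
  calc _ ≤ ∫⁻ _ in Set.Icc (-h) h, ∫⁻ x, A x := by
        refine lintegral_mono fun τ => ?_
        refine (setLIntegral_le_lintegral _ _).trans_eq ?_
        exact lintegral_add_right_eq_self A (τ • N)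
    _ = _ := by
        rw [lintegral_const, mul_comm, Measure.restrict_apply MeasurableSet.univ, Set.univ_inter,
          Real.volume_Icc]
        ring_nf

/-- The part of the interface close to `x₀` and inside the cut elements. -/
lemma LocalCut.isCompact_inter (H : LocalCut 𝒦 Γ h r η x₀ N f) (hη : 0 ≤ η) :
    IsCompact (Γ ∩ Metric.closedBall x₀ (3 * h) ∩ ⋃₀ cutElements 𝒦 Γ) := by
  have h1 : Γ ∩ Metric.closedBall x₀ (3 * h) = Metric.closedBall x₀ (3 * h) ∩ f ⁻¹' {0} := by
    ext x
    exact ⟨fun hx => ⟨hx.2, (H.mem_iff x hx.2).1 hx.1⟩, fun hx => ⟨(H.mem_iff x hx.1).2 hx.2, hx.1⟩⟩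
  rw [h1]
  have h2 : IsClosed (Metric.closedBall x₀ (3 * h) ∩ f ⁻¹' {0}) :=
    (H.near.continuousOn H.norm_eq hη).preimage_isClosed_of_isClosed Metric.isClosed_closedBall
      isClosed_singleton
  exact ((isCompact_closedBall x₀ (3 * h)).of_isClosed_subset h2 Set.inter_subset_left).inter_right
    (isClosed_sUnion_of_subset_elements H.finite fun K hK => hK.1)

/-- Two points of Γ on one line in direction `N` would violate near-linearity with `η < 1`: the
rescaled function vanishes at both but has slope close to `1`. -/
lemma LocalCut.injOn (H : LocalCut 𝒦 Γ h r η x₀ N f) (hη : η < 1) {P : E (n + 1) →L[ℝ] E n}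
    (hP : IsFrame N P) : Set.InjOn P (Γ ∩ Metric.closedBall x₀ (3 * h)) := by
  intro x hx y hy hxy
  have h1 := H.near x hx.2 y hy.2
  rw [(H.mem_iff x hx.2).1 hx.1, (H.mem_iff y hy.2).1 hy.1, sub_zero, zero_sub, abs_neg,
    dist_eq_norm] at h1
  have h2 := hP.norm_sq (x - y)
  rw [map_sub, hxy, sub_self, norm_zero] at h2
  have h3 : |(inner ℝ N (x - y) : ℝ)| = ‖x - y‖ := by
    rw [← sq_eq_sq₀ (abs_nonneg _) (norm_nonneg _), sq_abs, h2]
    ring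
  rw [h3] at h1
  have h4 : ‖x - y‖ = 0 := by nlinarith [norm_nonneg (x - y)]
  exact sub_eq_zero.1 (norm_eq_zero.1 h4)

/-- The `L²` norm over a ball with columns, in terms of the interface and of derivatives in the
direction of the columns. -/
lemma LocalCut.lintegral_ball_le (H : LocalCut 𝒦 Γ h r η x₀ N f) (hη : 0 ≤ η) (hη1 : η < 1)
    {m : ℕ} {μ : E (n + 1) → E (n + 1)} {P : Set (E (n + 1)) → E (n + 1) → E (n + 1)}
    (hP : ∀ K ∈ cutElements 𝒦 Γ, IsPolyMap m (P K) ∧ Set.EqOn μ (P K) K)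
    (hμ : ContinuousOn μ (⋃₀ cutElements 𝒦 Γ)) {J : Finset (Set (E (n + 1)))}
    (hJ : ∀ K, K ∈ J ↔ K ∈ cutElements 𝒦 Γ ∧ K ⊆ Metric.closedBall x₀ (3 * h))
    {T : Set (E (n + 1))} (hT : T ∈ elements 𝒦) (hx₀ : x₀ ∈ T) {y₀ : E (n + 1)} {ν : ℝ}
    (hy₀ : Metric.closedBall y₀ ν ⊆ T)
    (hcol : ∀ y ∈ Metric.closedBall y₀ ν, ∃ s : ℝ, |s| ≤ h ∧
      f (y + s • N) = 0 ∧ segment ℝ y (y + s • N) ⊆ ⋃₀ cutElements 𝒦 Γ) :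
    ∫⁻ y in Metric.closedBall y₀ ν, ENNReal.ofReal (‖μ y‖ ^ 2) ≤
      ENNReal.ofReal (4 * h) * ∫⁻ x in Γ ∩ Metric.closedBall x₀ (3 * h) ∩ ⋃₀ cutElements 𝒦 Γ,
        ENNReal.ofReal (‖μ x‖ ^ 2) ∂(μHE[n] : Measure (E (n + 1))) +
      ENNReal.ofReal (8 * h ^ 2 * J.card) *
        ∑ K ∈ J, ∫⁻ x in K, ENNReal.ofReal (‖fderiv ℝ (P K) x N‖ ^ 2) := by
  have hh : 0 < h := by linarith [H.r_pos, H.two_mul_r_le hT]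
  have hTh : T ⊆ Metric.closedBall x₀ h := fun z hz => (Metric.dist_le_diam_of_mem
    (isBounded_of_mem_elements hT) hz hx₀).trans (H.diam_le T hT)
  set B := Metric.closedBall y₀ ν with hB
  have hBm : MeasurableSet B := Metric.isClosed_closedBall.measurableSet
  have hcol' : ∀ y, ∃ s : ℝ, y ∈ B → |s| ≤ h ∧ f (y + s • N) = 0 ∧
      segment ℝ y (y + s • N) ⊆ ⋃₀ cutElements 𝒦 Γ := by
    intro y
    by_cases hy : y ∈ B
    · obtain ⟨s, hs⟩ := hcol y hy
      exact ⟨s, fun _ => hs⟩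
    · exact ⟨0, fun h => (hy h).elim⟩
  choose s hs using hcol'
  let π : E (n + 1) → E (n + 1) := fun y => y + s y • N
  let A : Set (E (n + 1)) → E (n + 1) → ENNReal := fun K =>
    K.indicator (fun x => ENNReal.ofReal (‖fderiv ℝ (P K) x N‖ ^ 2))
  have hKm : ∀ K ∈ J, MeasurableSet K := fun K hK =>
    (isCompact_of_mem_elements ((hJ K).1 hK).1.1).measurableSet
  have hA : ∀ K ∈ J, Measurable (A K) := by
    intro K hK
    refine Measurable.indicator ?_ (hKm K hK)
    have h1 := (hP K ((hJ K).1 hK).1).1.contDiff.continuous_fderiv (by simp)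
    exact (((h1.clm_apply continuous_const).norm.pow 2).measurable).ennreal_ofReal
  -- Split `μ y` into its value at the foot `π y` on Γ and the increment along the column; the
  -- column may go up or down, hence two cases.
  have hpt : ∀ y ∈ B, ENNReal.ofReal (‖μ y‖ ^ 2) ≤ 2 * ENNReal.ofReal (‖μ (π y)‖ ^ 2) +
      2 * (ENNReal.ofReal (2 * h * J.card) *
        ∑ K ∈ J, ∫⁻ τ in Set.Icc (-h) h, A K (y + τ • N)) := by
    intro y hy
    obtain ⟨hs1, hs2, hs3⟩ := hs y hy
    have hyh : y ∈ Metric.closedBall x₀ h := hTh (hy₀ hy)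
    have hs1' := abs_le.1 hs1
    have h1 : ENNReal.ofReal (‖μ (π y) - μ y‖ ^ 2) ≤ ENNReal.ofReal (2 * h * J.card) *
        ∑ K ∈ J, ∫⁻ τ in Set.Icc (-h) h, A K (y + τ • N) := by
      have hmem : ∀ θ ∈ Set.Icc (0 : ℝ) 1, y + (θ * s y) • N ∈ ⋃₀ cutElements 𝒦 Γ := by
        intro θ hθ
        refine hs3 ?_
        rw [segment_eq_image']
        refine ⟨θ, hθ, ?_⟩
        module
      rcases le_total 0 (s y) with h0 | h0
      · have := H.sq_norm_sub_le hh hP hμ hJ hyh h0 (by linarith) hs1'.2 (fun τ hτ => by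
          rcases h0.eq_or_lt with h00 | h00
          · have : τ = 0 * s y := by linarith [hτ.1, hτ.2]
            rw [this]
            exact hmem 0 ⟨le_rfl, zero_le_one⟩
          · have := hmem (τ / s y) ⟨div_nonneg hτ.1 h0, (div_le_one h00).2 hτ.2⟩
            rwa [div_mul_cancel₀ _ h00.ne'] at this)
        rw [zero_smul, add_zero] at this
        exact this
      · have := H.sq_norm_sub_le hh hP hμ hJ hyh h0 hs1'.1 (by linarith) (fun τ hτ => by
          rcases h0.eq_or_lt with h00 | h00
          · have : τ = 0 * s y := by linarith [hτ.1, hτ.2]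
            rw [this]
            exact hmem 0 ⟨le_rfl, zero_le_one⟩
          · have := hmem (τ / s y) ⟨div_nonneg_of_nonpos hτ.2 h0, (div_le_one_of_neg h00).2 hτ.1⟩
            rwa [div_mul_cancel₀ _ h00.ne] at this)
        rw [zero_smul, add_zero, norm_sub_rev] at this
        exact this
    have h2 : ‖μ y‖ ^ 2 ≤ 2 * ‖μ (π y)‖ ^ 2 + 2 * ‖μ (π y) - μ y‖ ^ 2 := by
      have h3 : ‖μ y‖ ≤ ‖μ (π y)‖ + ‖μ (π y) - μ y‖ := by
        have := norm_sub_le (μ (π y)) (μ (π y) - μ y)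
        rwa [sub_sub_cancel] at this
      nlinarith [norm_nonneg (μ y), sq_nonneg (‖μ (π y)‖ - ‖μ (π y) - μ y‖)]
    refine (ENNReal.ofReal_le_ofReal h2).trans ?_
    rw [ENNReal.ofReal_add (by positivity) (by positivity), ENNReal.ofReal_mul zero_le_two,
      ENNReal.ofReal_mul zero_le_two, ENNReal.ofReal_ofNat]
    gcongr
  obtain ⟨Q, hQ⟩ := exists_isFrame H.norm_eq
  have hslab := hQ.lintegral_slab_le H.norm_eq (H.isCompact_inter hη)
    ((H.injOn hη1 hQ).mono Set.inter_subset_left) (F := fun x => ENNReal.ofReal (‖μ x‖ ^ 2))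
    (ENNReal.continuous_ofReal.comp_continuousOn ((hμ.mono Set.inter_subset_right).norm.pow 2))
    hBm (π := π) (L := h) (fun y hy => by
      obtain ⟨hs1, hs2, hs3⟩ := hs y hy
      have h1 : π y ∈ Metric.closedBall x₀ (3 * h) := by
        have h2 : dist y x₀ ≤ h := hTh (hy₀ hy)
        have h3 : dist (π y) y ≤ h := by
          simp only [π]
          rwa [dist_eq_norm, add_sub_cancel_left, norm_smul, H.norm_eq, mul_one]
        have h4 := dist_triangle (π y) y x₀
        rw [Metric.mem_closedBall]
        linarith
      exact ⟨⟨⟨(H.mem_iff _ h1).2 hs2, h1⟩, hs3 (right_mem_segment ℝ _ _)⟩, s y, hs1, rfl⟩)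
  have hmeasI : ∀ K ∈ J, Measurable fun y => ∫⁻ τ in Set.Icc (-h) h, A K (y + τ • N) := by
    intro K hK
    refine Measurable.lintegral_prod_right' (f := fun p : E (n + 1) × ℝ => A K (p.1 + p.2 • N)) ?_
    refine (hA K hK).comp ?_
    fun_prop
  calc ∫⁻ y in B, ENNReal.ofReal (‖μ y‖ ^ 2)
      ≤ ∫⁻ y in B, (2 * ENNReal.ofReal (‖μ (π y)‖ ^ 2) +
          2 * (ENNReal.ofReal (2 * h * J.card) *
            ∑ K ∈ J, ∫⁻ τ in Set.Icc (-h) h, A K (y + τ • N))) := setLIntegral_mono' hBm hpt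
    _ = 2 * (∫⁻ y in B, ENNReal.ofReal (‖μ (π y)‖ ^ 2)) +
          2 * (ENNReal.ofReal (2 * h * J.card) *
            ∑ K ∈ J, ∫⁻ y in B, ∫⁻ τ in Set.Icc (-h) h, A K (y + τ • N)) := by
        have h1 : Measurable fun y => ∑ K ∈ J, ∫⁻ τ in Set.Icc (-h) h, A K (y + τ • N) :=
          Finset.measurable_fun_sum _ hmeasI
        rw [lintegral_add_right _ ((h1.const_mul _).const_mul _), lintegral_const_mul' _ _ (by simp),
          lintegral_const_mul' _ _ (by simp), lintegral_const_mul' _ _ (by simp),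
          lintegral_finsetSum _ hmeasI]
    _ ≤ 2 * (ENNReal.ofReal (2 * h) *
          ∫⁻ x in Γ ∩ Metric.closedBall x₀ (3 * h) ∩ ⋃₀ cutElements 𝒦 Γ,
            ENNReal.ofReal (‖μ x‖ ^ 2) ∂(μHE[n] : Measure (E (n + 1)))) +
          2 * (ENNReal.ofReal (2 * h * J.card) *
            ∑ K ∈ J, (ENNReal.ofReal (2 * h) *
              ∫⁻ x in K, ENNReal.ofReal (‖fderiv ℝ (P K) x N‖ ^ 2))) := by
        gcongr with K hK
        refine (lintegral_translate_le (hA K hK) _ _ _).trans_eq ?_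
        congr 1
        exact lintegral_indicator (hKm K hK) _
    _ = _ := by
        rw [← Finset.mul_sum, ← mul_assoc, ← mul_assoc, ← mul_assoc]
        have h2 : ∀ a : ℝ, 2 * ENNReal.ofReal a = ENNReal.ofReal (2 * a) := fun a => by
          rw [ENNReal.ofReal_mul zero_le_two, ENNReal.ofReal_ofNat]
        rw [h2, h2, ← ENNReal.ofReal_mul (by positivity)]
        congr 3 <;> ring_nf

end

/-! ### Local geometry of a level set function -/

lemma norm_gradient_sub {d : ℕ} (φ : E d → ℝ) (x y : E d) :
    ‖gradient φ x - gradient φ y‖ = ‖fderiv ℝ φ x - fderiv ℝ φ y‖ := by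
  rw [gradient, gradient, ← map_sub, LinearIsometryEquiv.norm_map]

lemma norm_normalize_sub_le {V : Type*} [NormedAddCommGroup V] [NormedSpace ℝ V] {v N : V}
    (hN : ‖N‖ = 1) (hv : v ≠ 0) : ‖‖v‖⁻¹ • v - N‖ ≤ 2 * ‖v - N‖ := by
  have hv' : 0 < ‖v‖ := norm_pos_iff.2 hv
  have h1 : ‖‖v‖⁻¹ • v - v‖ ≤ ‖v - N‖ := by
    have h2 : ‖v‖⁻¹ • v - v = (‖v‖⁻¹ - 1) • v := by module
    rw [h2, norm_smul]
    have h3 : ‖‖v‖⁻¹ - 1‖ * ‖v‖ = |1 - ‖v‖| := by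
      rw [Real.norm_eq_abs, ← abs_of_pos hv', ← abs_mul, abs_of_pos hv', sub_mul,
        inv_mul_cancel₀ hv'.ne', one_mul]
    rw [h3, ← hN, abs_sub_comm]
    exact abs_norm_sub_norm_le v N
  have h4 := norm_add_le (‖v‖⁻¹ • v - v) (v - N)
  rw [sub_add_sub_cancel] at h4
  linarith

namespace IsLevelSet

variable {d : ℕ} {bg : Set (E d)} {c M ρ : ℝ} {φ : E d → ℝ}

lemma contDiffAt (H : IsLevelSet bg c M ρ φ) (hbg : IsOpen bg) {x : E d} (hx : x ∈ bg) :
    ContDiffAt ℝ ∞ φ x := (H.smooth x hx).contDiffAt (hbg.mem_nhds hx)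

/-- Mean value inequality with the bound on the second derivative. `|M| + 1` replaces `M` so that
later quotients have a positive constant. -/
lemma norm_gradient_sub_le (H : IsLevelSet bg c M ρ φ) (hbg : IsOpen bg) {x₀ : E d}
    (hx₀ : x₀ ∈ interface bg φ) {x : E d} (hx : x ∈ Metric.ball x₀ ρ) :
    ‖gradient φ x - gradient φ x₀‖ ≤ (|M| + 1) * dist x x₀ := by
  have hρ : 0 < ρ := dist_nonneg.trans_lt hx
  rw [norm_gradient_sub, dist_eq_norm]
  refine (convex_ball x₀ ρ).norm_image_sub_le_of_norm_fderiv_le (𝕜 := ℝ) (fun y hy => ?_)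
    (fun y hy => ?_) (Metric.mem_ball_self hρ) hx
  · have h1 := H.contDiffAt hbg (H.clearance x₀ hx₀ hy)
    have h2 : ContDiffAt ℝ 1 (fderiv ℝ φ) y := h1.fderiv_right (by norm_cast)
    exact h2.differentiableAt (by simp)
  · have h1 := H.curvature x₀ hx₀ y hy
    rw [← norm_iteratedFDeriv_fderiv, norm_iteratedFDeriv_one] at h1
    exact h1.trans ((le_abs_self M).trans (by linarith))

/-- Near a point of the interface the rescaled level set function is nearly linear. -/
lemma nearLinear (H : IsLevelSet bg c M ρ φ) (hbg : IsOpen bg) (hc : 0 < c) {x₀ : E d}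
    (hx₀ : x₀ ∈ interface bg φ) {R : ℝ} (hR : R < ρ) :
    NearLinear (fun x => ‖gradient φ x₀‖⁻¹ * φ x) (‖gradient φ x₀‖⁻¹ • gradient φ x₀)
      ((|M| + 1) / c * R) (Metric.closedBall x₀ R) := by
  intro x hx y hy
  set c₁ := ‖gradient φ x₀‖ with hc₁
  have hcc₁ : c ≤ c₁ := H.regular x₀ hx₀
  have hc₁pos : 0 < c₁ := hc.trans_le hcc₁
  -- Subtracting the linear part leaves a function whose derivative is the rescaled oscillation of
  -- `∇φ`, small on the ball.
  let g : E d → ℝ := fun x => c₁⁻¹ * φ x - inner ℝ (c₁⁻¹ • gradient φ x₀) x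
  have hsub : Metric.closedBall x₀ R ⊆ Metric.ball x₀ ρ := Metric.closedBall_subset_ball hR
  have hd : ∀ z ∈ Metric.closedBall x₀ R,
      HasFDerivAt g (c₁⁻¹ • (fderiv ℝ φ z - fderiv ℝ φ x₀)) z := by
    intro z hz
    have h1 : HasFDerivAt φ (fderiv ℝ φ z) z :=
      ((H.contDiffAt hbg (H.clearance x₀ hx₀ (hsub hz))).differentiableAt (by simp)).hasFDerivAt
    have h2 := (h1.const_mul c₁⁻¹).sub
      ((innerSL ℝ (c₁⁻¹ • gradient φ x₀)).hasFDerivAt (x := z))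
    refine h2.congr_fderiv ?_
    ext v
    simp [gradient, mul_sub]
  have h1 := (convex_closedBall x₀ R).norm_image_sub_le_of_norm_hasFDerivWithin_le
    (C := (|M| + 1) / c * R) (fun z hz => (hd z hz).hasFDerivWithinAt) (fun z hz => ?_) hy hx
  · rw [Real.norm_eq_abs, ← dist_eq_norm] at h1
    convert h1 using 2
    simp only [g, inner_sub_right]
    ring
  · rw [norm_smul, norm_inv, Real.norm_of_nonneg hc₁pos.le, ← norm_gradient_sub]
    have h2 := H.norm_gradient_sub_le hbg hx₀ (hsub hz)
    have h3 : dist z x₀ ≤ R := hz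
    have h4 : 0 ≤ dist z x₀ := dist_nonneg
    calc c₁⁻¹ * ‖gradient φ z - gradient φ x₀‖ ≤ c⁻¹ * ((|M| + 1) * R) := by
          gcongr
          exact h2.trans (by gcongr)
      _ = _ := by ring

/-- The sum appears because `normal` points along `-∇φ`, whereas the frozen direction points along
`+∇φ` at `x₀`. -/
lemma norm_normal_add_le (H : IsLevelSet bg c M ρ φ) (hbg : IsOpen bg) (hc : 0 < c) {x₀ : E d}
    (hx₀ : x₀ ∈ interface bg φ) {R : ℝ} (hR : R < ρ) (hη : (|M| + 1) / c * R < 1) {x : E d}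
    (hx : x ∈ Metric.closedBall x₀ R) :
    gradient φ x ≠ 0 ∧
      ‖normal φ x + ‖gradient φ x₀‖⁻¹ • gradient φ x₀‖ ≤ 2 * ((|M| + 1) / c * R) := by
  set c₁ := ‖gradient φ x₀‖ with hc₁
  have hcc₁ : c ≤ c₁ := H.regular x₀ hx₀
  have hc₁pos : 0 < c₁ := hc.trans_le hcc₁
  have h2 := H.norm_gradient_sub_le hbg hx₀ (Metric.closedBall_subset_ball hR hx)
  have hx' : dist x x₀ ≤ R := hx
  have hN : ‖c₁⁻¹ • gradient φ x₀‖ = 1 := by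
    rw [norm_smul, norm_inv, Real.norm_of_nonneg hc₁pos.le, ← hc₁, inv_mul_cancel₀ hc₁pos.ne']
  have hv : ‖c₁⁻¹ • gradient φ x - c₁⁻¹ • gradient φ x₀‖ ≤ (|M| + 1) / c * R := by
    rw [← smul_sub, norm_smul, norm_inv, Real.norm_of_nonneg hc₁pos.le]
    calc _ ≤ c⁻¹ * ((|M| + 1) * R) := by
          gcongr
          exact h2.trans (by gcongr)
      _ = _ := by ring
  have hv0 : c₁⁻¹ • gradient φ x ≠ 0 := by
    intro h0
    rw [h0, zero_sub, norm_neg, hN] at hv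
    linarith
  refine ⟨fun h0 => hv0 (by rw [h0, smul_zero]), ?_⟩
  have h3 := norm_normalize_sub_le hN hv0
  have h4 : normal φ x = -(‖c₁⁻¹ • gradient φ x‖⁻¹ • c₁⁻¹ • gradient φ x) := by
    rw [normal, norm_smul, norm_inv, Real.norm_of_nonneg hc₁pos.le, smul_smul, mul_inv, inv_inv,
      mul_comm c₁, mul_assoc, mul_inv_cancel₀ hc₁pos.ne', mul_one]
  rw [h4, neg_add_eq_sub, norm_sub_rev]
  exact h3.trans (by linarith)

/-- A limit point of Γ lies within `ρ` of some point of Γ, so by the clearance it is inside `bg`,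
where continuity of `φ` puts it on Γ. -/
lemma isCompact_interface (H : IsLevelSet bg c M ρ φ) (hbg : IsOpen bg)
    (hb : Bornology.IsBounded bg) (hρ : 0 < ρ) : IsCompact (interface bg φ) := by
  refine Metric.isCompact_of_isClosed_isBounded ?_ (hb.subset fun x hx => hx.1)
  refine isClosed_of_closure_subset fun x hx => ?_
  obtain ⟨x₀, hx₀, hd⟩ := Metric.mem_closure_iff.1 hx ρ hρ
  have hxbg : x ∈ bg := H.clearance x₀ hx₀ hd
  refine ⟨hxbg, ?_⟩
  have hcont : ContinuousAt φ x := (H.contDiffAt hbg hxbg).continuousAt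
  by_contra hne
  have h1 := hcont.preimage_mem_nhds (isOpen_ne.mem_nhds hne)
  obtain ⟨y, hy, hy'⟩ := mem_closure_iff_nhds.1 hx _ h1
  exact hy hy'.2

/-- On balls where the nonlinearity is at most `1 / 2`, the difference of two points of Γ has at
most half its length along `N`, so Γ is locally a Lipschitz graph of finite measure; compactness
does the rest. -/
lemma measure_interface_lt_top {n : ℕ} {bg : Set (E (n + 1))} {φ : E (n + 1) → ℝ}
    (H : IsLevelSet bg c M ρ φ) (hbg : IsOpen bg) (hb : Bornology.IsBounded bg) (hc : 0 < c)
    (hρ : 0 < ρ) : (μHE[n] : Measure (E (n + 1))) (interface bg φ) < ⊤ := by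
  refine (H.isCompact_interface hbg hb hρ).measure_lt_top_of_nhdsWithin fun x₀ hx₀ => ?_
  obtain ⟨R, hR, hRρ, hη⟩ : ∃ R, 0 < R ∧ R < ρ ∧ (|M| + 1) / c * R ≤ 1 / 2 := by
    have hM : 0 < (|M| + 1) / c := by positivity
    refine ⟨min (ρ / 2) (1 / 2 / ((|M| + 1) / c)), by positivity,
      (min_le_left _ _).trans_lt (by linarith), ?_⟩
    rw [mul_comm, ← le_div_iff₀ hM]
    exact min_le_right _ _
  have hN : ‖‖gradient φ x₀‖⁻¹ • gradient φ x₀‖ = 1 := by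
    have h1 : 0 < ‖gradient φ x₀‖ := hc.trans_le (H.regular x₀ hx₀)
    rw [norm_smul, norm_inv, norm_norm, inv_mul_cancel₀ h1.ne']
  obtain ⟨P, hP⟩ := exists_isFrame hN
  have hnl := H.nearLinear hbg hc hx₀ hRρ
  refine ⟨interface bg φ ∩ Metric.closedBall x₀ R, ?_, ?_⟩
  · exact Filter.inter_mem self_mem_nhdsWithin
      (mem_nhdsWithin_of_mem_nhds (Metric.closedBall_mem_nhds x₀ hR))
  · refine hP.measure_lt_top (Metric.isBounded_closedBall.subset Set.inter_subset_right) (C := 2) ?_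
    intro x hx y hy
    have h1 := hnl x hx.2 y hy.2
    dsimp only at h1
    rw [hx.1.2, hy.1.2, mul_zero, sub_zero, zero_sub, abs_neg] at h1
    have h2 := hP.norm_sq (x - y)
    rw [map_sub, ← dist_eq_norm, ← dist_eq_norm] at h2
    have h3 : |inner ℝ (‖gradient φ x₀‖⁻¹ • gradient φ x₀) (x - y)| ≤ 1 / 2 * dist x y :=
      h1.trans (by gcongr)
    have h4 := pow_le_pow_left₀ (abs_nonneg _) h3 2
    rw [sq_abs] at h4
    have h5 : dist x y ^ 2 ≤ (2 * dist (P x) (P y)) ^ 2 := by nlinarith [sq_nonneg (dist x y)]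
    exact (sq_le_sq₀ dist_nonneg (by positivity)).1 h5

lemma localCut {n : ℕ} {bg : Set (E (n + 1))} {φ : E (n + 1) → ℝ} {σ q h : ℝ}
    {𝒦 : Geometry.SimplicialComplex ℝ (E (n + 1))} (H : IsLevelSet bg c M ρ φ)
    (hmesh : IsMesh bg σ q h 𝒦) (hbg : IsOpen bg) (hσ : 0 < σ) (hq : 0 < q) (hc : 0 < c)
    (hh : 0 < h) (hhρ : 3 * h < ρ) {x₀ : E (n + 1)} (hx₀ : x₀ ∈ interface bg φ) :
    LocalCut 𝒦 (interface bg φ) h (σ * q * h) ((|M| + 1) / c * (3 * h)) x₀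
      (‖gradient φ x₀‖⁻¹ • gradient φ x₀) (fun x => ‖gradient φ x₀‖⁻¹ * φ x) := by
  have hg := hmesh.goodMesh hσ hq hh
  have h1 : 0 < ‖gradient φ x₀‖ := hc.trans_le (H.regular x₀ hx₀)
  have hball : Metric.closedBall x₀ (3 * h) ⊆ bg :=
    (Metric.closedBall_subset_ball hhρ).trans (H.clearance x₀ hx₀)
  exact
    { finite := hg.finite
      r_pos := hg.r_pos
      inball := hg.inball
      diam_le := hg.diam_le
      norm_eq := by rw [norm_smul, norm_inv, norm_norm, inv_mul_cancel₀ h1.ne']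
      near := H.nearLinear hbg hc hx₀ hhρ
      covered := by
        rw [hmesh.covers]
        exact hball.trans subset_closure
      mem_iff := fun x hx => by
        rw [mul_eq_zero, or_iff_right (inv_ne_zero h1.ne')]
        exact ⟨fun h => h.2, fun h => ⟨hball hx, h⟩⟩ }

end IsLevelSet

/-- The part of the interface outside the interface elements is a null set. -/
lemma measure_interface_diff {n : ℕ} {bg : Set (E (n + 1))} {φ : E (n + 1) → ℝ}
    {𝒦 : Geometry.SimplicialComplex ℝ (E (n + 1))} (hf : 𝒦.faces.Finite)
    (hcov : ⋃₀ elements 𝒦 = closure bg) :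
    (μHE[n] : Measure (E (n + 1))) (interface bg φ \ ⋃₀ interfaceMesh bg φ 𝒦) = 0 := by
  have hsub : interface bg φ \ ⋃₀ interfaceMesh bg φ 𝒦 ⊆
      ⋃ T ∈ elements 𝒦 \ interfaceMesh bg φ 𝒦, T ∩ interface bg φ := by
    rintro x ⟨hx, hxn⟩
    have h1 : x ∈ ⋃₀ elements 𝒦 := by
      rw [hcov]
      exact subset_closure hx.1
    obtain ⟨T, hT, hxT⟩ := h1
    exact Set.mem_iUnion₂.2 ⟨T, ⟨hT, fun h => hxn ⟨T, h, hxT⟩⟩, hxT, hx⟩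
  refine measure_mono_null hsub ?_
  refine (measure_biUnion_null_iff ((finite_elements hf).subset Set.sdiff_subset).countable).2 ?_
  rintro T ⟨hT, hTn⟩
  by_contra hne
  exact hTn ⟨hT, pos_iff_ne_zero.2 hne⟩

/-- Continuous functions on the interface elements are integrable on the interface. -/
lemma integrableOn_interface {n : ℕ} {bg : Set (E (n + 1))} {φ : E (n + 1) → ℝ}
    {𝒦 : Geometry.SimplicialComplex ℝ (E (n + 1))} (hf : 𝒦.faces.Finite)
    (hcov : ⋃₀ elements 𝒦 = closure bg) (hΓ : IsCompact (interface bg φ))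
    (hΓfin : (μHE[n] : Measure (E (n + 1))) (interface bg φ) < ⊤) {V : Type*} [NormedAddCommGroup V]
    {g : E (n + 1) → V} (hg : ContinuousOn g (⋃₀ interfaceMesh bg φ 𝒦)) :
    IntegrableOn g (interface bg φ) (μHE[n] : Measure (E (n + 1))) := by
  have hcl : IsClosed (⋃₀ interfaceMesh bg φ 𝒦) :=
    isClosed_sUnion_of_subset_elements hf fun K hK => hK.1
  have h1 : IntegrableOn g (interface bg φ ∩ ⋃₀ interfaceMesh bg φ 𝒦)
      (μHE[n] : Measure (E (n + 1))) := by
    have hcomp := hΓ.inter_right hcl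
    have hcont := hg.mono (Set.inter_subset_right (s := interface bg φ))
    obtain ⟨C, hC⟩ := hcomp.exists_bound_of_continuousOn hcont
    refine IntegrableOn.of_bound ((measure_mono Set.inter_subset_left).trans_lt hΓfin)
      (hcont.aestronglyMeasurable_of_isCompact hcomp hcomp.measurableSet) C ?_
    rw [ae_restrict_iff' hcomp.measurableSet]
    exact Filter.Eventually.of_forall hC
  have h2 : IntegrableOn g (interface bg φ \ ⋃₀ interfaceMesh bg φ 𝒦)
      (μHE[n] : Measure (E (n + 1))) := by
    rw [IntegrableOn, Measure.restrict_eq_zero.2 (measure_interface_diff hf hcov)]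
    exact integrable_zero_measure
  rw [← Set.inter_union_sdiff (interface bg φ) (⋃₀ interfaceMesh bg φ 𝒦)]
  exact h1.union h2

/-! ### The multiplier on the interface elements -/

lemma IsPolyOn.exists_polyMap {d m : ℕ} {T : Set (E d)} {v : E d → E d} (h : IsPolyOn m T v) :
    ∃ P, IsPolyMap m P ∧ Set.EqOn v P T := by
  obtain ⟨p, hp, hv⟩ := h
  refine ⟨fun x => WithLp.toLp 2 fun i => MvPolynomial.eval (fun j => x j) (p i),
    fun i => ⟨p i, hp i, fun x => rfl⟩, fun x hx => ?_⟩
  ext i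
  exact hv x hx i

lemma exists_polyMap_family {d m : ℕ} {𝒯 : Set (Set (E d))} {v : E d → E d}
    (h : ∀ T ∈ 𝒯, IsPolyOn m T v) :
    ∃ P : Set (E d) → E d → E d, ∀ T ∈ 𝒯, IsPolyMap m (P T) ∧ Set.EqOn v (P T) T := by
  classical
  have h' : ∀ T : Set (E d), ∃ P : E d → E d, T ∈ 𝒯 → IsPolyMap m P ∧ Set.EqOn v P T := by
    intro T
    by_cases hT : T ∈ 𝒯
    · obtain ⟨P, hP⟩ := (h T hT).exists_polyMap
      exact ⟨P, fun _ => hP⟩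
    · exact ⟨0, fun h => (hT h).elim⟩
  choose P hP using h'
  exact ⟨P, hP⟩

lemma ae_fderiv_eq {d : ℕ} {𝒦 : Geometry.SimplicialComplex ℝ (E d)} {K : Set (E d)}
    (hK : K ∈ elements 𝒦) {v P : E d → E d} (h : Set.EqOn v P K) :
    ∀ᵐ x ∂volume.restrict K, fderiv ℝ v x = fderiv ℝ P x := by
  filter_upwards [ae_mem_interior_of_mem_elements hK] with x hx
  refine Filter.EventuallyEq.fderiv_eq ?_
  filter_upwards [mem_interior_iff_mem_nhds.1 hx] with y hy
  exact h hy

lemma IsLevelSet.continuousOn_normal {d : ℕ} {bg : Set (E d)} {c M ρ : ℝ} {φ : E d → ℝ}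
    (H : IsLevelSet bg c M ρ φ) (hbg : IsOpen bg) {A : Set (E d)} (hA : A ⊆ bg)
    (hA0 : ∀ x ∈ A, gradient φ x ≠ 0) : ContinuousOn (normal φ) A := by
  have h1 : ContinuousOn (gradient φ) A := by
    intro x hx
    have h2 : ContDiffAt ℝ 0 (fderiv ℝ φ) x := (H.contDiffAt hbg (hA hx)).fderiv_right (by simp)
    exact ((InnerProductSpace.toDual ℝ (E d)).symm.continuous.continuousAt.comp
      h2.continuousAt).continuousWithinAt
  exact ((h1.norm.inv₀ fun x hx => norm_ne_zero_iff.2 (hA0 x hx)).smul h1).neg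

lemma integrableOn_normalDeriv {d m : ℕ} {bg : Set (E d)} {c M ρ : ℝ} {φ : E d → ℝ}
    (H : IsLevelSet bg c M ρ φ) (hbg : IsOpen bg) {𝒦 : Geometry.SimplicialComplex ℝ (E d)}
    {K : Set (E d)} (hK : K ∈ elements 𝒦) (hKbg : K ⊆ bg) (hK0 : ∀ x ∈ K, gradient φ x ≠ 0)
    {v P : E d → E d} (hP : IsPolyMap m P) (h : Set.EqOn v P K) :
    IntegrableOn (fun x => ‖normalDeriv φ v x‖ ^ 2) K := by
  have hcK := isCompact_of_mem_elements hK
  have h1 : IntegrableOn (fun x => ‖fderiv ℝ P x (normal φ x)‖ ^ 2) K := by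
    refine ContinuousOn.integrableOn_compact hcK ?_
    have h2 := (hP.contDiff.continuous_fderiv (by simp)).continuousOn (s := K)
    exact (h2.clm_apply (H.continuousOn_normal hbg hKbg hK0)).norm.pow 2
  refine h1.congr ?_
  filter_upwards [ae_fderiv_eq hK h] with x hx
  rw [normalDeriv, hx]

/-- Replacing the frozen direction `N` by the normal field. -/
lemma setIntegral_fderiv_direction_le {d m : ℕ} {bg : Set (E d)} {c M ρ : ℝ} {φ : E d → ℝ}
    (H : IsLevelSet bg c M ρ φ) (hbg : IsOpen bg) {𝒦 : Geometry.SimplicialComplex ℝ (E d)}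
    {K : Set (E d)} (hK : K ∈ elements 𝒦) (hKbg : K ⊆ bg) (hK0 : ∀ x ∈ K, gradient φ x ≠ 0)
    {v P : E d → E d} (hP : IsPolyMap m P) (h : Set.EqOn v P K) {N : E d} {η : ℝ}
    (hN : ∀ x ∈ K, ‖normal φ x + N‖ ≤ 2 * η) :
    ∫ x in K, ‖fderiv ℝ P x N‖ ^ 2 ≤ 2 * (∫ x in K, ‖normalDeriv φ v x‖ ^ 2) +
      8 * η ^ 2 * ∫ x in K, ‖fderiv ℝ P x‖ ^ 2 := by
  have hcK := isCompact_of_mem_elements hK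
  have hcf := hP.contDiff.continuous_fderiv (by simp)
  have h1 := integrableOn_normalDeriv H hbg hK hKbg hK0 hP h
  have h2 : IntegrableOn (fun x => ‖fderiv ℝ P x‖ ^ 2) K :=
    (hcf.norm.pow 2).continuousOn.integrableOn_compact hcK
  have h3 : IntegrableOn (fun x => ‖fderiv ℝ P x N‖ ^ 2) K :=
    ((hcf.clm_apply continuous_const).norm.pow 2).continuousOn.integrableOn_compact hcK
  rw [← integral_const_mul, ← integral_const_mul, ← integral_add (h1.const_mul 2) (h2.const_mul _)]
  refine integral_mono_ae h3 ((h1.const_mul 2).add (h2.const_mul _)) ?_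
  filter_upwards [ae_fderiv_eq hK h, ae_restrict_mem hcK.measurableSet] with x hx hxK
  simp only [normalDeriv, hx]
  -- `N` is written as `(n + N) - n`, where `n + N` is small.
  have h4 : fderiv ℝ P x N = fderiv ℝ P x (normal φ x + N) - fderiv ℝ P x (normal φ x) := by
    rw [map_add]; abel
  have h5 : ‖fderiv ℝ P x (normal φ x + N)‖ ≤ ‖fderiv ℝ P x‖ * (2 * η) :=
    ((fderiv ℝ P x).le_opNorm _).trans (mul_le_mul_of_nonneg_left (hN x hxK) (norm_nonneg _))
  have h6 : ‖fderiv ℝ P x N‖ ≤ ‖fderiv ℝ P x‖ * (2 * η) + ‖fderiv ℝ P x (normal φ x)‖ := by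
    rw [h4]
    exact (norm_sub_le _ _).trans (by linarith)
  nlinarith [norm_nonneg (fderiv ℝ P x N), norm_nonneg (fderiv ℝ P x (normal φ x)),
    sq_nonneg (‖fderiv ℝ P x‖ * (2 * η) - ‖fderiv ℝ P x (normal φ x)‖),
    pow_le_pow_left₀ (norm_nonneg _) h6 2]

/-- A mesh and a level set function on the background domain, with mesh size small compared to the
clearance and the curvature of the interface. -/
structure Setting {n : ℕ} (bg : Set (E (n + 1))) (σ q c M ρ h : ℝ)
    (𝒦 : Geometry.SimplicialComplex ℝ (E (n + 1))) (φ : E (n + 1) → ℝ) : Prop where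
  isOpen : IsOpen bg
  bounded : Bornology.IsBounded bg
  σ_pos : 0 < σ
  q_pos : 0 < q
  c_pos : 0 < c
  ρ_pos : 0 < ρ
  h_pos : 0 < h
  mesh : IsMesh bg σ q h 𝒦
  levelSet : IsLevelSet bg c M ρ φ
  h_lt : 3 * h < ρ
  h_lt' : (|M| + 1) / c * (3 * h) < 1

namespace Setting

variable {n : ℕ} {bg : Set (E (n + 1))} {σ q c M ρ h : ℝ}
  {𝒦 : Geometry.SimplicialComplex ℝ (E (n + 1))} {φ : E (n + 1) → ℝ}

lemma goodMesh (S : Setting bg σ q c M ρ h 𝒦 φ) : GoodMesh 𝒦 h (σ * q * h) :=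
  S.mesh.goodMesh S.σ_pos S.q_pos S.h_pos

lemma ball_facts (S : Setting bg σ q c M ρ h 𝒦 φ) {x₀ : E (n + 1)} (hx₀ : x₀ ∈ interface bg φ)
    {K : Set (E (n + 1))} (hK : K ⊆ Metric.closedBall x₀ (3 * h)) :
    K ⊆ bg ∧ ∀ x ∈ K, gradient φ x ≠ 0 :=
  ⟨hK.trans ((Metric.closedBall_subset_ball S.h_lt).trans (S.levelSet.clearance x₀ hx₀)),
    fun _ hx => (S.levelSet.norm_normal_add_le S.isOpen S.c_pos hx₀ S.h_lt S.h_lt' (hK hx)).1⟩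

lemma exists_mem_interface {T : Set (E (n + 1))} (hT : T ∈ interfaceMesh bg φ 𝒦) :
    ∃ x₀ ∈ T, x₀ ∈ interface bg φ := nonempty_of_measure_ne_zero hT.2.ne'

lemma subset_closedBall (S : Setting bg σ q c M ρ h 𝒦 φ) {T : Set (E (n + 1))}
    (hT : T ∈ elements 𝒦) {x : E (n + 1)} (hx : x ∈ T) {R : ℝ} (hR : h ≤ R) :
    T ⊆ Metric.closedBall x R :=
  (S.goodMesh.subset_closedBall hT hx).trans (Metric.closedBall_subset_closedBall hR)

lemma integrableOn_normalDeriv_sq (S : Setting bg σ q c M ρ h 𝒦 φ) {m : ℕ}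
    {μ : E (n + 1) → E (n + 1)} {K : Set (E (n + 1))} (hK : K ∈ interfaceMesh bg φ 𝒦)
    (hμ : IsPolyOn m K μ) : IntegrableOn (fun x => ‖normalDeriv φ μ x‖ ^ 2) K := by
  obtain ⟨x₀, hx₀K, hx₀⟩ := exists_mem_interface hK
  obtain ⟨P, hP, hμP⟩ := hμ.exists_polyMap
  obtain ⟨h1, h2⟩ := S.ball_facts hx₀ (S.subset_closedBall hK.1 hx₀K (by linarith [S.h_pos]))
  exact integrableOn_normalDeriv S.levelSet S.isOpen hK.1 h1 h2 hP hμP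

lemma integrableOn_interface_sq (S : Setting bg σ q c M ρ h 𝒦 φ) {μ : E (n + 1) → E (n + 1)}
    (hμ : ContinuousOn μ (⋃₀ interfaceMesh bg φ 𝒦)) :
    IntegrableOn (fun x => ‖μ x‖ ^ 2) (interface bg φ) (μHE[n] : Measure (E (n + 1))) :=
  integrableOn_interface S.mesh.finite S.mesh.covers
    (S.levelSet.isCompact_interface S.isOpen S.bounded S.ρ_pos)
    (S.levelSet.measure_interface_lt_top S.isOpen S.bounded S.c_pos S.ρ_pos) (hμ.norm.pow 2)

end Setting

/-- The estimate on one interface element. -/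
lemma exists_element_estimate (n m : ℕ) {σ q c : ℝ} (hσ : 0 < σ) (hq : 0 < q) (hc : 0 < c)
    (M : ℝ) : ∃ C > 0, ∃ h₁ > 0, ∀ {ρ h : ℝ} {bg : Set (E (n + 1))}
      {𝒦 : Geometry.SimplicialComplex ℝ (E (n + 1))} {φ : E (n + 1) → ℝ},
      h ≤ h₁ → Setting bg σ q c M ρ h 𝒦 φ →
      ∀ μ ∈ feSpace m (interfaceMesh bg φ 𝒦), ∀ T ∈ interfaceMesh bg φ 𝒦, ∀ x₀ ∈ T,
      x₀ ∈ interface bg φ → ∀ J : Finset (Set (E (n + 1))),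
      (∀ K, K ∈ J ↔ K ∈ interfaceMesh bg φ 𝒦 ∧ K ⊆ Metric.closedBall x₀ (3 * h)) →
      ∫ x in T, ‖μ x‖ ^ 2 ≤ C * (h * (∫ x in interface bg φ ∩ Metric.closedBall x₀ (3 * h),
          ‖μ x‖ ^ 2 ∂(μHE[n] : Measure (E (n + 1)))) +
        ∑ K ∈ J, (h ^ 2 * (∫ x in K, ‖normalDeriv φ μ x‖ ^ 2) + h ^ 2 * ∫ x in K, ‖μ x‖ ^ 2)) := by
  set a := (|M| + 1) / c with ha
  have hapos : 0 < a := by positivity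
  -- This is the value for which `t · 14 (n + 2) h` equals the inscribed radius `σ q h`.
  set t := σ * q / (14 * (n + 2)) with ht
  have htpos : 0 < t := by positivity
  -- The first entry times `h` is the lower bound for the column ball, the second gives the
  -- inscribed ball, so one family of inverse estimates serves both.
  set κ := min (t * (σ * q) ^ 2 / 256) (σ * q) with hκ
  have hκpos : 0 < κ := lt_min (by positivity) (by positivity)
  obtain ⟨Ci, hCi, Hinv⟩ := exists_inverse_estimates (n + 1) m hκpos
  set n₁ := (3 / (σ * q)) ^ (n + 1) with hn₁
  have hn₁pos : 0 < n₁ := by positivity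
  refine ⟨Ci * (4 + 16 * n₁ + 8 * n₁ * (72 * a ^ 2) * Ci), by positivity, t / (3 * a),
    by positivity, ?_⟩
  intro ρ h bg 𝒦 φ hh₁ S μ hμ T hT x₀ hx₀T hx₀ J hJ
  have hh := S.h_pos
  set η := a * (3 * h) with hη
  have hηpos : 0 < η := by positivity
  have hηt : η ≤ t := by
    rw [le_div_iff₀ (by positivity)] at hh₁
    rw [hη]; linarith
  have LC := S.levelSet.localCut S.mesh S.isOpen hσ hq hc hh S.h_lt hx₀
  rw [← ha, ← hη] at LC
  set N := ‖gradient φ x₀‖⁻¹ • gradient φ x₀ with hN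
  obtain ⟨P, hP⟩ := exists_polyMap_family hμ.2
  obtain ⟨ν, hν, y₀, hy₀, hcol⟩ := LC.hasColumns hηpos.le (t := t) (by rw [ht]; field_simp) hηt hT hx₀T
  have hκν : κ * h ≤ ν := by
    refine le_trans ?_ hν
    calc κ * h ≤ t * (σ * q) ^ 2 / 256 * h := by gcongr; exact min_le_left _ _
      _ = _ := by field_simp
  have hBν : Metric.closedBall y₀ (κ * h) ⊆ Metric.closedBall y₀ ν :=
    Metric.closedBall_subset_closedBall hκν
  have hBT : Metric.closedBall y₀ (κ * h) ⊆ T := hBν.trans hy₀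
  have hy₀T : y₀ ∈ T := hBT (Metric.mem_closedBall_self (by positivity))
  have hmain := LC.lintegral_ball_le hηpos.le S.h_lt' hP hμ.1 hJ hT.1 hx₀T hBT
    fun y hy => hcol y (hBν hy)
  have hJK : ∀ K ∈ J, K ∈ interfaceMesh bg φ 𝒦 := fun K hK => ((hJ K).1 hK).1
  have hcP : ∀ K ∈ interfaceMesh bg φ 𝒦, Continuous (fderiv ℝ (P K)) := fun K hK =>
    (hP K hK).1.contDiff.continuous_fderiv (by simp)
  have hcompJ : ∀ K ∈ J, IsCompact K := fun K hK => isCompact_of_mem_elements (hJK K hK).1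
  set Γs := interface bg φ ∩ Metric.closedBall x₀ (3 * h) with hΓs
  have hμΓ := S.integrableOn_interface_sq hμ.1
  have hμΓs : IntegrableOn (fun x => ‖μ x‖ ^ 2) Γs (μHE[n] : Measure (E (n + 1))) :=
    hμΓ.mono_set Set.inter_subset_left
  set X : Set (E (n + 1)) → ℝ := fun K => ∫ x in K, ‖μ x‖ ^ 2 with hX
  set D : Set (E (n + 1)) → ℝ := fun K => ∫ x in K, ‖fderiv ℝ (P K) x N‖ ^ 2 with hD
  set Nd : Set (E (n + 1)) → ℝ := fun K => ∫ x in K, ‖normalDeriv φ μ x‖ ^ 2 with hNd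
  set G : ℝ := ∫ x in Γs, ‖μ x‖ ^ 2 ∂(μHE[n] : Measure (E (n + 1))) with hG
  have hG0 : 0 ≤ G := integral_nonneg fun _ => sq_nonneg _
  have hX0 : ∀ K, 0 ≤ X K := fun K => integral_nonneg fun _ => sq_nonneg _
  have hD0 : ∀ K, 0 ≤ D K := fun K => integral_nonneg fun _ => sq_nonneg _
  have hNd0 : ∀ K, 0 ≤ Nd K := fun K => integral_nonneg fun _ => sq_nonneg _
  have hμc : ContinuousOn (fun x => ‖μ x‖ ^ 2) (⋃₀ interfaceMesh bg φ 𝒦) := hμ.1.norm.pow 2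
  have hTO : T ⊆ ⋃₀ interfaceMesh bg φ 𝒦 := Set.subset_sUnion_of_mem hT
  have hB : ∫ y in Metric.closedBall y₀ (κ * h), ‖μ y‖ ^ 2 ≤
      4 * h * G + 8 * h ^ 2 * J.card * ∑ K ∈ J, D K := by
    have h1 : IntegrableOn (fun x => ‖μ x‖ ^ 2) (Metric.closedBall y₀ (κ * h)) :=
      (hμc.mono (hBT.trans hTO)).integrableOn_compact (isCompact_closedBall _ _)
    have h2 : IntegrableOn (fun x => ‖μ x‖ ^ 2)
        (Γs ∩ ⋃₀ cutElements 𝒦 (interface bg φ)) (μHE[n] : Measure (E (n + 1))) :=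
      hμΓs.mono_set Set.inter_subset_left
    have h3 : ∀ K ∈ J, ∫⁻ x in K, ENNReal.ofReal (‖fderiv ℝ (P K) x N‖ ^ 2) =
        ENNReal.ofReal (D K) := by
      intro K hK
      refine (ofReal_integral_eq_lintegral_ofReal ?_
        (Filter.Eventually.of_forall fun _ => sq_nonneg _)).symm
      exact (((hcP K (hJK K hK)).clm_apply continuous_const).norm.pow 2).continuousOn.integrableOn_compact
        (hcompJ K hK)
    rw [← ofReal_integral_eq_lintegral_ofReal h1 (Filter.Eventually.of_forall fun _ => sq_nonneg _),
      ← ofReal_integral_eq_lintegral_ofReal h2 (Filter.Eventually.of_forall fun _ => sq_nonneg _),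
      Finset.sum_congr rfl h3, ← ENNReal.ofReal_sum_of_nonneg fun K _ => hD0 K,
      ← ENNReal.ofReal_mul (by positivity), ← ENNReal.ofReal_mul (by positivity),
      ← ENNReal.ofReal_add
        (mul_nonneg (by positivity) (integral_nonneg fun _ => sq_nonneg _))
        (mul_nonneg (by positivity) (Finset.sum_nonneg fun K _ => hD0 K)),
      ENNReal.ofReal_le_ofReal_iff (add_nonneg
        (mul_nonneg (by positivity) (integral_nonneg fun _ => sq_nonneg _))
        (mul_nonneg (by positivity) (Finset.sum_nonneg fun K _ => hD0 K)))] at hmain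
    refine hmain.trans ?_
    gcongr
    exact setIntegral_mono_set hμΓs (Filter.Eventually.of_forall fun _ => sq_nonneg _)
      Set.inter_subset_left.eventuallyLE
  have hcard : (J.card : ℝ) ≤ n₁ := by
    refine (S.goodMesh.card_le (fun K hK => (hJK K hK).1) (x := x₀) (R := 3 * h) (by positivity)
      fun K hK => ((hJ K).1 hK).2).trans_eq ?_
    rw [hn₁]
    congr 1
    field_simp
  have hT1 : X T ≤ Ci * ∫ y in Metric.closedBall y₀ (κ * h), ‖μ y‖ ^ 2 := by
    have h1 := (Hinv h hh T y₀ (isCompact_of_mem_elements hT.1) hBT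
      (S.subset_closedBall hT.1 hy₀T le_rfl) (P T) (hP T hT).1).2.1
    rw [← setIntegral_congr_fun (isCompact_of_mem_elements hT.1).measurableSet
        (fun x hx => by simp only [(hP T hT).2 hx] : Set.EqOn (fun x => ‖μ x‖ ^ 2)
          (fun x => ‖P T x‖ ^ 2) T),
      ← setIntegral_congr_fun Metric.isClosed_closedBall.measurableSet
        (fun x hx => by simp only [(hP T hT).2 (hBT hx)] : Set.EqOn (fun x => ‖μ x‖ ^ 2)
          (fun x => ‖P T x‖ ^ 2) (Metric.closedBall y₀ (κ * h)))] at h1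
    exact h1
  -- Freezing the normal costs `8 η² ‖∇μ‖²` with `η = 3 a h`; the inverse estimate turns `h² ‖∇μ‖²`
  -- into `‖μ‖²`, leaving `72 a² h² ‖μ‖²`, of higher order in `h`.
  have hDK : ∀ K ∈ J, h ^ 2 * D K ≤ 2 * (h ^ 2 * Nd K) + 72 * a ^ 2 * Ci * (h ^ 2 * X K) := by
    intro K hK
    have hKI := hJK K hK
    have hKb := ((hJ K).1 hK).2
    obtain ⟨hKbg, hK0⟩ := S.ball_facts hx₀ hKb
    have h1 := setIntegral_fderiv_direction_le S.levelSet S.isOpen hKI.1 hKbg hK0 (hP K hKI).1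
      (hP K hKI).2 (N := N) (η := η) (fun x hx => (S.levelSet.norm_normal_add_le S.isOpen S.c_pos hx₀
        S.h_lt S.h_lt' (hKb hx)).2)
    obtain ⟨m', hm'⟩ := S.goodMesh.inball K hKI.1
    have hm'' : Metric.closedBall m' (κ * h) ⊆ K :=
      (Metric.closedBall_subset_closedBall (by gcongr; exact min_le_right _ _)).trans hm'
    have h2 := (Hinv h hh K m' (hcompJ K hK) hm'' (S.subset_closedBall hKI.1
      (hm'' (Metric.mem_closedBall_self (by positivity))) le_rfl) (P K) (hP K hKI).1).2.2
    rw [← setIntegral_congr_fun (hcompJ K hK).measurableSet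
        (fun x hx => by simp only [(hP K hKI).2 hx] : Set.EqOn (fun x => ‖μ x‖ ^ 2)
          (fun x => ‖P K x‖ ^ 2) K)] at h2
    calc h ^ 2 * D K ≤ h ^ 2 * (2 * Nd K + 8 * η ^ 2 * ∫ x in K, ‖fderiv ℝ (P K) x‖ ^ 2) := by
          gcongr
      _ = 2 * (h ^ 2 * Nd K) + 8 * η ^ 2 * (h ^ 2 * ∫ x in K, ‖fderiv ℝ (P K) x‖ ^ 2) := by ring
      _ ≤ 2 * (h ^ 2 * Nd K) + 8 * η ^ 2 * (Ci * X K) := by gcongr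
      _ = _ := by rw [hη]; ring
  have hsumD : h ^ 2 * ∑ K ∈ J, D K ≤
      (2 + 72 * a ^ 2 * Ci) * ∑ K ∈ J, (h ^ 2 * Nd K + h ^ 2 * X K) := by
    rw [Finset.mul_sum, Finset.mul_sum]
    refine Finset.sum_le_sum fun K hK => (hDK K hK).trans ?_
    have h1 : 0 ≤ h ^ 2 * Nd K := mul_nonneg (by positivity) (hNd0 K)
    have h2 : 0 ≤ h ^ 2 * X K := mul_nonneg (by positivity) (hX0 K)
    have h3 : 0 ≤ 72 * a ^ 2 * Ci * (h ^ 2 * Nd K) := by positivity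
    nlinarith
  have hQ0 : 0 ≤ ∑ K ∈ J, (h ^ 2 * Nd K + h ^ 2 * X K) := Finset.sum_nonneg fun K _ =>
    add_nonneg (mul_nonneg (by positivity) (hNd0 K)) (mul_nonneg (by positivity) (hX0 K))
  set Q := ∑ K ∈ J, (h ^ 2 * Nd K + h ^ 2 * X K) with hQ
  calc X T ≤ Ci * (4 * h * G + 8 * h ^ 2 * J.card * ∑ K ∈ J, D K) := hT1.trans (by gcongr)
    _ = Ci * (4 * (h * G) + 8 * J.card * (h ^ 2 * ∑ K ∈ J, D K)) := by ring
    _ ≤ Ci * (4 * (h * G) + 8 * n₁ * ((2 + 72 * a ^ 2 * Ci) * Q)) := by gcongr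
    _ ≤ Ci * (4 + 16 * n₁ + 8 * n₁ * (72 * a ^ 2) * Ci) * (h * G + Q) := by
        have h1 : 0 ≤ h * G := by positivity
        rw [mul_assoc Ci]
        gcongr Ci * ?_
        have h2 : 0 ≤ (16 * n₁ + 8 * n₁ * (72 * a ^ 2) * Ci) * (h * G) := by positivity
        nlinarith

/-! ### Summation over the interface elements -/

-- Interchanging the sums, each `K` is counted once for every `T` related to it, that is, at most
-- `N` times.
open Classical in
lemma sum_sum_filter_le {ι κ : Type*} {I : Finset ι} {L : Finset κ} {R : ι → κ → Prop}
    {f : κ → ℝ} (hf : ∀ K ∈ L, 0 ≤ f K) {N : ℝ}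
    (hN : ∀ K ∈ L, ((I.filter fun T => R T K).card : ℝ) ≤ N) :
    ∑ T ∈ I, ∑ K ∈ L.filter (R T), f K ≤ N * ∑ K ∈ L, f K := by
  simp only [Finset.sum_filter]
  rw [Finset.sum_comm, Finset.mul_sum]
  refine Finset.sum_le_sum fun K hK => ?_
  rw [← Finset.sum_filter, Finset.sum_const, nsmul_eq_mul]
  exact mul_le_mul_of_nonneg_right (hN K hK) (hf K hK)

open Classical in
lemma sum_setIntegral_inter_le {X ι : Type*} [MeasurableSpace X] {ν : Measure X} {A : Set X}
    {I : Finset ι} {B : ι → Set X} (hB : ∀ T ∈ I, MeasurableSet (B T)) {g : X → ℝ}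
    (hg0 : ∀ x, 0 ≤ g x) (hg : IntegrableOn g A ν) {N : ℝ}
    (hN : ∀ x ∈ A, ((I.filter fun T => x ∈ B T).card : ℝ) ≤ N) (hA : MeasurableSet A) :
    ∑ T ∈ I, ∫ x in A ∩ B T, g x ∂ν ≤ N * ∫ x in A, g x ∂ν := by
  have h1 : ∀ T ∈ I, ∫ x in A ∩ B T, g x ∂ν = ∫ x in A, (B T).indicator g x ∂ν := fun T hT => by
    rw [setIntegral_indicator (hB T hT)]
  have h2 : ∀ T ∈ I, Integrable ((B T).indicator g) (ν.restrict A) := fun T hT =>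
    Integrable.indicator hg (hB T hT)
  rw [Finset.sum_congr rfl h1, ← integral_finsetSum _ h2, ← integral_const_mul]
  refine setIntegral_mono_on (integrable_finsetSum _ h2) (hg.const_mul N) hA fun x hx => ?_
  simp only [Set.indicator_apply]
  rw [← Finset.sum_filter, Finset.sum_const, nsmul_eq_mul]
  exact mul_le_mul_of_nonneg_right (hN x hx) (hg0 x)

/-- A function of the multiplier space is controlled on the interface elements by its trace on the
interface and its normal derivative. -/
lemma exists_volume_estimate (n m : ℕ) {σ q c : ℝ} (hσ : 0 < σ) (hq : 0 < q) (hc : 0 < c)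
    (M : ℝ) : ∃ C > 0, ∃ h₁ > 0, ∀ {ρ h : ℝ} {bg : Set (E (n + 1))}
      {𝒦 : Geometry.SimplicialComplex ℝ (E (n + 1))} {φ : E (n + 1) → ℝ},
      h ≤ h₁ → Setting bg σ q c M ρ h 𝒦 φ →
      ∀ μ ∈ feSpace m (interfaceMesh bg φ 𝒦), ∀ I : Finset (Set (E (n + 1))),
      (∀ K, K ∈ I ↔ K ∈ interfaceMesh bg φ 𝒦) →
      ∑ T ∈ I, ∫ x in T, ‖μ x‖ ^ 2 ≤ C * (h * (∫ x in interface bg φ,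
          ‖μ x‖ ^ 2 ∂(μHE[n] : Measure (E (n + 1)))) +
        h ^ 2 * ∑ T ∈ I, ∫ x in T, ‖normalDeriv φ μ x‖ ^ 2) := by
  classical
  obtain ⟨C, hC, h₁, hh₁, H⟩ := exists_element_estimate n m hσ hq hc M
  set N₀ := (4 / (σ * q)) ^ (n + 1) with hN₀
  have hN₀pos : 0 < N₀ := by positivity
  -- This makes `C N₀ h² ≤ 1 / 2`, so that the remainder `h² ‖μ‖²` is absorbed into the left-hand
  -- side.
  set h₂ := min 1 (1 / (2 * (C * N₀))) with hh₂
  have hh₂pos : 0 < h₂ := lt_min one_pos (by positivity)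
  refine ⟨2 * (C * N₀), by positivity, min h₁ h₂, lt_min hh₁ hh₂pos, ?_⟩
  intro ρ h bg 𝒦 φ hh S μ hμ I hI
  have hpos := S.h_pos
  have hmem : ∀ T : Set (E (n + 1)), ∃ x, T ∈ I → x ∈ T ∧ x ∈ interface bg φ := fun T => by
    by_cases hT : T ∈ I
    · obtain ⟨x, hx, hx'⟩ := Setting.exists_mem_interface ((hI T).1 hT)
      exact ⟨x, fun _ => ⟨hx, hx'⟩⟩
    · exact ⟨0, fun h => (hT h).elim⟩
  choose x₀ hx₀ using hmem
  set Γ := interface bg φ with hΓ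
  set X : Set (E (n + 1)) → ℝ := fun K => ∫ x in K, ‖μ x‖ ^ 2 with hX
  set Nd : Set (E (n + 1)) → ℝ := fun K => ∫ x in K, ‖normalDeriv φ μ x‖ ^ 2 with hNd
  have hX0 : ∀ K, 0 ≤ X K := fun K => integral_nonneg fun _ => sq_nonneg _
  have hNd0 : ∀ K, 0 ≤ Nd K := fun K => integral_nonneg fun _ => sq_nonneg _
  set R : Set (E (n + 1)) → Set (E (n + 1)) → Prop := fun T K =>
    K ⊆ Metric.closedBall (x₀ T) (3 * h) with hR
  -- Elements whose `3 h`-neighbourhood contains `x` lie in the ball of radius `4 h` around `x`,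
  -- hence the base `4 / (σ q)` in `N₀`.
  have hcard : ∀ x : E (n + 1), ∀ I' : Finset (Set (E (n + 1))), I' ⊆ I →
      (∀ T ∈ I', x ∈ Metric.closedBall (x₀ T) (3 * h)) → (I'.card : ℝ) ≤ N₀ := by
    intro x I' hI' hx
    refine (S.goodMesh.card_le (fun K hK => ((hI K).1 (hI' hK)).1) (x := x) (R := 4 * h)
      (by positivity) fun T hT => ?_).trans_eq ?_
    · have h1 := S.subset_closedBall ((hI T).1 (hI' hT)).1 (hx₀ T (hI' hT)).1 le_rfl
      refine h1.trans (Metric.closedBall_subset_closedBall' ?_)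
      have := Metric.mem_closedBall'.1 (hx T hT)
      linarith
    · rw [hN₀]
      congr 1
      field_simp
  have h1 : ∀ T ∈ I, X T ≤ C * (h * (∫ x in Γ ∩ Metric.closedBall (x₀ T) (3 * h),
      ‖μ x‖ ^ 2 ∂(μHE[n] : Measure (E (n + 1)))) +
        ∑ K ∈ I.filter (R T), (h ^ 2 * Nd K + h ^ 2 * X K)) := fun T hT =>
    H (hh.trans (min_le_left _ _)) S μ hμ T ((hI T).1 hT) (x₀ T) (hx₀ T hT).1 (hx₀ T hT).2 _
      fun K => by rw [Finset.mem_filter, hI]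
  have hΓm : MeasurableSet Γ :=
    (S.levelSet.isCompact_interface S.isOpen S.bounded S.ρ_pos).measurableSet
  have h2 : ∑ T ∈ I, ∫ x in Γ ∩ Metric.closedBall (x₀ T) (3 * h),
      ‖μ x‖ ^ 2 ∂(μHE[n] : Measure (E (n + 1))) ≤
      N₀ * ∫ x in Γ, ‖μ x‖ ^ 2 ∂(μHE[n] : Measure (E (n + 1))) :=
    sum_setIntegral_inter_le (fun T _ => Metric.isClosed_closedBall.measurableSet)
      (fun _ => sq_nonneg _) (S.integrableOn_interface_sq hμ.1)
      (fun x _ => hcard x _ (Finset.filter_subset _ _) fun T hT => (Finset.mem_filter.1 hT).2) hΓm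
  have h3 : ∑ T ∈ I, ∑ K ∈ I.filter (R T), (h ^ 2 * Nd K + h ^ 2 * X K) ≤
      N₀ * ∑ K ∈ I, (h ^ 2 * Nd K + h ^ 2 * X K) :=
    sum_sum_filter_le (fun K _ => add_nonneg (mul_nonneg (by positivity) (hNd0 K))
      (mul_nonneg (by positivity) (hX0 K))) fun K hK =>
      hcard (x₀ K) _ (Finset.filter_subset _ _) fun T hT => (Finset.mem_filter.1 hT).2 (hx₀ K hK).1
  have h4 := Finset.sum_le_sum h1
  rw [← Finset.mul_sum, Finset.sum_add_distrib, ← Finset.mul_sum] at h4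
  set G := ∫ x in Γ, ‖μ x‖ ^ 2 ∂(μHE[n] : Measure (E (n + 1)))
  rw [Finset.sum_add_distrib, ← Finset.mul_sum, ← Finset.mul_sum] at h3
  have hSX : 0 ≤ ∑ T ∈ I, X T := Finset.sum_nonneg fun T _ => hX0 T
  have h5 : ∑ T ∈ I, X T ≤ C * (h * (N₀ * G) +
      N₀ * (h ^ 2 * ∑ T ∈ I, Nd T + h ^ 2 * ∑ T ∈ I, X T)) := h4.trans (by gcongr)
  have h6 : C * N₀ * h ^ 2 ≤ 1 / 2 := by
    have e1 : h ≤ 1 := hh.trans ((min_le_right _ _).trans (min_le_left _ _))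
    have e2 : h ≤ 1 / (2 * (C * N₀)) := hh.trans ((min_le_right _ _).trans (min_le_right _ _))
    calc C * N₀ * h ^ 2 = C * N₀ * (h * h) := by ring
      _ ≤ C * N₀ * (1 * (1 / (2 * (C * N₀)))) := by gcongr
      _ = 1 / 2 := by field_simp
  have h7 := mul_le_mul_of_nonneg_right h6 hSX
  linarith

/-! ### Homogeneous polynomials in barycentric coordinates -/

/-- Discarding the variables outside a face amounts to evaluating with zeros there, which is how
barycentric coordinates of points of the face look. -/
lemma eval_killCompl {σ τ : Type*} {f : σ → τ} (hf : Function.Injective f) (Q : MvPolynomial τ ℝ)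
    (u : σ → ℝ) : MvPolynomial.eval u (MvPolynomial.killCompl hf Q) =
      MvPolynomial.eval (Function.extend f u 0) Q := by
  induction Q using MvPolynomial.induction_on with
  | C a => simp
  | add p q hp hq => simp [hp, hq]
  | mul_X p z hp =>
    rw [map_mul, map_mul, hp, map_mul, MvPolynomial.eval_X]
    congr 1
    rw [MvPolynomial.killCompl, MvPolynomial.aeval_X]
    split_ifs with h
    · obtain ⟨i, rfl⟩ := h
      rw [Equiv.ofInjective_symm_apply, MvPolynomial.eval_X, hf.extend_apply]
    · rw [map_zero, Function.extend_apply' _ _ _ h]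
      rfl

lemma isHomogeneous_killCompl {σ τ : Type*} {f : σ → τ} (hf : Function.Injective f)
    {Q : MvPolynomial τ ℝ} {m : ℕ} (hQ : Q.IsHomogeneous m) :
    (MvPolynomial.killCompl hf Q).IsHomogeneous m := by
  intro α hα
  rw [MvPolynomial.coeff_killCompl] at hα
  rw [← hQ hα]
  simp [Finsupp.weight_apply, Finsupp.sum_mapDomain_index]

lemma eval_mul_of_isHomogeneous {σ : Type*} {Q : MvPolynomial σ ℝ} {m : ℕ}
    (hQ : Q.IsHomogeneous m) (t : ℝ) (w : σ → ℝ) :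
    MvPolynomial.eval (fun i => t * w i) Q = t ^ m * MvPolynomial.eval w Q := by
  rw [MvPolynomial.eval_eq, MvPolynomial.eval_eq, Finset.mul_sum]
  refine Finset.sum_congr rfl fun α hα => ?_
  have h1 : ∑ i ∈ α.support, α i = m := (hQ.degree_eq_sum_deg_support hα).symm
  simp only [mul_pow]
  rw [Finset.prod_mul_distrib, Finset.prod_pow_eq_pow_sum, h1]
  ring

/-- By homogeneity, vanishing on the simplex spreads to the whole open positive orthant, a product
of infinite sets. -/
lemma eq_zero_of_eval_eq_zero_on_stdSimplex {σ : Type*} [Fintype σ] [Nonempty σ]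
    {Q : MvPolynomial σ ℝ} {m : ℕ} (hQ : Q.IsHomogeneous m)
    (h : ∀ u ∈ stdSimplex ℝ σ, MvPolynomial.eval u Q = 0) : Q = 0 := by
  refine MvPolynomial.funext_set (fun _ => Set.Ioi (0 : ℝ)) (fun _ => Set.Ioi_infinite 0)
    fun x hx => ?_
  have hx' : ∀ i, 0 < x i := fun i => hx i (Set.mem_univ i)
  have hS : 0 < ∑ i, x i := Finset.sum_pos (fun i _ => hx' i) Finset.univ_nonempty
  have h1 := h (fun i => (∑ i, x i)⁻¹ * x i) ⟨fun i => by have := hx' i; positivity, by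
    rw [← Finset.mul_sum, inv_mul_cancel₀ hS.ne']⟩
  rw [eval_mul_of_isHomogeneous hQ] at h1
  rw [map_zero]
  exact (mul_eq_zero.1 h1).resolve_left (by positivity)

/-- The linear map from coefficients to functions on the simplex is injective on a
finite-dimensional space, hence bounded below. -/
lemma exists_coeff_bound_stdSimplex (N m : ℕ) : ∃ C > 0, ∀ Q : MvPolynomial (Fin (N + 1)) ℝ,
    Q.IsHomogeneous m → ∀ B : ℝ, 0 ≤ B →
    (∀ u ∈ stdSimplex ℝ (Fin (N + 1)), |MvPolynomial.eval u Q| ≤ B) →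
    ∀ α, |MvPolynomial.coeff α Q| ≤ C * B := by
  classical
  let A := (Finset.univ : Finset (Fin (N + 1))).finsuppAntidiag m
  have hA : ∀ α, α ∈ A ↔ α.degree = m := fun α => by
    simp [A, Finsupp.degree_eq_sum]
  let p : (A → ℝ) → MvPolynomial (Fin (N + 1)) ℝ := fun c =>
    ∑ α : A, MvPolynomial.monomial α.1 (c α)
  have hp : ∀ c, (p c).IsHomogeneous m := fun c =>
    MvPolynomial.IsHomogeneous.sum _ _ _ fun α _ =>
      MvPolynomial.isHomogeneous_monomial _ ((hA _).1 α.2)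
  have hpc : ∀ c (α : A), (p c).coeff α.1 = c α := fun c α => by
    simp only [p, MvPolynomial.coeff_sum, MvPolynomial.coeff_monomial]
    rw [Finset.sum_eq_single α (fun β _ hβ => if_neg fun h => hβ (Subtype.ext h)) (by simp)]
    simp
  let f : (A → ℝ) →ₗ[ℝ] C(stdSimplex ℝ (Fin (N + 1)), ℝ) :=
    { toFun := fun c => ⟨fun u => MvPolynomial.eval u.1 (p c),
        (MvPolynomial.continuous_eval (p c)).comp continuous_subtype_val⟩
      map_add' := fun c c' => by
        ext u
        simp [p, Finset.sum_add_distrib]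
      map_smul' := fun t c => by
        ext u
        simp [p, Finset.mul_sum, mul_assoc, MvPolynomial.eval_monomial] }
  have hker : LinearMap.ker f = ⊥ := by
    rw [LinearMap.ker_eq_bot']
    intro c hc
    have h1 : p c = 0 := eq_zero_of_eval_eq_zero_on_stdSimplex (hp c) fun u hu => by
      have := congrArg (fun g : C(stdSimplex ℝ (Fin (N + 1)), ℝ) => g ⟨u, hu⟩) hc
      exact this
    funext α
    rw [← hpc c α, h1]
    rfl
  obtain ⟨K, hK, hKf⟩ := f.exists_antilipschitzWith hker
  refine ⟨K, hK, fun Q hQ B hB hQB α => ?_⟩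
  by_cases hα : α.degree = m
  · set c : A → ℝ := fun α => Q.coeff α.1 with hc
    have hQc : p c = Q := by
      ext β
      by_cases hβ : β.degree = m
      · exact hpc c ⟨β, (hA β).2 hβ⟩
      · rw [(hp c).coeff_eq_zero hβ, hQ.coeff_eq_zero hβ]
    have h1 : ‖c‖ ≤ K * ‖f c‖ := by
      have := hKf.le_mul_dist c 0
      rwa [map_zero, dist_zero_right, dist_zero_right] at this
    have h2 : ‖f c‖ ≤ B := (ContinuousMap.norm_le _ hB).2 fun u => by
      have := hQB u.1 u.2
      rw [← hQc] at this
      exact this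
    calc |Q.coeff α| = ‖c ⟨α, (hA α).2 hα⟩‖ := rfl
      _ ≤ ‖c‖ := norm_le_pi_norm c _
      _ ≤ K * B := h1.trans (by gcongr)
  · rw [hQ.coeff_eq_zero hα, abs_zero]
    positivity

/-- The coefficients of a homogeneous polynomial are bounded by its values at the barycentric
coordinates of the points of a simplex. -/
lemma exists_coeff_bound (τ : Type*) (N m : ℕ) : ∃ C > 0, ∀ s : Finset τ, s.card = N + 1 →
    ∀ Q : MvPolynomial τ ℝ, Q.IsHomogeneous m → ∀ B : ℝ, 0 ≤ B →
    (∀ w : τ → ℝ, (∀ z, z ∉ s → w z = 0) → (∀ z, 0 ≤ w z) → ∑ z ∈ s, w z = 1 →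
      |MvPolynomial.eval w Q| ≤ B) →
    ∀ α : τ →₀ ℕ, α.support ⊆ s → |MvPolynomial.coeff α Q| ≤ C * B := by
  classical
  obtain ⟨C, hC, H⟩ := exists_coeff_bound_stdSimplex N m
  refine ⟨C, hC, fun s hs Q hQ B hB hw α hα => ?_⟩
  let e : Fin (N + 1) ≃ s := (s.equivFinOfCardEq hs).symm
  let f : Fin (N + 1) → τ := fun i => (e i).1
  have hf : Function.Injective f := Subtype.val_injective.comp e.injective
  have hrange : ∀ z, z ∈ s ↔ z ∈ Set.range f := fun z =>
    ⟨fun hz => ⟨e.symm ⟨z, hz⟩, by simp [f]⟩, by rintro ⟨i, rfl⟩; exact (e i).2⟩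
  have h1 := H _ (isHomogeneous_killCompl hf hQ) B hB (fun u hu => by
    rw [eval_killCompl]
    refine hw _ (fun z hz => ?_) (fun z => ?_) ?_
    · exact Function.extend_apply' _ _ _ fun h => hz ((hrange z).2 h)
    · by_cases hz : z ∈ Set.range f
      · obtain ⟨i, rfl⟩ := hz
        rw [hf.extend_apply]
        exact hu.1 i
      · rw [Function.extend_apply' _ _ _ hz]
        rfl
    · rw [← hu.2, ← Finset.sum_coe_sort s, ← e.sum_comp]
      exact Finset.sum_congr rfl fun i _ => hf.extend_apply _ _ i) (α.comapDomain f hf.injOn)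
  rwa [MvPolynomial.coeff_killCompl, Finsupp.mapDomain_comapDomain f hf α
    fun z hz => (hrange z).1 (hα hz)] at h1

lemma eval_eq_sum_finsuppAntidiag {τ : Type*} [DecidableEq τ] {Q : MvPolynomial τ ℝ} {m : ℕ}
    (hQ : Q.IsHomogeneous m) {s : Finset τ} {w : τ → ℝ} (hw : ∀ z, z ∉ s → w z = 0) :
    MvPolynomial.eval w Q =
      ∑ α ∈ s.finsuppAntidiag m, Q.coeff α * ∏ z ∈ α.support, w z ^ α z := by
  rw [MvPolynomial.eval_eq]
  have h1 : ∀ α ∈ Q.support, α ∉ s.finsuppAntidiag m →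
      Q.coeff α * ∏ z ∈ α.support, w z ^ α z = 0 := by
    intro α hα hαs
    have h2 : ∑ z ∈ α.support, α z = m := (hQ.degree_eq_sum_deg_support hα).symm
    have h3 : ¬ α.support ⊆ s := fun h => hαs (by
      rw [Finset.mem_finsuppAntidiag]
      refine ⟨?_, h⟩
      rw [← h2]
      exact (Finset.sum_subset h fun z _ hz => Finsupp.notMem_support_iff.1 hz).symm)
    obtain ⟨z, hz, hzs⟩ := Finset.not_subset.1 h3
    rw [Finset.prod_eq_zero hz, mul_zero]
    rw [hw z hzs, zero_pow (Finsupp.mem_support_iff.1 hz)]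
  rw [← Finset.sum_subset (Finset.inter_subset_left (s₂ := s.finsuppAntidiag m))
    fun α hα hα' => h1 α hα fun h => hα' (Finset.mem_inter.2 ⟨hα, h⟩)]
  refine Finset.sum_subset Finset.inter_subset_right fun α hα hα' => ?_
  rw [MvPolynomial.notMem_support_iff.1 fun h => hα' (Finset.mem_inter.2 ⟨h, hα⟩), zero_mul]

/-- A polynomial of degree at most `m` is a homogeneous polynomial of degree `m` in the barycentric
coordinates. -/
lemma IsPolyFun.exists_homogenization {d m : ℕ} {P : E d → ℝ} (hP : IsPolyFun m P)
    (s : Finset (E d)) : ∃ Q : MvPolynomial (E d) ℝ, Q.IsHomogeneous m ∧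
      ∀ w : E d → ℝ, ∑ z ∈ s, w z = 1 → MvPolynomial.eval w Q = P (∑ z ∈ s, w z • z) := by
  obtain ⟨p, hp, hpP⟩ := hP
  -- Substitute the barycentric expression for each coordinate and fill up every monomial to degree
  -- `m` with powers of the sum of the weights, which equals `1`.
  refine ⟨∑ α ∈ p.support, MvPolynomial.C (p.coeff α) *
    ((∏ j ∈ α.support, (∑ z ∈ s, MvPolynomial.C (z j) * MvPolynomial.X z) ^ α j) *
      (∑ z ∈ s, MvPolynomial.X z) ^ (m - ∑ j ∈ α.support, α j)), ?_, ?_⟩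
  · refine MvPolynomial.IsHomogeneous.sum _ _ _ fun α hα => MvPolynomial.IsHomogeneous.C_mul ?_ _
    have h1 : ∑ j ∈ α.support, α j ≤ m :=
      (MvPolynomial.le_totalDegree hα).trans hp
    have h2 := (MvPolynomial.IsHomogeneous.prod α.support
      (fun j => (∑ z ∈ s, MvPolynomial.C (z j) * MvPolynomial.X z) ^ α j) (fun j => α j)
      fun j _ => by
        have := (MvPolynomial.IsHomogeneous.sum s
          (fun z : E d => MvPolynomial.C (z j) * MvPolynomial.X z) 1
          fun z _ => MvPolynomial.isHomogeneous_C_mul_X _ _).pow (α j)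
        rwa [one_mul] at this).mul ((MvPolynomial.IsHomogeneous.sum s
          (fun z : E d => (MvPolynomial.X z : MvPolynomial (E d) ℝ)) 1
          fun z _ => MvPolynomial.isHomogeneous_X _ _).pow (m - ∑ j ∈ α.support, α j))
    rwa [one_mul, Nat.add_sub_cancel' h1] at h2
  · intro w hw
    rw [hpP, MvPolynomial.eval_eq _ p]
    simp only [map_sum, map_mul, map_prod, map_pow, MvPolynomial.eval_C, MvPolynomial.eval_X, hw,
      one_pow, mul_one]
    refine Finset.sum_congr rfl fun α _ => ?_
    congr 1
    refine Finset.prod_congr rfl fun j _ => ?_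
    congr 1
    simp [mul_comm]

/-! ### Extension of piecewise polynomials from a part of the mesh -/

/-- Coefficients of the homogenised pieces depend only on the face spanned by their exponents, so
they glue to one polynomial in the nodal functions; missing coefficients are zero. Degree `m ≠ 0`
ensures that each monomial involves a vertex: a coefficient active on an element then comes from a
piece sharing that vertex, which keeps the bound local. -/
lemma exists_scalar_extension (d : ℕ) {m : ℕ} (hm : m ≠ 0) : ∃ C > 0,
    ∀ 𝒦 : Geometry.SimplicialComplex ℝ (E d), 𝒦.faces.Finite → ∀ 𝒮 ⊆ simplices 𝒦,
    ∀ f : E d → ℝ,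
    (∀ s ∈ 𝒮, ∃ P, IsPolyFun m P ∧ Set.EqOn f P (convexHull ℝ (s : Set (E d)))) →
    ∃ g : E d → ℝ,
      (∀ s ∈ simplices 𝒦, ∃ P, IsPolyFun m P ∧ Set.EqOn g P (convexHull ℝ (s : Set (E d)))) ∧
      (∀ s ∈ 𝒮, Set.EqOn g f (convexHull ℝ (s : Set (E d)))) ∧
      ∀ s ∈ simplices 𝒦, ∀ B : ℝ, 0 ≤ B →
        (∀ s' ∈ 𝒮, (convexHull ℝ (s' : Set (E d)) ∩ convexHull ℝ (s : Set (E d))).Nonempty →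
          ∀ x ∈ convexHull ℝ (s' : Set (E d)), |f x| ≤ B) →
        ∀ x ∈ convexHull ℝ (s : Set (E d)), |g x| ≤ C * B := by
  classical
  obtain ⟨C, hC, HC⟩ := exists_coeff_bound (E d) d m
  refine ⟨((d + 1 + m - 1).choose m + 1) * C, by positivity, fun 𝒦 hfin 𝒮 h𝒮 f hf => ?_⟩
  have hQ : ∀ s : Finset (E d), ∃ Q : MvPolynomial (E d) ℝ, s ∈ 𝒮 → Q.IsHomogeneous m ∧
      ∀ x w, IsBaryOn s x w → MvPolynomial.eval w Q = f x := by
    intro s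
    by_cases hs : s ∈ 𝒮
    · obtain ⟨P, hP, hfP⟩ := hf s hs
      obtain ⟨Q, hQ, hQP⟩ := hP.exists_homogenization s
      refine ⟨Q, fun _ => ⟨hQ, fun x w hw => ?_⟩⟩
      rw [hQP w hw.2.2.1, hw.2.2.2, hfP hw.mem_convexHull]
    · exact ⟨0, fun h => (hs h).elim⟩
  choose Q hQ using hQ
  -- Both homogenisations represent `f` on the common face spanned by the exponent, so the
  -- coefficient bound applied to their difference with `B = 0` gives equality.
  have hagree : ∀ s ∈ 𝒮, ∀ s' ∈ 𝒮, ∀ α : E d →₀ ℕ, α.support ⊆ s → α.support ⊆ s' →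
      α.support.Nonempty → (Q s).coeff α = (Q s').coeff α := by
    intro s hs s' hs' α hαs hαs' hne
    obtain ⟨C', -, H⟩ := exists_coeff_bound (E d) (α.support.card - 1) m
    have h1 := H α.support (by have := hne.card_pos; omega) (Q s - Q s')
      ((hQ s hs).1.sub (hQ s' hs').1) 0 le_rfl (fun w hw0 hw hw1 => by
        have hb : IsBaryOn α.support (∑ z ∈ α.support, w z • z) w := ⟨hw0, hw, hw1, rfl⟩
        rw [map_sub, (hQ s hs).2 _ w (hb.mono hαs), (hQ s' hs').2 _ w (hb.mono hαs'), sub_self,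
          abs_zero]) α subset_rfl
    rw [mul_zero, MvPolynomial.coeff_sub] at h1
    exact sub_eq_zero.1 (abs_nonpos_iff.1 h1)
  let c : (E d →₀ ℕ) → ℝ := fun α =>
    if h : ∃ s ∈ 𝒮, α.support ⊆ s then (Q h.choose).coeff α else 0
  have hc : ∀ s ∈ 𝒮, ∀ α : E d →₀ ℕ, α.support ⊆ s → α.support.Nonempty →
      c α = (Q s).coeff α := by
    intro s hs α hα hne
    have h : ∃ s ∈ 𝒮, α.support ⊆ s := ⟨s, hs, hα⟩
    have h1 : c α = (Q h.choose).coeff α := dif_pos h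
    rw [h1]
    exact hagree _ h.choose_spec.1 s hs α h.choose_spec.2 hα hne
  have hc0 : ∀ α : E d →₀ ℕ, (¬ ∃ s ∈ 𝒮, α.support ⊆ s) → c α = 0 := fun α h => dif_neg h
  let V : Finset (E d) := hfin.toFinset.biUnion id
  have hV : ∀ s ∈ 𝒦.faces, s ⊆ V := fun s hs =>
    Finset.subset_biUnion_of_mem id (hfin.mem_toFinset.2 hs)
  have hdeg : ∀ (s : Finset (E d)) (α : E d →₀ ℕ), α ∈ s.finsuppAntidiag m ↔
      α.degree = m ∧ α.support ⊆ s := fun s α => by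
    rw [Finset.mem_finsuppAntidiag']
    rfl
  let q : MvPolynomial (E d) ℝ := ∑ α ∈ V.finsuppAntidiag m, MvPolynomial.monomial α (c α)
  have hqh : q.IsHomogeneous m := MvPolynomial.IsHomogeneous.sum _ _ _ fun α hα =>
    MvPolynomial.isHomogeneous_monomial _ ((hdeg V α).1 hα).1
  have hqc : ∀ α ∈ V.finsuppAntidiag m, q.coeff α = c α := fun α hα => by
    simp only [q, MvPolynomial.coeff_sum, MvPolynomial.coeff_monomial]
    rw [Finset.sum_eq_single α (fun β _ hβ => if_neg hβ) fun h => (h hα).elim, if_pos rfl]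
  have hqs : ∀ s ∈ simplices 𝒦, ∀ α ∈ s.finsuppAntidiag m, q.coeff α = c α := fun s hs α hα =>
    hqc α ((hdeg V α).2 ⟨((hdeg s α).1 hα).1, ((hdeg s α).1 hα).2.trans (hV s hs.1)⟩)
  have hne : ∀ (s : Finset (E d)), ∀ α ∈ s.finsuppAntidiag m, α.support.Nonempty := by
    intro s α hα
    rw [Finset.nonempty_iff_ne_empty]
    intro h
    rw [Finsupp.support_eq_empty] at h
    rw [hdeg, h, map_zero] at hα
    exact hm hα.1.symm
  refine ⟨fun x => MvPolynomial.eval (hat 𝒦 x) q, fun s hs => ?_, fun s hs x hx => ?_,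
    fun s hs B hB hfB x hx => ?_⟩
  · choose a ha _ using fun z => exists_affineMap_eq_hat hs z
    refine ⟨fun x => MvPolynomial.eval (fun z => a z x) q,
      (IsPolyFun.eval q fun _ _ z _ => AffineMap.isPolyFun (a z)).mono hqh.totalDegree_le,
      fun x hx => ?_⟩
    simp only
    congr 2
    funext z
    exact ha z x hx
  · have hb := isBaryOn_hat (h𝒮 hs).1 hx
    rw [← (hQ s hs).2 x _ hb, eval_eq_sum_finsuppAntidiag (hQ s hs).1 hb.1]
    dsimp only
    rw [eval_eq_sum_finsuppAntidiag hqh hb.1]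
    refine Finset.sum_congr rfl fun α hα => ?_
    rw [hqs s (h𝒮 hs) α hα, hc s hs α ((hdeg s α).1 hα).2 (hne s α hα)]
  · have hb := isBaryOn_hat hs.1 hx
    dsimp only
    rw [eval_eq_sum_finsuppAntidiag hqh hb.1]
    have h1 : ∀ α ∈ s.finsuppAntidiag m,
        |q.coeff α * ∏ z ∈ α.support, hat 𝒦 x z ^ α z| ≤ C * B := by
      intro α hα
      rw [hqs s hs α hα, abs_mul]
      have h2 : |∏ z ∈ α.support, hat 𝒦 x z ^ α z| ≤ 1 := by
        rw [Finset.abs_prod]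
        refine Finset.prod_le_one (fun _ _ => abs_nonneg _) fun z _ => ?_
        rw [abs_of_nonneg (pow_nonneg (hb.2.1 z) _)]
        exact pow_le_one₀ (hb.2.1 z) (hb.le_one z)
      refine (mul_le_of_le_one_right (abs_nonneg _) h2).trans ?_
      -- A coefficient from a piece `s'` is bounded by `f` there, and a vertex of the exponent lies
      -- in both `s'` and `s`.
      by_cases h : ∃ s' ∈ 𝒮, α.support ⊆ s'
      · obtain ⟨s', hs', hα'⟩ := h
        rw [hc s' hs' α hα' (hne s α hα)]
        obtain ⟨z, hz⟩ := hne s α hα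
        refine HC s' (h𝒮 hs').2 (Q s') (hQ s' hs').1 B hB (fun w hw0 hw hw1 => ?_) α hα'
        have hb' : IsBaryOn s' (∑ z ∈ s', w z • z) w := ⟨hw0, hw, hw1, rfl⟩
        rw [(hQ s' hs').2 _ w hb']
        exact hfB s' hs' ⟨z, subset_convexHull ℝ _ (hα' hz),
          subset_convexHull ℝ _ (((hdeg s α).1 hα).2 hz)⟩ _ hb'.mem_convexHull
      · rw [hc0 α h, abs_zero]
        positivity
    calc |∑ α ∈ s.finsuppAntidiag m, q.coeff α * ∏ z ∈ α.support, hat 𝒦 x z ^ α z|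
        ≤ ∑ α ∈ s.finsuppAntidiag m, |q.coeff α * ∏ z ∈ α.support, hat 𝒦 x z ^ α z| :=
          Finset.abs_sum_le_sum_abs _ _
      _ ≤ ∑ α ∈ s.finsuppAntidiag m, C * B := Finset.sum_le_sum h1
      _ = ((d + 1 + m - 1).choose m) * (C * B) := by
          rw [Finset.sum_const, Finset.card_finsuppAntidiag_nat_eq_choose, hs.2, nsmul_eq_mul]
      _ ≤ ((d + 1 + m - 1).choose m + 1) * C * B := by
          have : 0 ≤ C * B := by positivity
          nlinarith

lemma IsPolyMap.isPolyOn {d m : ℕ} {T : Set (E d)} {v P : E d → E d} (hP : IsPolyMap m P)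
    (h : Set.EqOn v P T) : IsPolyOn m T v := by
  choose p hp hpP using hP
  exact ⟨p, hp, fun x hx i => by rw [h hx]; exact hpP i x⟩

lemma gradSq_le {d : ℕ} (v : E d → E d) (x : E d) : gradSq v x ≤ d * ‖fderiv ℝ v x‖ ^ 2 := by
  refine (Finset.sum_le_card_nsmul _ _ (‖fderiv ℝ v x‖ ^ 2) fun j _ => ?_).trans_eq (by simp)
  refine pow_le_pow_left₀ (norm_nonneg _) (((fderiv ℝ v x).le_opNorm _).trans_eq ?_) 2
  simp

lemma gradSq_nonneg {d : ℕ} (v : E d → E d) (x : E d) : 0 ≤ gradSq v x :=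
  Finset.sum_nonneg fun _ _ => sq_nonneg _

section

variable {d m : ℕ} {𝒦 : Geometry.SimplicialComplex ℝ (E d)} {T : Set (E d)} {v P : E d → E d}

lemma integrableOn_gradSq (hT : T ∈ elements 𝒦) (hP : IsPolyMap m P) (h : Set.EqOn v P T) :
    IntegrableOn (gradSq v) T := by
  have hcf := hP.contDiff.continuous_fderiv (by simp)
  have h1 : IntegrableOn (gradSq P) T :=
    (continuous_finsetSum _ fun j _ => ((hcf.clm_apply continuous_const).norm.pow
      2)).continuousOn.integrableOn_compact (isCompact_of_mem_elements hT)
  refine h1.congr ?_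
  filter_upwards [ae_fderiv_eq hT h] with x hx
  simp only [gradSq, hx]

lemma setIntegral_gradSq_le (hT : T ∈ elements 𝒦) (hP : IsPolyMap m P) (h : Set.EqOn v P T) :
    ∫ x in T, gradSq v x ≤ d * ∫ x in T, ‖fderiv ℝ P x‖ ^ 2 := by
  have hcf := hP.contDiff.continuous_fderiv (by simp)
  rw [← integral_const_mul]
  refine integral_mono_ae (integrableOn_gradSq hT hP h) (((hcf.norm.pow
    2).continuousOn.integrableOn_compact (isCompact_of_mem_elements hT)).const_mul _) ?_
  filter_upwards [ae_fderiv_eq hT h] with x hx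
  rw [← hx]
  exact gradSq_le v x

end

lemma setIntegral_norm_sq_congr {d : ℕ} {𝒦 : Geometry.SimplicialComplex ℝ (E d)} {T : Set (E d)}
    (hT : T ∈ elements 𝒦) {v P : E d → E d} (h : Set.EqOn v P T) :
    ∫ x in T, ‖v x‖ ^ 2 = ∫ x in T, ‖P x‖ ^ 2 :=
  setIntegral_congr_fun (isCompact_of_mem_elements hT).measurableSet fun x hx => by
    simp only [h hx]

/-- Extension of finite element functions of positive degree to the whole mesh. -/
lemma exists_extension (d : ℕ) {m : ℕ} (hm : m ≠ 0) {κ : ℝ} (hκ : 0 < κ) : ∃ C : ℝ, 0 ≤ C ∧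
    ∀ (𝒦 : Geometry.SimplicialComplex ℝ (E d)) (h : ℝ), 0 < h → GoodMesh 𝒦 h (κ * h) →
    ∀ I : Finset (Set (E d)), (∀ T ∈ I, T ∈ elements 𝒦) → ∀ μ : E d → E d,
    (∀ T ∈ I, IsPolyOn m T μ) →
    ∃ (v : E d → E d) (V : Set (E d) → E d → E d),
      (∀ T ∈ elements 𝒦, IsPolyMap m (V T) ∧ Set.EqOn v (V T) T) ∧
      (∀ T ∈ I, Set.EqOn v μ T) ∧
      ∀ L : Finset (Set (E d)), (∀ T ∈ L, T ∈ elements 𝒦) →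
        h ^ 2 * ∑ T ∈ L, ∫ x in T, gradSq v x ≤ C * ∑ K ∈ I, ∫ x in K, ‖μ x‖ ^ 2 := by
  classical
  obtain ⟨C₀, hC₀, Hext⟩ := exists_scalar_extension d hm
  obtain ⟨Ci, hCi, Hinv⟩ := exists_inverse_estimates d m hκ
  set v₁ := volume.real (Metric.closedBall (0 : E d) 1) with hv₁
  have hv₁0 : 0 ≤ v₁ := measureReal_nonneg
  set C₁ := d * (C₀ ^ 2 * Ci) * v₁ with hC₁
  have hC₁0 : 0 ≤ C₁ := by positivity
  refine ⟨d * (Ci * C₁) * (2 / κ) ^ d, by positivity, ?_⟩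
  intro 𝒦 h hh hmesh I hI μ hμ
  choose! P hP hμP using fun T hT => (hμ T hT).exists_polyMap
  set 𝒮 : Set (Finset (E d)) := {s | s ∈ simplices 𝒦 ∧ convexHull ℝ (s : Set (E d)) ∈ I} with h𝒮
  choose g hg hgμ hgB using fun i : Fin d => Hext 𝒦 hmesh.finite 𝒮 (fun _ hs => hs.1)
    (fun x => μ x i) fun s hs => ⟨fun x => P _ x i, hP _ hs.2 i, fun x hx => by
      simp only [hμP _ hs.2 hx]⟩
  set v : E d → E d := fun x => WithLp.toLp 2 fun i => g i x with hv
  have hV : ∀ T : Set (E d), ∃ F : E d → E d, T ∈ elements 𝒦 → IsPolyMap m F ∧ Set.EqOn v F T := by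
    intro T
    by_cases hT : T ∈ elements 𝒦
    · obtain ⟨s, hs, rfl⟩ := mem_elements_iff.1 hT
      choose p hp hgp using fun i => hg i s hs
      exact ⟨fun x => WithLp.toLp 2 fun i => p i x, fun _ => ⟨fun i => hp i, fun x hx => by
        ext i
        exact hgp i hx⟩⟩
    · exact ⟨0, fun h => (hT h).elim⟩
  choose V hV using hV
  have hball : ∀ T ∈ elements 𝒦, ∃ y ∈ T, Metric.closedBall y (κ * h) ⊆ T ∧
      T ⊆ Metric.closedBall y h := by
    intro T hT
    obtain ⟨y, hy⟩ := hmesh.inball T hT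
    have hyT := hy (Metric.mem_closedBall_self (by positivity))
    exact ⟨y, hyT, hy, hmesh.subset_closedBall hT hyT⟩
  refine ⟨v, V, hV, fun T hT x hx => ?_, fun L hL => ?_⟩
  · obtain ⟨s, hs, rfl⟩ := mem_elements_iff.1 (hI T hT)
    ext i
    exact hgμ i s ⟨hs, hT⟩ hx
  set X : Set (E d) → ℝ := fun K => ∫ x in K, ‖μ x‖ ^ 2 with hX
  have hX0 : ∀ K, 0 ≤ X K := fun K => integral_nonneg fun _ => sq_nonneg _
  have hpt : ∀ K ∈ I, ∀ x ∈ K, h ^ d * ‖μ x‖ ^ 2 ≤ Ci * X K := by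
    intro K hK x hx
    obtain ⟨y, -, hy1, hy2⟩ := hball K (hI K hK)
    have h1 := (Hinv h hh K y (isCompact_of_mem_elements (hI K hK)) hy1 hy2 (P K) (hP K hK)).1 x hx
    rwa [← hμP K hK hx, ← setIntegral_norm_sq_congr (hI K hK) (hμP K hK)] at h1
  have hloc : ∀ T ∈ elements 𝒦, h ^ 2 * ∫ x in T, gradSq v x ≤
      d * (Ci * C₁) * ∑ K ∈ I.filter (fun K => (K ∩ T).Nonempty), X K := by
    intro T hT
    set S := ∑ K ∈ I.filter (fun K => (K ∩ T).Nonempty), X K with hS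
    have hS0 : 0 ≤ S := Finset.sum_nonneg fun K _ => hX0 K
    -- By the inverse estimate from L² to the maximum norm, `B` bounds `μ` on every element of `I`
    -- touching `T`.
    set B := Real.sqrt (Ci * S / h ^ d) with hB
    have hB2 : B ^ 2 = Ci * S / h ^ d := Real.sq_sqrt (by positivity)
    have hμB : ∀ K ∈ I, (K ∩ T).Nonempty → ∀ x ∈ K, ‖μ x‖ ≤ B := by
      intro K hK hKT x hx
      refine Real.le_sqrt_of_sq_le ?_
      rw [le_div_iff₀ (by positivity), mul_comm]
      refine (hpt K hK x hx).trans (mul_le_mul_of_nonneg_left ?_ hCi.le)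
      exact Finset.single_le_sum (fun K _ => hX0 K) (Finset.mem_filter.2 ⟨hK, hKT⟩)
    have hvB : ∀ x ∈ T, ‖v x‖ ^ 2 ≤ d * (C₀ * B) ^ 2 := by
      intro x hx
      rw [EuclideanSpace.norm_sq_eq]
      refine (Finset.sum_le_card_nsmul _ _ ((C₀ * B) ^ 2) fun i _ => ?_).trans_eq (by simp)
      obtain ⟨s, hs, rfl⟩ := mem_elements_iff.1 hT
      refine pow_le_pow_left₀ (norm_nonneg _) (hgB i s hs B (Real.sqrt_nonneg _) ?_ x hx) 2
      intro s' hs' hne y hy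
      exact (PiLp.norm_apply_le (μ y) i).trans (hμB _ hs'.2 hne y hy)
    obtain ⟨y, -, hy1, hy2⟩ := hball T hT
    have hvol : volume.real T ≤ h ^ d * v₁ := by
      refine (measureReal_mono hy2 measure_closedBall_lt_top.ne).trans_eq ?_
      rw [Measure.real, Measure.addHaar_closedBall volume y hh.le, ENNReal.toReal_mul,
        ENNReal.toReal_ofReal (by positivity), finrank_euclideanSpace_fin, hv₁, Measure.real,
        Measure.addHaar_closedBall volume 0 zero_le_one]
      simp
    have hint : ∫ x in T, ‖v x‖ ^ 2 ≤ C₁ * S := by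
      have h1 := norm_setIntegral_le_of_norm_le_const (μ := volume) (f := fun x => ‖v x‖ ^ 2)
        (isCompact_of_mem_elements hT).measure_lt_top (C := d * (C₀ * B) ^ 2) fun x hx => by
          rw [Real.norm_of_nonneg (sq_nonneg _)]
          exact hvB x hx
      refine (le_abs_self _).trans (h1.trans ?_)
      calc d * (C₀ * B) ^ 2 * volume.real T ≤ d * (C₀ * B) ^ 2 * (h ^ d * v₁) := by gcongr
        _ = d * (C₀ ^ 2 * (Ci * S / h ^ d)) * (h ^ d * v₁) := by rw [← hB2]; ring
        _ = C₁ * S := by rw [hC₁]; field_simp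
    have h2 := (Hinv h hh T y (isCompact_of_mem_elements hT) hy1 hy2 (V T) (hV T hT).1).2.2
    rw [← setIntegral_norm_sq_congr hT (hV T hT).2] at h2
    calc h ^ 2 * ∫ x in T, gradSq v x
        ≤ h ^ 2 * (d * ∫ x in T, ‖fderiv ℝ (V T) x‖ ^ 2) := by
          gcongr
          exact setIntegral_gradSq_le hT (hV T hT).1 (hV T hT).2
      _ = d * (h ^ 2 * ∫ x in T, ‖fderiv ℝ (V T) x‖ ^ 2) := by ring
      _ ≤ d * (Ci * (C₁ * S)) := by
          exact mul_le_mul_of_nonneg_left (h2.trans (by gcongr)) (Nat.cast_nonneg d)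
      _ = _ := by ring
  -- All elements touching `K` fit in a ball of radius `2 h`, so `K` is used only boundedly often.
  have h3 : ∀ K ∈ I, ((L.filter fun T => (K ∩ T).Nonempty).card : ℝ) ≤ (2 / κ) ^ d := by
    intro K hK
    obtain ⟨y, hyK, -⟩ := hball K (hI K hK)
    refine (hmesh.card_le (fun T hT => hL T (Finset.mem_filter.1 hT).1) (x := y) (R := 2 * h)
      (by positivity) fun T hT => ?_).trans_eq ?_
    · obtain ⟨hTL, z, hzK, hzT⟩ := Finset.mem_filter.1 hT
      refine (hmesh.subset_closedBall (hL T hTL) hzT).trans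
        (Metric.closedBall_subset_closedBall' ?_)
      have := Metric.mem_closedBall.1 (hmesh.subset_closedBall (hI K hK) hyK hzK)
      linarith
    · congr 1
      field_simp
  have h4 := sum_sum_filter_le (R := fun T K => (K ∩ T).Nonempty) (fun K _ => hX0 K) h3
  calc h ^ 2 * ∑ T ∈ L, ∫ x in T, gradSq v x
      ≤ ∑ T ∈ L, d * (Ci * C₁) * ∑ K ∈ I.filter (fun K => (K ∩ T).Nonempty), X K := by
        rw [Finset.mul_sum]
        exact Finset.sum_le_sum fun T hT => hloc T (hL T hT)
    _ = d * (Ci * C₁) * ∑ T ∈ L, ∑ K ∈ I.filter (fun K => (K ∩ T).Nonempty), X K := by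
        rw [Finset.mul_sum]
    _ ≤ d * (Ci * C₁) * ((2 / κ) ^ d * ∑ K ∈ I, X K) :=
        mul_le_mul_of_nonneg_left h4 (by positivity)
    _ = _ := by ring

/-! ### The inf-sup condition -/

namespace Setting

variable {n : ℕ} {bg : Set (E (n + 1))} {σ q c M ρ h : ℝ}
  {𝒦 : Geometry.SimplicialComplex ℝ (E (n + 1))} {φ : E (n + 1) → ℝ} {δ : ℝ}

/-- A point of Γ away from the closure of the bulk would be a local minimum of `φ`, contradicting
`∇φ ≠ 0`. Hence elements meeting Γ are active even for `δ = 0`. -/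
lemma infDist_bulk_eq_zero (S : Setting bg σ q c M ρ h 𝒦 φ) {x : E (n + 1)}
    (hx : x ∈ interface bg φ) : Metric.infDist x (bulk bg φ) = 0 := by
  refine Metric.infDist_zero_of_mem_closure ?_
  by_contra hcl
  have h1 : IsLocalMin φ x := by
    filter_upwards [S.isOpen.mem_nhds hx.1, isClosed_closure.isOpen_compl.mem_nhds hcl] with y hy hy'
    rw [hx.2]
    by_contra hlt
    exact hy' (subset_closure ⟨hy, not_le.1 hlt⟩)
  have h2 := S.levelSet.regular x hx
  rw [gradient, h1.fderiv_eq_zero, map_zero, norm_zero] at h2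
  exact absurd S.c_pos (not_lt.2 h2)

lemma interface_subset_sUnion_activeMesh (S : Setting bg σ q c M ρ h 𝒦 φ) (hδ : 0 ≤ δ) :
    interface bg φ ⊆ ⋃₀ activeMesh bg φ δ 𝒦 := by
  intro x hx
  obtain ⟨T, hT, hxT⟩ : x ∈ ⋃₀ elements 𝒦 := by
    rw [S.mesh.covers]
    exact subset_closure hx.1
  exact ⟨T, ⟨hT, x, hxT, (S.infDist_bulk_eq_zero hx).trans_le hδ⟩, hxT⟩

lemma isCompact_interface (S : Setting bg σ q c M ρ h 𝒦 φ) : IsCompact (interface bg φ) :=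
  S.levelSet.isCompact_interface S.isOpen S.bounded S.ρ_pos

lemma velocityNorm_sq (S : Setting bg σ q c M ρ h 𝒦 φ) (v : E (n + 1) → E (n + 1)) :
    velocityNorm bg φ δ h 𝒦 v ^ 2 = (∫ x in ⋃₀ activeMesh bg φ δ 𝒦, gradSq v x) +
      h⁻¹ * ∫ x in interface bg φ, ‖v x‖ ^ 2 ∂(μHE[n] : Measure (E (n + 1))) :=
  Real.sq_sqrt (add_nonneg (integral_nonneg fun _ => gradSq_nonneg _ _)
    (mul_nonneg (inv_nonneg.2 S.h_pos.le) (integral_nonneg fun _ => sq_nonneg _)))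

/-- Every quotient is bounded. -/
lemma quotient_le (S : Setting bg σ q c M ρ h 𝒦 φ) (hδ : 0 ≤ δ) {m k : ℕ}
    {μ v : E (n + 1) → E (n + 1)} (hμ : μ ∈ feSpace m (interfaceMesh bg φ 𝒦))
    (hv : v ∈ velocitySpace bg φ δ k 𝒦) (hv0 : velocityNorm bg φ δ h 𝒦 v ≠ 0) :
    formB bg φ μ v / velocityNorm bg φ δ h 𝒦 v ≤
      ((∫ x in interface bg φ, ‖μ x‖ ^ 2 ∂(μHE[n] : Measure (E (n + 1)))) + h) / 2 := by
  have hh := S.h_pos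
  set w := velocityNorm bg φ δ h 𝒦 v with hw
  have hwpos : 0 < w := lt_of_le_of_ne (Real.sqrt_nonneg _) hv0.symm
  set G := ∫ x in interface bg φ, ‖μ x‖ ^ 2 ∂(μHE[n] : Measure (E (n + 1))) with hG
  set W := ∫ x in interface bg φ, ‖v x‖ ^ 2 ∂(μHE[n] : Measure (E (n + 1))) with hW
  have hG0 : 0 ≤ G := integral_nonneg fun _ => sq_nonneg _
  have hW0 : 0 ≤ W := integral_nonneg fun _ => sq_nonneg _
  have hμi := S.integrableOn_interface_sq hμ.1
  have hvi : IntegrableOn (fun x => ‖v x‖ ^ 2) (interface bg φ)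
      (μHE[n] : Measure (E (n + 1))) := by
    have h1 : ContinuousOn (fun x => ‖v x‖ ^ 2) (interface bg φ) :=
      (hv.1.mono (S.interface_subset_sUnion_activeMesh hδ)).norm.pow 2
    exact h1.integrableOn_of_subset_isCompact S.isCompact_interface
      S.isCompact_interface.measurableSet subset_rfl
      (S.levelSet.measure_interface_lt_top S.isOpen S.bounded S.c_pos S.ρ_pos).ne
  have hWw : W ≤ h * w ^ 2 := by
    have h1 : h⁻¹ * W ≤ w ^ 2 := by
      rw [hw, S.velocityNorm_sq]
      exact le_add_of_nonneg_left (integral_nonneg fun _ => gradSq_nonneg _ _)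
    rwa [inv_mul_le_iff₀ hh] at h1
  -- Young's inequality with weight `w`; the resulting bound is only meant to show finiteness. A
  -- nonintegrable integrand would have integral zero by convention.
  have hb : formB bg φ μ v ≤ w / 2 * G + w⁻¹ / 2 * W := by
    by_cases hint : IntegrableOn (fun x => inner ℝ (μ x) (v x)) (interface bg φ)
        (μHE[n] : Measure (E (n + 1)))
    · rw [hG, hW, ← integral_const_mul, ← integral_const_mul,
        ← integral_add (hμi.const_mul _) (hvi.const_mul _)]
      refine integral_mono hint ((hμi.const_mul _).add (hvi.const_mul _)) fun x => ?_
      have h1 := real_inner_le_norm (μ x) (v x)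
      have h2 : 0 ≤ w⁻¹ / 2 * (w * ‖μ x‖ - ‖v x‖) ^ 2 := by positivity
      have h3 : w⁻¹ / 2 * (w * ‖μ x‖ - ‖v x‖) ^ 2 =
          w / 2 * ‖μ x‖ ^ 2 + w⁻¹ / 2 * ‖v x‖ ^ 2 - ‖μ x‖ * ‖v x‖ := by
        field_simp
        ring
      dsimp only
      linarith
    · have h1 : formB bg φ μ v = 0 := integral_undef hint
      rw [h1]
      positivity
  rw [div_le_iff₀ hwpos]
  calc formB bg φ μ v ≤ w / 2 * G + w⁻¹ / 2 * (h * w ^ 2) := hb.trans (by gcongr)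
    _ = (G + h) / 2 * w := by field_simp

lemma bddAbove_infSupQuotients (S : Setting bg σ q c M ρ h 𝒦 φ) (hδ : 0 ≤ δ) {m k : ℕ}
    {μ : E (n + 1) → E (n + 1)} (hμ : μ ∈ feSpace m (interfaceMesh bg φ 𝒦)) :
    BddAbove (infSupQuotients bg φ δ h k 𝒦 μ) := by
  refine ⟨((∫ x in interface bg φ, ‖μ x‖ ^ 2 ∂(μHE[n] : Measure (E (n + 1)))) + h) / 2, ?_⟩
  rintro r ⟨v, hv, hv0, rfl⟩
  exact S.quotient_le hδ hμ hv hv0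

lemma sSup_infSupQuotients_nonneg (S : Setting bg σ q c M ρ h 𝒦 φ) {m k : ℕ}
    {μ : E (n + 1) → E (n + 1)} (hμ : μ ∈ feSpace m (interfaceMesh bg φ 𝒦))
    (h0 : ∫ x in interface bg φ, ‖μ x‖ ^ 2 ∂(μHE[n] : Measure (E (n + 1))) = 0) :
    0 ≤ sSup (infSupQuotients bg φ δ h k 𝒦 μ) := by
  refine Real.sSup_nonneg ?_
  rintro r ⟨v, -, -, rfl⟩
  have h1 := (integral_eq_zero_iff_of_nonneg (fun _ => sq_nonneg _)
    (S.integrableOn_interface_sq hμ.1)).1 h0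
  have h2 : formB bg φ μ v = 0 := by
    refine integral_eq_zero_of_ae ?_
    filter_upwards [h1] with x hx
    have h3 : μ x = 0 := by simpa using hx
    simp [h3]
  rw [h2, zero_div]

end Setting

theorem exists_infSup (n : ℕ) {k : ℕ} (hk : 2 ≤ k) {σ q c ρ : ℝ} (hσ : 0 < σ) (hq : 0 < q)
    (hc : 0 < c) (hρ : 0 < ρ) (M : ℝ) {bg : Set (E (n + 1))} (hbg : IsOpen bg)
    (hb : Bornology.IsBounded bg) :
    ∃ β h₀ : ℝ, 0 < β ∧ 0 < h₀ ∧ ∀ h : ℝ, 0 < h → h ≤ h₀ →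
      ∀ 𝒦 : Geometry.SimplicialComplex ℝ (E (n + 1)), IsMesh bg σ q h 𝒦 →
      ∀ φ : E (n + 1) → ℝ, IsLevelSet bg c M ρ φ → ∀ δ : ℝ, 0 ≤ δ →
      ∀ μ ∈ multiplierSpace bg φ k 𝒦,
        BddAbove (infSupQuotients bg φ δ h k 𝒦 μ) ∧
        β * multiplierNorm bg φ h 𝒦 μ ≤
          sSup (infSupQuotients bg φ δ h k 𝒦 μ) + Real.sqrt (formJ bg φ h 𝒦 μ μ) := by
  obtain ⟨Cv, hCv, h₁, hh₁, Hvol⟩ := exists_volume_estimate n (k - 1) hσ hq hc M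
  obtain ⟨Ce, hCe, Hext⟩ := exists_extension (n + 1) (m := k - 1) (by omega) (mul_pos hσ hq)
  set A := Ce * Cv + 1 with hA
  have hA1 : 1 ≤ A := by rw [hA]; nlinarith [mul_nonneg hCe hCv.le]
  have hsA : 1 ≤ Real.sqrt A := Real.one_le_sqrt.2 hA1
  set b := (|M| + 1) / c with hb'
  have hbpos : 0 < b := by positivity
  refine ⟨1 / Real.sqrt A, min h₁ (min (ρ / 4) (1 / (4 * b))), by positivity,
    lt_min hh₁ (lt_min (by positivity) (by positivity)), ?_⟩
  intro h hh hh₀ 𝒦 hmesh φ hφ δ hδ μ hμ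
  have S : Setting bg σ q c M ρ h 𝒦 φ :=
    { isOpen := hbg
      bounded := hb
      σ_pos := hσ
      q_pos := hq
      c_pos := hc
      ρ_pos := hρ
      h_pos := hh
      mesh := hmesh
      levelSet := hφ
      h_lt := by
        have : h ≤ ρ / 4 := hh₀.trans ((min_le_right _ _).trans (min_le_left _ _))
        linarith
      h_lt' := by
        have : h ≤ 1 / (4 * b) := hh₀.trans ((min_le_right _ _).trans (min_le_right _ _))
        rw [le_div_iff₀ (by positivity)] at this
        rw [← hb']
        linarith }
  have hbdd := S.bddAbove_infSupQuotients (k := k) hδ hμ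
  refine ⟨hbdd, ?_⟩
  have hfin := finite_elements hmesh.finite
  set I := (hfin.subset fun T hT => hT.1 : (interfaceMesh bg φ 𝒦).Finite).toFinset with hI
  have hIm : ∀ K, K ∈ I ↔ K ∈ interfaceMesh bg φ 𝒦 := fun K => by simp [hI]
  have hIe : ∀ K ∈ I, K ∈ elements 𝒦 := fun K hK => ((hIm K).1 hK).1
  have hIc : (I : Set (Set (E (n + 1)))) = interfaceMesh bg φ 𝒦 := by simp [hI]
  set L := (hfin.subset fun T hT => hT.1 : (activeMesh bg φ δ 𝒦).Finite).toFinset with hL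
  have hLm : ∀ K, K ∈ L ↔ K ∈ activeMesh bg φ δ 𝒦 := fun K => by simp [hL]
  have hLe : ∀ K ∈ L, K ∈ elements 𝒦 := fun K hK => ((hLm K).1 hK).1
  have hLc : (L : Set (Set (E (n + 1)))) = activeMesh bg φ δ 𝒦 := by simp [hL]
  set G := ∫ x in interface bg φ, ‖μ x‖ ^ 2 ∂(μHE[n] : Measure (E (n + 1))) with hG
  set D := ∫ x in ⋃₀ interfaceMesh bg φ 𝒦, ‖normalDeriv φ μ x‖ ^ 2 with hD
  have hG0 : 0 ≤ G := integral_nonneg fun _ => sq_nonneg _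
  have hD0 : 0 ≤ D := integral_nonneg fun _ => sq_nonneg _
  have hJ : formJ bg φ h 𝒦 μ μ = h ^ 2 * D := by
    simp only [formJ, real_inner_self_eq_norm_sq, hD]
  have hY : multiplierNorm bg φ h 𝒦 μ = Real.sqrt (h * G + h ^ 2 * D) := rfl
  rw [hJ, hY]
  have hJ0 : 0 ≤ h ^ 2 * D := by positivity
  -- If the trace vanishes, the extension might have norm zero, but then `b` vanishes and the
  -- stabilisation alone is the whole norm of the multiplier; `1 / √A ≤ 1` suffices.
  rcases hG0.eq_or_lt with hG00 | hGpos
  · have h1 := S.sSup_infSupQuotients_nonneg (δ := δ) (k := k) hμ hG00.symm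
    rw [← hG00, mul_zero, zero_add]
    have h2 : 1 / Real.sqrt A * Real.sqrt (h ^ 2 * D) ≤ Real.sqrt (h ^ 2 * D) :=
      mul_le_of_le_one_left (Real.sqrt_nonneg _) ((div_le_one (by positivity)).2 hsA)
    linarith
  set Y := Real.sqrt (h * G + h ^ 2 * D) with hYdef
  have hY2 : Y ^ 2 = h * G + h ^ 2 * D := Real.sq_sqrt (by positivity)
  have hYpos : 0 < Y := Real.sqrt_pos.2 (by positivity)
  obtain ⟨v, V, hV, hvμ, hvgrad⟩ := Hext 𝒦 h hh S.goodMesh I hIe μ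
    fun T hT => hμ.2 T ((hIm T).1 hT)
  have hvint := hvgrad L hLe
  have hvol := Hvol (hh₀.trans (min_le_left _ _)) S μ hμ I hIm
  rw [← setIntegral_sUnion_elements hLe fun T hT => integrableOn_gradSq (hLe T hT) (hV T (hLe T hT)).1
    (hV T (hLe T hT)).2, hLc] at hvint
  rw [← setIntegral_sUnion_elements (g := fun x => ‖normalDeriv φ μ x‖ ^ 2) hIe fun T hT =>
    S.integrableOn_normalDeriv_sq ((hIm T).1 hT) (hμ.2 T ((hIm T).1 hT)), hIc] at hvol
  have hvspace : v ∈ velocitySpace bg φ δ k 𝒦 := by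
    refine ⟨continuousOn_sUnion_of_finite (hfin.subset fun T hT => hT.1)
      (fun T hT => (isCompact_of_mem_elements hT.1).isClosed) fun T hT => ?_, fun T hT => ?_⟩
    · exact (hV T hT.1).1.contDiff.continuous.continuousOn.congr (hV T hT.1).2
    · exact ((hV T hT.1).1.mono (Nat.sub_le k 1)).isPolyOn (hV T hT.1).2
  -- The extension equals `μ` on the interface elements, which cover Γ up to a null set.
  have hae : ∀ᵐ x ∂(μHE[n] : Measure (E (n + 1))).restrict (interface bg φ), v x = μ x := by
    rw [ae_restrict_iff' S.isCompact_interface.measurableSet]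
    have h1 := measure_interface_diff (n := n) (φ := φ) hmesh.finite hmesh.covers
    filter_upwards [compl_mem_ae_iff.2 h1] with x hx hxΓ
    obtain ⟨T, hT, hxT⟩ : x ∈ ⋃₀ interfaceMesh bg φ 𝒦 := by
      by_contra hn
      exact hx ⟨hxΓ, hn⟩
    exact hvμ T ((hIm T).2 hT) hxT
  have hvΓ : ∫ x in interface bg φ, ‖v x‖ ^ 2 ∂(μHE[n] : Measure (E (n + 1))) = G := by
    refine integral_congr_ae ?_
    filter_upwards [hae] with x hx
    rw [hx]
  have hform : formB bg φ μ v = G := by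
    refine integral_congr_ae ?_
    filter_upwards [hae] with x hx
    rw [hx, real_inner_self_eq_norm_sq]
  set w := velocityNorm bg φ δ h 𝒦 v with hw
  have hw2 := S.velocityNorm_sq (δ := δ) v
  rw [hvΓ, ← hw] at hw2
  have hgrad0 : 0 ≤ ∫ x in ⋃₀ activeMesh bg φ δ 𝒦, gradSq v x :=
    integral_nonneg fun _ => gradSq_nonneg _ _
  have hwpos : 0 < w := by
    refine lt_of_le_of_ne (Real.sqrt_nonneg _) fun h0 => ?_
    have h1 : 0 < h⁻¹ * G := by positivity
    have h2 : w ^ 2 = 0 := by rw [← h0]; exact zero_pow two_ne_zero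
    linarith
  -- The extension and volume estimates give `Ce Cv Y²` for the gradient part; the trace part `h G`
  -- accounts for the `+ 1` in `A`.
  have hwle : h * w ≤ Real.sqrt A * Y := by
    refine (pow_le_pow_iff_left₀ (by positivity) (by positivity) two_ne_zero).1 ?_
    rw [mul_pow, mul_pow, Real.sq_sqrt (by positivity), hw2, hY2]
    have h1 : h ^ 2 * (h⁻¹ * G) = h * G := by field_simp
    have h2 := mul_le_mul_of_nonneg_left hvol hCe
    calc _ = h ^ 2 * (∫ x in ⋃₀ activeMesh bg φ δ 𝒦, gradSq v x) + h * G := by rw [mul_add, h1]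
      _ ≤ Ce * (Cv * (h * G + h ^ 2 * D)) + (h * G + h ^ 2 * D) :=
        add_le_add (hvint.trans h2) (le_add_of_nonneg_right hJ0)
      _ = A * (h * G + h ^ 2 * D) := by rw [hA]; ring
  have hsup : h * G / (Real.sqrt A * Y) ≤ sSup (infSupQuotients bg φ δ h k 𝒦 μ) := by
    refine le_trans ?_ (le_csSup hbdd ⟨v, hvspace, hwpos.ne', rfl⟩)
    rw [hform, div_le_div_iff₀ (by positivity) hwpos]
    calc h * G * w = G * (h * w) := by ring
      _ ≤ G * (Real.sqrt A * Y) := mul_le_mul_of_nonneg_left hwle hG0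
  have hsJ : h ^ 2 * D / (Real.sqrt A * Y) ≤ Real.sqrt (h ^ 2 * D) := by
    rw [div_le_iff₀ (by positivity)]
    have h1 : Real.sqrt (h ^ 2 * D) ≤ Y := Real.sqrt_le_sqrt (le_add_of_nonneg_left (by positivity))
    have h2 : Y ≤ Real.sqrt A * Y := le_mul_of_one_le_left hYpos.le hsA
    calc h ^ 2 * D = Real.sqrt (h ^ 2 * D) * Real.sqrt (h ^ 2 * D) := (Real.mul_self_sqrt hJ0).symm
      _ ≤ Real.sqrt (h ^ 2 * D) * (Real.sqrt A * Y) := by gcongr; exact h1.trans h2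
  calc 1 / Real.sqrt A * Y = h * G / (Real.sqrt A * Y) + h ^ 2 * D / (Real.sqrt A * Y) := by
        rw [← add_div, ← hY2]
        field_simp
    _ ≤ _ := add_le_add hsup hsJ

end UnfittedFEM

theorem mainTheorem6 (d : ℕ) (hd : d = 2 ∨ d = 3) (k : ℕ) (hk : 2 ≤ k)
    (bg : Set (UnfittedFEM.E d)) (hbg_open : IsOpen bg) (hbg_bdd : Bornology.IsBounded bg)
    (hbg_conn : IsConnected bg)
    (σ q : ℝ) (hσ : 0 < σ) (hq : 0 < q)
    (c M ρ : ℝ) (hc : 0 < c) (hρ : 0 < ρ) :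
    ∃ β h₀ : ℝ, 0 < β ∧ 0 < h₀ ∧
      ∀ h : ℝ, 0 < h → h ≤ h₀ →
      ∀ 𝒦 : Geometry.SimplicialComplex ℝ (UnfittedFEM.E d), UnfittedFEM.IsMesh bg σ q h 𝒦 →
      ∀ φ : UnfittedFEM.E d → ℝ, UnfittedFEM.IsLevelSet bg c M ρ φ →
      ∀ δ : ℝ, 0 ≤ δ →
      ∀ μ ∈ UnfittedFEM.multiplierSpace bg φ k 𝒦,
        BddAbove (UnfittedFEM.infSupQuotients bg φ δ h k 𝒦 μ) ∧
        β * UnfittedFEM.multiplierNorm bg φ h 𝒦 μ ≤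
          sSup (UnfittedFEM.infSupQuotients bg φ δ h k 𝒦 μ) +
            Real.sqrt (UnfittedFEM.formJ bg φ h 𝒦 μ μ) := by
  -- With `d = n + 1` the surface dimension `d - 1` is `n` by definition.
  obtain ⟨n, rfl⟩ : ∃ n, d = n + 1 := ⟨d - 1, by omega⟩
  exact UnfittedFEM.exists_infSup n hk hσ hq hc hρ M hbg_open hbg_bdd
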